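/- Let $M\in\mathbb R^{m\times m}$ be symmetric positive semidefinite of rank $p>1$, let $b\in\mathbb R^m$ have nonnegative entries, and let $q<\min(m,p)$. Put $H_b=I_m-\frac{\mathbf 1_m b^T}{\mathbf 1_m^T b}$ if $b\ne 0$, $H_b=I_m$ if $b=0$, and $S=H_bMH_b^T$. Given $A_{(0)}\in\mathbb R^{m\times q}$ and $\delta_{(0)}\in\mathbb R$, the EM updates are $$A_{(t+1)}=SA_{(t)}\bigl(\delta_{(t)}I_q+\Sigma_{(t)}^{-1}A_{(t)}^TSA_{(t)}\bigr)^{-1},\qquad \delta_{(t+1)}=\frac1m\Bigl[\operatorname{tr}(S)-\operatorname{tr}\bigl(A_{(t+1)}\Sigma_{(t)}^{-1}A_{(t)}^TS\bigr)\Bigr],$$ where $\Sigma_{(t)}=\delta_{(t)}I_q+A_{(t)}^TA_{(t)}$. Suppose that $\delta_{(0)}>0$ and $A_{(0)}^Tb=0$. (1) For every $t\ge 0$: $A_{(t)}^Tb=0$, $\delta_{(t)}>0$, and the matrices $\Sigma_{(t)}$ and $\delta_{(t)}I_q+\Sigma_{(t)}^{-1}A_{(t)}^TSA_{(t)}$ are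 invertible. (2) Let $\gamma_1\ge\dots\ge\gamma_m\ (\ge 0)$ be the eigenvalues of $S$ with multiplicity, and suppose that $q\ge1$ and $\gamma_q>\gamma_j>0$ for some $j\in\{q+1,\dots,m\}$. Put $\Gamma_q=\operatorname{diag}(\gamma_1,\dots,\gamma_q)$, and call $U\in\mathbb R^{m\times q}$ principal if $U^TU=I_q$ and $SU=U\Gamma_q$. The maximum-likelihood solutions are the pairs $$\widehat A=U_q(\Gamma_q-\hat\delta I_q)^{1/2}V,\qquad \hat\delta=\frac1{m-q}\sum_{j=q+1}^m\gamma_j,$$ with $U_q$ principal and $V\in\mathbb R^{q\times q}$ orthogonal. Each of them satisfies $\widehat A^Tb=0$ and $\hat\delta>0$, and minimizes $G(A,\delta)=\log|AA^T+\delta I_m|+\operatorname{tr}[(AA^T+\delta I_m)^{-1}S]$ over all $A\in\mathbb R^{m\times q}$ and $\delta\in\mathbb R$ with $A^Tb=0$ and $\delta>0$. The EM iterates converge, $A_{(t)}\to\widehat A$ and $\delta_{(t)}\to\hat\delta$, to one of these solutions if and only if the initial matrix is non-degenerate, i.e. $U^TA_{(0)}$ is invertible for some principal $U$. -/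

import Mathlib

open Filter Topology Matrix

noncomputable section

/-- The centering matrix `H_b = I - (1 bᵀ) / (1ᵀ b)` for `b ≠ 0`, with `H_0 = I`. -/
def centering {m : ℕ} (b : Fin m → ℝ) : Matrix (Fin m) (Fin m) ℝ :=
  open Classical in
  if b = 0 then 1 else 1 - (∑ i, b i)⁻¹ • Matrix.vecMulVec (fun _ => (1 : ℝ)) b

/-- The centered matrix `S = H_b M H_bᵀ`. -/
def centered {m : ℕ} (b : Fin m → ℝ) (M : Matrix (Fin m) (Fin m) ℝ) :
    Matrix (Fin m) (Fin m) ℝ :=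
  centering b * M * (centering b)ᵀ

/-- `Σ = δ I_q + Aᵀ A`. -/
def emSigma {m q : ℕ} (A : Matrix (Fin m) (Fin q) ℝ) (δ : ℝ) : Matrix (Fin q) (Fin q) ℝ :=
  δ • (1 : Matrix (Fin q) (Fin q) ℝ) + Aᵀ * A

/-- The matrix `δ I_q + Σ⁻¹ Aᵀ S A` which is inverted in the update of `A`. -/
def emGain {m q : ℕ} (S : Matrix (Fin m) (Fin m) ℝ) (A : Matrix (Fin m) (Fin q) ℝ) (δ : ℝ) :
    Matrix (Fin q) (Fin q) ℝ :=
  δ • (1 : Matrix (Fin q) (Fin q) ℝ) + (emSigma A δ)⁻¹ * Aᵀ * S * A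

/-- The EM recursion: `A' = S A (δ I + Σ⁻¹ Aᵀ S A)⁻¹` and
`δ' = (tr S - tr (A' Σ⁻¹ Aᵀ S)) / m`. -/
structure IsEMSequence {m q : ℕ} (S : Matrix (Fin m) (Fin m) ℝ)
    (A : ℕ → Matrix (Fin m) (Fin q) ℝ) (δ : ℕ → ℝ) : Prop where
  step_A : ∀ t, A (t + 1) = S * A t * (emGain S (A t) (δ t))⁻¹
  step_δ : ∀ t, δ (t + 1) =
    1 / (m : ℝ) * (S.trace - (A (t + 1) * (emSigma (A t) (δ t))⁻¹ * (A t)ᵀ * S).trace)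

/-- `γ` lists the eigenvalues of `S`, with multiplicity, in descending order
(`γ i` with `i = 0, …, m - 1` is the `(i + 1)`-st largest one). -/
def IsOrderedEigenvalues {m : ℕ} (S : Matrix (Fin m) (Fin m) ℝ) (γ : Fin m → ℝ) : Prop :=
  Antitone γ ∧ S.charpoly = ∏ i, (Polynomial.X - Polynomial.C (γ i))

/-- `U` is column-orthonormal, and its columns are eigenvectors of `S` for the `q` largest
eigenvalues. -/
def IsPrincipal {m q : ℕ} (S : Matrix (Fin m) (Fin m) ℝ) (γ : Fin m → ℝ) (hqm : q < m)
    (U : Matrix (Fin m) (Fin q) ℝ) : Prop :=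
  Uᵀ * U = 1 ∧ S * U = U * Matrix.diagonal (fun i => γ (Fin.castLE hqm.le i))

/-- The estimate `δ̂`, the mean of the `m - q` smallest eigenvalues. -/
def mlRidge {m : ℕ} (q : ℕ) (γ : Fin m → ℝ) : ℝ :=
  1 / ((m : ℝ) - (q : ℝ)) * ∑ j ∈ Finset.univ.filter (fun j : Fin m => q ≤ (j : ℕ)), γ j

/-- The pairs `Â = U_q (Γ_q - δ̂ I)^{1/2} V`, `δ̂ = (γ_{q+1} + … + γ_m) / (m - q)` with `V`
orthogonal and `U_q` a matrix of principal eigenvectors. -/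
def IsMLSolution {m q : ℕ} (S : Matrix (Fin m) (Fin m) ℝ) (γ : Fin m → ℝ) (hqm : q < m)
    (A : Matrix (Fin m) (Fin q) ℝ) (δ : ℝ) : Prop :=
  δ = mlRidge q γ ∧
  ∃ (U : Matrix (Fin m) (Fin q) ℝ) (V : Matrix (Fin q) (Fin q) ℝ),
    IsPrincipal S γ hqm U ∧ V ∈ Matrix.orthogonalGroup (Fin q) ℝ ∧
    A = U * Matrix.diagonal (fun i => Real.sqrt (γ (Fin.castLE hqm.le i) - δ)) * V

/-- The loss `G(A, δ) = log |A Aᵀ + δ I| + tr ((A Aᵀ + δ I)⁻¹ S)`; up to a positive factor and an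
additive constant it is the negative log-likelihood. -/
def lossG {m q : ℕ} (S : Matrix (Fin m) (Fin m) ℝ) (A : Matrix (Fin m) (Fin q) ℝ) (δ : ℝ) : ℝ :=
  Real.log (A * Aᵀ + δ • (1 : Matrix (Fin m) (Fin m) ℝ)).det +
    ((A * Aᵀ + δ • (1 : Matrix (Fin m) (Fin m) ℝ))⁻¹ * S).trace

/-- The admissible parameters: `δ > 0` and `Aᵀ b = 0`. -/
def feasible {m : ℕ} (q : ℕ) (b : Fin m → ℝ) : Set (Matrix (Fin m) (Fin q) ℝ × ℝ) :=
  {x | x.1ᵀ *ᵥ b = 0 ∧ 0 < x.2}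

end

/-! ### Trace, determinant and Frobenius-norm inequalities. -/

section MatrixInequalities

open scoped Matrix.Norms.Frobenius

variable {ι κ : Type*}

/-! EM is majorization-minimization for $G$. A trial Gaussian posterior gives an upper bound
(`surrogate`) that touches $G$ at the true posterior, and both updates minimize this bound exactly.
Completing squares shows that one step lowers $G$ by at least a constant times the squared step
length (`lossG_descent_sq`).

The column space moves by power iteration. For principal $U$ the update reads
$U^TA_{t+1}K_t=\Gamma_q U^TA_t$ with $K_t$ (`emGain`) invertible. Hence $U^TA_t$ is invertible for
one $t$ iff it is for all $t$; since $U^T\widehat A$ is invertible for the $U$ of $\widehat A$,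
convergence forces non-degeneracy. Conversely, the graph coordinate $Y_t=A_t(U^TA_t)^{-1}-U$
satisfies exactly $Y_{t+1}=SY_t\Gamma_q^{-1}$, so in an eigenbasis its entry $(k,i)$ is multiplied
by $\gamma_k/\gamma_i$ at each step. A gap $\gamma_q>\gamma_{q+1}$ is not assumed, so the limiting
subspace depends on $A_0$: choosing $U$ to maximize $|\det(U^TA_0)|$ over the compact set of
principal matrices makes the entries with $\gamma_k\ge\gamma_i$ vanish, and $Y_t=O(\rho^t)$ with
$\rho<1$ (`exists_alignedEM`).

Inside the subspace put $W=U^TA$, $Q=\delta I+WW^T$ and $D=\Gamma_q^{-1}-Q^{-1}$ (`defect`). Up to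
$O(\rho^t)$ the step length bounds $D\Gamma_qW$. To remove $W$, column $i$ of $W^{-1}$ has to stay
bounded; it obeys a linear recursion with multiplier $\delta_t/\gamma_i$, and the update of $\delta$
yields $\limsup\delta_t\le\hat\delta<\gamma_i$ (`limsup_ridge_le`). So $D$ and $\delta-\hat\delta$
are bounded by step length plus $\rho^t$, while the excess loss is quadratic in these quantities.
This is a Łojasiewicz inequality with exponent $1/2$ (`lossG_sub_le`); together with the descent
estimate it makes the excess decay geometrically and the steps summable (`summable_of_descent`), so
the iterates converge.

Global minimality is a by-product: any $(B,\varepsilon)$ is a limit of non-degenerate starting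
points, from which the loss decreases to the optimal value (`optimalLoss_le_lossG`). The constraint
is preserved because $Sb=0$. -/

theorem Matrix.PosSemidef.transpose_eq {S : Matrix ι ι ℝ} (hS : S.PosSemidef) : Sᵀ = S := by
  simpa using hS.isHermitian.eq

theorem posDef_smul_one_add [DecidableEq ι] {N : Matrix ι ι ℝ} (hN : N.PosSemidef) {δ : ℝ}
    (hδ : 0 < δ) : (δ • (1 : Matrix ι ι ℝ) + N).PosDef :=
  (Matrix.PosDef.one.smul hδ).add_posSemidef hN

theorem one_add_sum_le_prod_one_add' (s : Finset ι) (f : ι → ℝ) (hf : ∀ i, 0 ≤ f i) :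
    1 + ∑ i ∈ s, f i ≤ ∏ i ∈ s, (1 + f i) := by
  classical
  induction s using Finset.induction_on with
  | empty => simp
  | insert a s ha ih =>
    rw [Finset.sum_insert ha, Finset.prod_insert ha]
    have h0 : 0 ≤ ∑ i ∈ s, f i := Finset.sum_nonneg fun i _ => hf i
    nlinarith [hf a, mul_le_mul_of_nonneg_left ih (by linarith [hf a] : 0 ≤ 1 + f a),
      mul_nonneg (hf a) h0]

variable [Fintype ι] [Fintype κ]

theorem frobenius_sq_eq_trace (A : Matrix ι κ ℝ) : ‖A‖ ^ 2 = (A * Aᵀ).trace := by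
  rw [Matrix.frobenius_norm_def, ← Real.sqrt_eq_rpow, Real.sq_sqrt (by positivity)]
  simp [Matrix.trace, Matrix.mul_apply, pow_two]

theorem frobenius_sq_eq_trace' (A : Matrix ι κ ℝ) : ‖A‖ ^ 2 = (Aᵀ * A).trace := by
  rw [frobenius_sq_eq_trace, Matrix.trace_mul_comm]

theorem abs_entry_le_frobenius (A : Matrix ι κ ℝ) (i : ι) (j : κ) : |A i j| ≤ ‖A‖ := by
  refine abs_le_of_sq_le_sq ?_ (norm_nonneg _)
  rw [frobenius_sq_eq_trace]
  simp only [Matrix.trace, Matrix.diag, Matrix.mul_apply, Matrix.transpose_apply, ← pow_two]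
  exact (Finset.single_le_sum (f := fun j => A i j ^ 2) (fun _ _ => sq_nonneg _)
    (Finset.mem_univ j)).trans (Finset.single_le_sum (f := fun i => ∑ j, A i j ^ 2)
      (fun _ _ => Finset.sum_nonneg fun _ _ => sq_nonneg _) (Finset.mem_univ i))

theorem abs_trace_le_frobenius (A : Matrix ι ι ℝ) : |A.trace| ≤ Fintype.card ι * ‖A‖ := by
  refine (Finset.abs_sum_le_sum_abs _ _).trans ?_
  refine (Finset.sum_le_card_nsmul _ _ ‖A‖ fun i _ => abs_entry_le_frobenius A i i).trans ?_
  simp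

theorem frobenius_le_sum (A : Matrix ι κ ℝ) : ‖A‖ ≤ ∑ i, ∑ j, |A i j| := by
  refine abs_le_of_sq_le_sq' ?_ (by positivity) |>.2
  rw [frobenius_sq_eq_trace]
  simp only [Matrix.trace, Matrix.diag, Matrix.mul_apply, Matrix.transpose_apply, ← pow_two]
  have h : ∀ i, ∑ j, A i j ^ 2 ≤ (∑ j, |A i j|) ^ 2 := fun i => by
    simpa using Finset.sum_sq_le_sq_sum_of_nonneg (s := Finset.univ) (f := fun j => |A i j|)
      (fun _ _ => abs_nonneg _)
  exact (Finset.sum_le_sum fun i _ => h i).trans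
    (Finset.sum_sq_le_sq_sum_of_nonneg fun _ _ => Finset.sum_nonneg fun _ _ => abs_nonneg _)

open scoped MatrixOrder in
theorem Matrix.PosSemidef.exists_eq_transpose_mul_self [DecidableEq ι] {S : Matrix ι ι ℝ}
    (hS : S.PosSemidef) : ∃ B : Matrix ι ι ℝ, S = Bᵀ * B := by
  obtain ⟨B, hB⟩ := (CStarAlgebra.nonneg_iff_eq_star_mul_self (a := S)).1
    (nonneg_iff_posSemidef.2 hS)
  exact ⟨B, by simpa [Matrix.star_eq_conjTranspose] using hB⟩

theorem Matrix.PosSemidef.conj {S : Matrix ι ι ℝ} (hS : S.PosSemidef) (A : Matrix κ ι ℝ) :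
    (A * S * Aᵀ).PosSemidef := by
  simpa using hS.mul_mul_conjTranspose_same A

theorem Matrix.PosSemidef.conj' {S : Matrix ι ι ℝ} (hS : S.PosSemidef) (A : Matrix ι κ ℝ) :
    (Aᵀ * S * A).PosSemidef := by
  simpa using hS.conj Aᵀ

theorem Matrix.posSemidef_transpose_mul_self' (A : Matrix ι κ ℝ) : (Aᵀ * A).PosSemidef := by
  simpa using Matrix.posSemidef_conjTranspose_mul_self A

theorem Matrix.posSemidef_mul_transpose_self' (A : Matrix ι κ ℝ) : (A * Aᵀ).PosSemidef := by
  simpa using Matrix.posSemidef_self_mul_conjTranspose A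

theorem Matrix.PosSemidef.trace_mul_nonneg [DecidableEq ι] {S T : Matrix ι ι ℝ}
    (hS : S.PosSemidef) (hT : T.PosSemidef) : 0 ≤ (S * T).trace := by
  obtain ⟨B, rfl⟩ := hS.exists_eq_transpose_mul_self
  rw [Matrix.mul_assoc, Matrix.trace_mul_comm]
  exact (hT.conj B).trace_nonneg

theorem trace_eq_sum_eigenvalues' [DecidableEq ι] {Z : Matrix ι ι ℝ} (hZ : Z.IsHermitian) :
    Z.trace = ∑ i, hZ.eigenvalues i := by
  simpa using hZ.trace_eq_sum_eigenvalues

theorem det_eq_prod_eigenvalues' [DecidableEq ι] {Z : Matrix ι ι ℝ} (hZ : Z.IsHermitian) :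
    Z.det = ∏ i, hZ.eigenvalues i := by
  simpa using hZ.det_eq_prod_eigenvalues

theorem Matrix.PosDef.log_det_le [DecidableEq ι] {Z : Matrix ι ι ℝ} (hZ : Z.PosDef) :
    Real.log Z.det ≤ Z.trace - Fintype.card ι := by
  rw [trace_eq_sum_eigenvalues' hZ.isHermitian, det_eq_prod_eigenvalues' hZ.isHermitian,
    Real.log_prod fun i _ => (hZ.eigenvalues_pos i).ne']
  refine (Finset.sum_le_sum fun i _ => Real.log_le_sub_one_of_pos (hZ.eigenvalues_pos i)).trans ?_
  simp

theorem Matrix.PosDef.exists_isUnit_eq_transpose_mul_self [DecidableEq ι] {Z : Matrix ι ι ℝ}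
    (hZ : Z.PosDef) : ∃ B : Matrix ι ι ℝ, IsUnit B.det ∧ Z = Bᵀ * B := by
  obtain ⟨B, hB⟩ := hZ.posSemidef.exists_eq_transpose_mul_self
  refine ⟨B, ?_, hB⟩
  have h := hZ.det_pos
  rw [hB, Matrix.det_mul, Matrix.det_transpose] at h
  exact isUnit_iff_ne_zero.2 fun h0 => by simp [h0] at h

/-- With $X=B^TB$, the positive definite matrix $BZB^T$ has the determinant and the trace of $XZ$,
so the previous bound applies. This is nonnegativity of the relative entropy of centred Gaussians;
the posterior bound and the bound on the excess loss both rest on it. -/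
theorem Matrix.PosDef.log_det_mul_le [DecidableEq ι] {X Z : Matrix ι ι ℝ} (hX : X.PosDef)
    (hZ : Z.PosDef) : Real.log X.det + Real.log Z.det ≤ (X * Z).trace - Fintype.card ι := by
  obtain ⟨B, hB, rfl⟩ := hX.exists_isUnit_eq_transpose_mul_self
  have hP : (B * Z * Bᵀ).PosDef := by
    refine (hZ.posSemidef.conj B).posDef_iff_det_ne_zero.2 ?_
    simp only [Matrix.det_mul, Matrix.det_transpose]
    exact mul_ne_zero (mul_ne_zero hB.ne_zero hZ.det_pos.ne') hB.ne_zero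
  have h := hP.log_det_le
  rw [← Real.log_mul hX.det_pos.ne' hZ.det_pos.ne', Matrix.mul_assoc, Matrix.trace_mul_comm,
    show (Bᵀ * B).det * Z.det = (B * Z * Bᵀ).det by simp only [Matrix.det_mul]; ring]
  exact h

theorem Matrix.PosSemidef.one_add_trace_le_det [DecidableEq ι] {N : Matrix ι ι ℝ}
    (hN : N.PosSemidef) : 1 + N.trace ≤ (1 + N).det := by
  set e := hN.isHermitian.eigenvalues
  -- The determinant is, up to sign, the characteristic polynomial of $N$ at $-1$.
  have hdet : (1 + N).det = ∏ i, (1 + e i) := by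
    have h1 := Matrix.eval_charpoly N (-1)
    rw [hN.isHermitian.charpoly_eq, Polynomial.eval_prod] at h1
    have h2 : (Matrix.scalar ι (-1 : ℝ) - N) = -(1 + N) := by
      rw [map_neg, map_one]; abel
    rw [h2, Matrix.det_neg] at h1
    have h3 : ∏ i, (1 + e i) = (-1) ^ Fintype.card ι * ∏ i, (-1 - e i) := by
      rw [← Finset.card_univ, ← Finset.prod_const, ← Finset.prod_mul_distrib]
      exact Finset.prod_congr rfl fun i _ => by ring
    simp only [Polynomial.eval_sub, Polynomial.eval_X, Polynomial.eval_C, RCLike.ofReal_real_eq_id,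
      id] at h1
    rw [h3, h1, ← mul_assoc, ← mul_pow]
    simp
  rw [hdet, trace_eq_sum_eigenvalues' hN.isHermitian]
  exact one_add_sum_le_prod_one_add' _ _ hN.eigenvalues_nonneg

/-- The inverse $X$ satisfies $X=\delta X^2+XNX$, whence $\delta X_{ii}^2\le X_{ii}$. -/
theorem inv_smul_one_add_diag_le [DecidableEq ι] {N : Matrix ι ι ℝ} (hN : N.PosSemidef) {δ : ℝ}
    (hδ : 0 < δ) (i : ι) : (δ • (1 : Matrix ι ι ℝ) + N)⁻¹ i i ≤ 1 / δ := by
  have hP := posDef_smul_one_add hN hδ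
  set X := (δ • (1 : Matrix ι ι ℝ) + N)⁻¹ with hXdef
  have hX : Xᵀ = X := hP.inv.posSemidef.transpose_eq
  have h1 : X = δ • (Xᵀ * X) + Xᵀ * N * X := by
    have : X * (δ • (1 : Matrix ι ι ℝ) + N) * X = X := by
      rw [hXdef, Matrix.nonsing_inv_mul _ ((Matrix.isUnit_iff_isUnit_det _).1 hP.isUnit),
        Matrix.one_mul]
    rw [hX]
    conv_lhs => rw [← this]
    simp [Matrix.mul_add, Matrix.add_mul, Matrix.mul_assoc]
  have h2 : 0 ≤ (Xᵀ * N * X) i i := (hN.conj' X).diag_nonneg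
  have h3 : X i i ^ 2 ≤ (Xᵀ * X) i i := by
    simp only [Matrix.mul_apply, Matrix.transpose_apply, ← pow_two]
    exact Finset.single_le_sum (f := fun j => X j i ^ 2) (fun _ _ => sq_nonneg _)
      (Finset.mem_univ i)
  have h4 := congrFun (congrFun h1 i) i
  simp only [Matrix.add_apply, Matrix.smul_apply, smul_eq_mul] at h4
  have h5 : 0 < X i i := hP.inv.diag_pos
  rw [le_div_iff₀ hδ]
  have h6 : δ * X i i ^ 2 ≤ X i i := by nlinarith
  nlinarith

theorem frobenius_inv_smul_one_add_le [DecidableEq ι] {N : Matrix ι ι ℝ} (hN : N.PosSemidef)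
    {δ : ℝ} (hδ : 0 < δ) : ‖(δ • (1 : Matrix ι ι ℝ) + N)⁻¹‖ ≤ Fintype.card ι / δ := by
  have hP := posDef_smul_one_add hN hδ
  have hd := inv_smul_one_add_diag_le hN hδ
  set X := (δ • (1 : Matrix ι ι ℝ) + N)⁻¹ with hXdef
  obtain ⟨B, hB⟩ := hP.inv.posSemidef.exists_eq_transpose_mul_self
  rw [← hXdef] at hB
  calc ‖X‖ = ‖Bᵀ * B‖ := by rw [← hB]
    _ ≤ ‖Bᵀ‖ * ‖B‖ := Matrix.frobenius_norm_mul _ _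
    _ = X.trace := by rw [Matrix.frobenius_norm_transpose, ← pow_two, frobenius_sq_eq_trace', hB]
    _ ≤ ∑ _i : ι, 1 / δ := Finset.sum_le_sum fun i _ => hd i
    _ = Fintype.card ι / δ := by simp [div_eq_mul_inv]

/-- Factor $Z^{-1}=B^TB$ and apply submultiplicativity to $D=(DB^T)(B^T)^{-1}$. This turns the
weighted norms produced by the descent estimate into plain ones. -/
theorem frobenius_sq_le_trace_mul_inv [DecidableEq ι] {Z : Matrix ι ι ℝ} (hZ : Z.PosDef)
    (D : Matrix κ ι ℝ) : ‖D‖ ^ 2 ≤ (D * Z⁻¹ * Dᵀ).trace * Z.trace := by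
  obtain ⟨B, hB, hZB⟩ := hZ.inv.exists_isUnit_eq_transpose_mul_self
  have h1 : D = D * Bᵀ * Bᵀ⁻¹ := by
    rw [Matrix.mul_nonsing_inv_cancel_right _ _ (by simpa using hB)]
  have h2 : Z = B⁻¹ * Bᵀ⁻¹ := by
    rw [← Matrix.mul_inv_rev, ← hZB, Matrix.nonsing_inv_nonsing_inv _
      ((Matrix.isUnit_iff_isUnit_det _).1 hZ.isUnit)]
  have h3 : (D * Z⁻¹ * Dᵀ).trace = ‖D * Bᵀ‖ ^ 2 := by
    rw [frobenius_sq_eq_trace, hZB]; simp [Matrix.mul_assoc]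
  have h4 : Z.trace = ‖Bᵀ⁻¹‖ ^ 2 := by
    rw [frobenius_sq_eq_trace', h2, Matrix.transpose_nonsing_inv, Matrix.transpose_transpose]
  rw [h3, h4, ← mul_pow]
  conv_lhs => rw [h1]
  exact pow_le_pow_left₀ (norm_nonneg _) (Matrix.frobenius_norm_mul _ _) 2

end MatrixInequalities

/-! ### EM as majorization-minimization: the variational bound. -/

noncomputable section Surrogate

open scoped Matrix.Norms.Frobenius

variable {m q : ℕ}

/-- The posterior regression matrix `Σ⁻¹ Aᵀ`. -/
def emLoading (A : Matrix (Fin m) (Fin q) ℝ) (δ : ℝ) : Matrix (Fin q) (Fin m) ℝ :=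
  (emSigma A δ)⁻¹ * Aᵀ

/-- The posterior second moment `B S Bᵀ + δ Σ⁻¹` of the latent variable, `B = Σ⁻¹ Aᵀ`. -/
def emMoment (S : Matrix (Fin m) (Fin m) ℝ) (A : Matrix (Fin m) (Fin q) ℝ) (δ : ℝ) :
    Matrix (Fin q) (Fin q) ℝ :=
  emLoading A δ * S * (emLoading A δ)ᵀ + δ • (emSigma A δ)⁻¹

/-- The variational upper bound of `lossG` given by a Gaussian posterior with regression
matrix `B` and covariance `Φ`. -/
def surrogate (S : Matrix (Fin m) (Fin m) ℝ) (A : Matrix (Fin m) (Fin q) ℝ) (δ : ℝ)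
    (B : Matrix (Fin q) (Fin m) ℝ) (Φ : Matrix (Fin q) (Fin q) ℝ) : ℝ :=
  m * Real.log δ + 1 / δ * (S.trace - 2 * (A * B * S).trace
    + (A * (B * S * Bᵀ + Φ) * Aᵀ).trace) + (B * S * Bᵀ + Φ).trace - Real.log Φ.det - q

variable {S : Matrix (Fin m) (Fin m) ℝ} {A : Matrix (Fin m) (Fin q) ℝ} {δ : ℝ}

theorem emSigma_posDef (A : Matrix (Fin m) (Fin q) ℝ) (hδ : 0 < δ) : (emSigma A δ).PosDef :=
  posDef_smul_one_add (posSemidef_transpose_mul_self' A) hδ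

theorem emSigma_isUnit_det (A : Matrix (Fin m) (Fin q) ℝ) (hδ : 0 < δ) :
    IsUnit (emSigma A δ).det :=
  (Matrix.isUnit_iff_isUnit_det _).1 (emSigma_posDef A hδ).isUnit

theorem emSigma_transpose (A : Matrix (Fin m) (Fin q) ℝ) (δ : ℝ) :
    (emSigma A δ)ᵀ = emSigma A δ := by
  simp [emSigma]

theorem emSigma_inv_transpose (A : Matrix (Fin m) (Fin q) ℝ) (δ : ℝ) :
    ((emSigma A δ)⁻¹)ᵀ = (emSigma A δ)⁻¹ := by
  rw [Matrix.transpose_nonsing_inv, emSigma_transpose]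

theorem emLoading_transpose (A : Matrix (Fin m) (Fin q) ℝ) (δ : ℝ) :
    (emLoading A δ)ᵀ = A * (emSigma A δ)⁻¹ := by
  simp [emLoading, emSigma_inv_transpose]

theorem emMoment_posDef (hS : S.PosSemidef) (A : Matrix (Fin m) (Fin q) ℝ) (hδ : 0 < δ) :
    (emMoment S A δ).PosDef :=
  Matrix.PosDef.posSemidef_add (hS.conj _) ((emSigma_posDef A hδ).inv.smul hδ)

/-- The gain is not symmetric, but this factorization into two positive definite matrices makes it
invertible and turns the update into normal equations for the posterior moment. -/
theorem emGain_eq (S : Matrix (Fin m) (Fin m) ℝ) (A : Matrix (Fin m) (Fin q) ℝ) (hδ : 0 < δ) :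
    emGain S A δ = emMoment S A δ * emSigma A δ := by
  have hu := emSigma_isUnit_det A hδ
  simp only [emGain, emMoment, emLoading_transpose, Matrix.add_mul, Matrix.smul_mul,
    Matrix.nonsing_inv_mul _ hu]
  rw [add_comm]
  simp only [emLoading, Matrix.mul_assoc, Matrix.nonsing_inv_mul _ hu, Matrix.mul_one]

theorem emGain_isUnit (hS : S.PosSemidef) (A : Matrix (Fin m) (Fin q) ℝ) (hδ : 0 < δ) :
    IsUnit (emGain S A δ) := by
  rw [emGain_eq S A hδ]
  exact (emMoment_posDef hS A hδ).isUnit.mul (emSigma_posDef A hδ).isUnit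

theorem emGain_isUnit_det (hS : S.PosSemidef) (A : Matrix (Fin m) (Fin q) ℝ) (hδ : 0 < δ) :
    IsUnit (emGain S A δ).det :=
  (Matrix.isUnit_iff_isUnit_det _).1 (emGain_isUnit hS A hδ)

/-- The normal equations of the update of `A`. -/
theorem emStep_mul_emMoment (hS : S.PosSemidef) (hδ : 0 < δ) {A' : Matrix (Fin m) (Fin q) ℝ}
    (hA' : A' = S * A * (emGain S A δ)⁻¹) : A' * emMoment S A δ = S * (emLoading A δ)ᵀ := by
  have h1 : emMoment S A δ = emGain S A δ * (emSigma A δ)⁻¹ := by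
    rw [emGain_eq S A hδ, Matrix.mul_nonsing_inv_cancel_right _ _ (emSigma_isUnit_det A hδ)]
  rw [h1, hA', ← Matrix.mul_assoc,
    Matrix.nonsing_inv_mul_cancel_right _ _ (emGain_isUnit_det hS A hδ), emLoading_transpose,
    Matrix.mul_assoc]

/-- Expanding the square and using the normal equations exhibits $m\delta'$ as an expected squared
residual, a sum of nonnegative terms. Both the positivity of $\delta'$ and its uniform lower bound
come from this form. -/
theorem trace_emStep_eq (hS : S.PosSemidef) (hδ : 0 < δ) {A' : Matrix (Fin m) (Fin q) ℝ}
    (hA' : A' = S * A * (emGain S A δ)⁻¹) :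
    S.trace - (A' * (emSigma A δ)⁻¹ * Aᵀ * S).trace =
      ((1 - A' * emLoading A δ) * S * (1 - A' * emLoading A δ)ᵀ).trace
        + δ * (A' * (emSigma A δ)⁻¹ * A'ᵀ).trace := by
  have h := congrArg (fun M => (M * A'ᵀ).trace) (emStep_mul_emMoment hS hδ hA')
  have h2 : (S * (emLoading A δ)ᵀ * A'ᵀ).trace = (A' * emLoading A δ * S).trace := by
    rw [← Matrix.trace_transpose]
    simp [Matrix.mul_assoc, hS.transpose_eq]
  have h3 : (A' * (emSigma A δ)⁻¹ * Aᵀ * S) = A' * emLoading A δ * S := by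
    simp [emLoading, Matrix.mul_assoc]
  simp only [emMoment, Matrix.mul_add, Matrix.add_mul, Matrix.trace_add, Matrix.mul_smul,
    Matrix.smul_mul, Matrix.trace_smul, smul_eq_mul] at h
  rw [h3]
  simp only [Matrix.transpose_sub, Matrix.transpose_mul, Matrix.transpose_one, Matrix.sub_mul,
    Matrix.mul_sub, Matrix.one_mul, Matrix.mul_one, Matrix.trace_sub]
  simp only [Matrix.mul_assoc] at h h2 ⊢
  linarith

/-- The update of `A` minimizes the surrogate, which is quadratic in `A`. -/
theorem trace_quadratic_sub (hS : S.PosSemidef) (hδ : 0 < δ) {A' : Matrix (Fin m) (Fin q) ℝ}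
    (hA' : A' = S * A * (emGain S A δ)⁻¹) (C : Matrix (Fin m) (Fin q) ℝ) :
    (S.trace - 2 * (C * emLoading A δ * S).trace + (C * emMoment S A δ * Cᵀ).trace) =
      (S.trace - (A' * (emSigma A δ)⁻¹ * Aᵀ * S).trace)
        + ((C - A') * emMoment S A δ * (C - A')ᵀ).trace := by
  have hR := emStep_mul_emMoment hS hδ hA'
  have hRt : (emMoment S A δ)ᵀ = emMoment S A δ := (emMoment_posDef hS A hδ).posSemidef.transpose_eq
  have h3 : (A' * (emSigma A δ)⁻¹ * Aᵀ * S) = A' * emLoading A δ * S := by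
    simp [emLoading, Matrix.mul_assoc]
  have h1 : ∀ C : Matrix (Fin m) (Fin q) ℝ,
      (A' * emMoment S A δ * Cᵀ).trace = (C * emLoading A δ * S).trace := fun C => by
    rw [hR, ← Matrix.trace_transpose]; simp [Matrix.mul_assoc, hS.transpose_eq]
  have h2 : (C * emMoment S A δ * A'ᵀ).trace = (C * emLoading A δ * S).trace := by
    rw [← h1, ← Matrix.trace_transpose]; simp [Matrix.mul_assoc, hRt]
  rw [h3]
  simp only [Matrix.transpose_sub, Matrix.sub_mul, Matrix.mul_sub, Matrix.trace_sub, h1, h2]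
  ring

/-- Woodbury's identity; it follows from $(AA^T+\delta I)A=A\Sigma$. -/
theorem inv_covariance (A : Matrix (Fin m) (Fin q) ℝ) (hδ : 0 < δ) :
    (A * Aᵀ + δ • (1 : Matrix (Fin m) (Fin m) ℝ))⁻¹ =
      (1 / δ) • (1 - A * (emSigma A δ)⁻¹ * Aᵀ) := by
  have hu := emSigma_isUnit_det A hδ
  refine Matrix.inv_eq_right_inv ?_
  have h1 : (A * Aᵀ + δ • (1 : Matrix (Fin m) (Fin m) ℝ)) * A = A * emSigma A δ := by
    simp [emSigma, Matrix.add_mul, Matrix.mul_add, Matrix.mul_assoc, add_comm]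
  rw [Matrix.mul_smul, Matrix.mul_sub, Matrix.mul_one, ← Matrix.mul_assoc, ← Matrix.mul_assoc, h1,
    Matrix.mul_nonsing_inv_cancel_right _ _ hu, add_sub_cancel_left, smul_smul,
    one_div_mul_cancel hδ.ne', one_smul]

theorem log_det_covariance (A : Matrix (Fin m) (Fin q) ℝ) (hδ : 0 < δ) :
    Real.log (A * Aᵀ + δ • (1 : Matrix (Fin m) (Fin m) ℝ)).det =
      ((m : ℝ) - q) * Real.log δ + Real.log (emSigma A δ).det := by
  have h1 : A * Aᵀ + δ • (1 : Matrix (Fin m) (Fin m) ℝ) = δ • (1 + (δ⁻¹ • A) * Aᵀ) := by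
    simp [smul_smul, mul_inv_cancel₀ hδ.ne', add_comm]
  have h2 : emSigma A δ = δ • (1 + Aᵀ * (δ⁻¹ • A)) := by
    simp [emSigma, smul_smul, mul_inv_cancel₀ hδ.ne']
  have h3 : (emSigma A δ).det ≠ 0 := (emSigma_posDef A hδ).det_pos.ne'
  rw [h1]
  rw [h2] at h3 ⊢
  rw [Matrix.det_smul, Matrix.det_smul, Matrix.det_one_add_mul_comm]
  rw [Matrix.det_smul] at h3
  have h4 := right_ne_zero_of_mul h3
  rw [Real.log_mul (pow_ne_zero _ hδ.ne') h4, Real.log_mul (pow_ne_zero _ hδ.ne') h4,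
    Real.log_pow, Real.log_pow]
  simp
  ring

theorem lossG_eq (S : Matrix (Fin m) (Fin m) ℝ) (A : Matrix (Fin m) (Fin q) ℝ) (hδ : 0 < δ) :
    lossG S A δ = ((m : ℝ) - q) * Real.log δ + Real.log (emSigma A δ).det
      + 1 / δ * (S.trace - (A * (emSigma A δ)⁻¹ * Aᵀ * S).trace) := by
  rw [lossG, log_det_covariance A hδ, inv_covariance A hδ]
  simp [Matrix.sub_mul, Matrix.trace_sub]

/-- Completing the square in $B$ separates the regression error of the trial posterior from its
covariance error. -/
theorem surrogate_eq (hS : S.PosSemidef) (A : Matrix (Fin m) (Fin q) ℝ) (hδ : 0 < δ)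
    (B : Matrix (Fin q) (Fin m) ℝ) (Φ : Matrix (Fin q) (Fin q) ℝ) :
    surrogate S A δ B Φ = m * Real.log δ
      + 1 / δ * (S.trace - (A * (emSigma A δ)⁻¹ * Aᵀ * S).trace)
      + 1 / δ * ((B - emLoading A δ)ᵀ * emSigma A δ * (B - emLoading A δ) * S).trace
      + ((1 / δ) • emSigma A δ * Φ).trace - Real.log Φ.det - q := by
  have hu := emSigma_isUnit_det A hδ
  have h1 : ((B - emLoading A δ)ᵀ * emSigma A δ * (B - emLoading A δ) * S).trace =
      (Bᵀ * emSigma A δ * B * S).trace - 2 * (A * B * S).trace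
        + (A * (emSigma A δ)⁻¹ * Aᵀ * S).trace := by
    have e1 : (Bᵀ * emSigma A δ * emLoading A δ * S).trace = (A * B * S).trace := by
      rw [emLoading, Matrix.mul_assoc Bᵀ, Matrix.mul_nonsing_inv_cancel_left _ _ hu,
        ← Matrix.trace_transpose]
      simp only [Matrix.transpose_mul, Matrix.transpose_transpose, hS.transpose_eq]
      rw [Matrix.trace_mul_comm]
    simp only [Matrix.transpose_sub, Matrix.sub_mul, Matrix.mul_sub, Matrix.trace_sub, e1,
      emLoading_transpose, Matrix.nonsing_inv_mul_cancel_right _ _ hu]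
    simp only [emLoading, Matrix.mul_assoc]
    ring
  have h2 : (Bᵀ * emSigma A δ * B * S).trace =
      δ * (B * S * Bᵀ).trace + (A * (B * S * Bᵀ) * Aᵀ).trace := by
    have e1 : (A * (B * S * Bᵀ) * Aᵀ).trace = (Bᵀ * (Aᵀ * A) * B * S).trace := by
      rw [Matrix.trace_mul_comm, Matrix.trace_mul_comm _ S, Matrix.trace_mul_comm S]
      simp only [← Matrix.mul_assoc]
      rw [Matrix.trace_mul_comm]
      simp only [← Matrix.mul_assoc]
    have e2 : (B * S * Bᵀ).trace = (Bᵀ * B * S).trace := by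
      rw [Matrix.trace_mul_comm, ← Matrix.mul_assoc]
    rw [e1, e2, emSigma]
    simp [Matrix.mul_add, Matrix.add_mul]
  have h3 : (emSigma A δ * Φ).trace = δ * Φ.trace + (A * Φ * Aᵀ).trace := by
    rw [Matrix.trace_mul_comm (A * Φ), ← Matrix.mul_assoc]
    simp [emSigma, Matrix.add_mul]
  rw [h1, h2, surrogate, Matrix.smul_mul, Matrix.trace_smul, h3]
  simp only [Matrix.mul_add, Matrix.add_mul, Matrix.trace_add, smul_eq_mul]
  field_simp
  ring

/-- The square in `surrogate_eq` is nonnegative, and the terms in $\Phi$ are controlled by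
`log_det_mul_le` applied to $\Sigma/\delta$ and $\Phi$. -/
theorem lossG_le_surrogate (hS : S.PosSemidef) (A : Matrix (Fin m) (Fin q) ℝ) (hδ : 0 < δ)
    (B : Matrix (Fin q) (Fin m) ℝ) {Φ : Matrix (Fin q) (Fin q) ℝ} (hΦ : Φ.PosDef) :
    lossG S A δ ≤ surrogate S A δ B Φ := by
  have hP := emSigma_posDef A hδ
  have h1 := ((emSigma_posDef A hδ).smul (one_div_pos.2 hδ)).log_det_mul_le hΦ
  rw [Matrix.det_smul, Real.log_mul (by positivity) hP.det_pos.ne', Real.log_pow] at h1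
  have h2 : 0 ≤ 1 / δ *
      ((B - emLoading A δ)ᵀ * emSigma A δ * (B - emLoading A δ) * S).trace :=
    mul_nonneg (by positivity) ((hP.posSemidef.conj' _).trace_mul_nonneg hS)
  rw [lossG_eq S A hδ, surrogate_eq hS A hδ]
  simp only [Fintype.card_fin, one_div, Real.log_inv] at h1 h2 ⊢
  linarith

theorem surrogate_self (hS : S.PosSemidef) (A : Matrix (Fin m) (Fin q) ℝ) (hδ : 0 < δ) :
    surrogate S A δ (emLoading A δ) (δ • (emSigma A δ)⁻¹) = lossG S A δ := by
  have hP := emSigma_posDef A hδ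
  rw [lossG_eq S A hδ, surrogate_eq hS A hδ, Matrix.smul_mul, Matrix.mul_smul,
    Matrix.mul_nonsing_inv _ (emSigma_isUnit_det A hδ), smul_smul, one_div_mul_cancel hδ.ne',
    Matrix.det_smul, Real.log_mul (by positivity) hP.inv.det_pos.ne', Real.log_pow,
    Matrix.det_nonsing_inv, Ring.inverse_eq_inv', Real.log_inv]
  simp
  ring

end Surrogate

/-! ### Positivity of the ridge and quantitative descent of the loss. -/

section Descent

open scoped Matrix.Norms.Frobenius

variable {m q : ℕ} {S : Matrix (Fin m) (Fin m) ℝ}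

theorem dim_pos_of_trace_pos (htr : 0 < S.trace) : 0 < m := by
  rcases Nat.eq_zero_or_pos m with rfl | h
  · simp [Matrix.trace] at htr
  · exact h

theorem emStep_ridge_pos (hS : S.PosSemidef) (htr : 0 < S.trace)
    {A A' : Matrix (Fin m) (Fin q) ℝ} {δ δ' : ℝ} (hδ : 0 < δ)
    (hA' : A' = S * A * (emGain S A δ)⁻¹)
    (hδ' : δ' = 1 / (m : ℝ) * (S.trace - (A' * (emSigma A δ)⁻¹ * Aᵀ * S).trace)) : 0 < δ' := by
  have hm : (0 : ℝ) < m := by exact_mod_cast dim_pos_of_trace_pos htr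
  rw [hδ']
  refine mul_pos (by positivity) ?_
  have h1 : 0 ≤ ((1 - A' * emLoading A δ) * S * (1 - A' * emLoading A δ)ᵀ).trace :=
    (hS.conj _).trace_nonneg
  have hZ := emSigma_posDef A hδ
  by_cases h0 : A' = 0
  · simpa [h0] using htr
  · rw [trace_emStep_eq hS hδ hA']
    have h2 := frobenius_sq_le_trace_mul_inv hZ A'
    have h3 : 0 < ‖A'‖ ^ 2 := by have := norm_pos_iff.2 h0; positivity
    have h4 : 0 ≤ (A' * (emSigma A δ)⁻¹ * A'ᵀ).trace := (hZ.inv.posSemidef.conj _).trace_nonneg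
    have h5 : 0 < (A' * (emSigma A δ)⁻¹ * A'ᵀ).trace :=
      lt_of_le_of_ne h4 fun h => by rw [← h] at h2; linarith
    nlinarith [mul_pos hδ h5]

/-- By the normal equations the subtracted trace equals $\operatorname{tr}(A'RA'^T)$ with $R$ the
posterior moment, which is nonnegative. -/
theorem emStep_ridge_le (hS : S.PosSemidef)
    {A A' : Matrix (Fin m) (Fin q) ℝ} {δ δ' : ℝ} (hδ : 0 < δ)
    (hA' : A' = S * A * (emGain S A δ)⁻¹)
    (hδ' : δ' = 1 / (m : ℝ) * (S.trace - (A' * (emSigma A δ)⁻¹ * Aᵀ * S).trace)) :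
    δ' ≤ 1 / (m : ℝ) * S.trace := by
  rw [hδ']
  refine mul_le_mul_of_nonneg_left ?_ (by positivity)
  have h2 : (A' * emMoment S A δ * A'ᵀ).trace = (A' * (emSigma A δ)⁻¹ * Aᵀ * S).trace := by
    rw [emStep_mul_emMoment hS hδ hA', ← Matrix.trace_transpose]
    simp [Matrix.mul_assoc, hS.transpose_eq, emLoading]
  have h3 := ((emMoment_posDef hS A hδ).posSemidef.conj A').trace_nonneg
  rw [h2] at h3
  linarith

/-- From $\log x=2\log\sqrt x\le 2(\sqrt x-1)$ one gets $x-1-\log x\ge(\sqrt x-1)^2=(x-1)^2/(\sqrt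
x+1)^2$. -/
theorem sq_div_le_sub_one_sub_log {x : ℝ} (hx : 0 < x) :
    (x - 1) ^ 2 / (2 * (x + 1)) ≤ x - 1 - Real.log x := by
  have h1 : Real.log x ≤ 2 * (√x - 1) := by
    have h := Real.log_le_sub_one_of_pos (Real.sqrt_pos.2 hx)
    rw [Real.log_sqrt hx.le] at h
    linarith
  have h2 : √x ^ 2 = x := Real.sq_sqrt hx.le
  rw [div_le_iff₀ (by positivity)]
  have h3 : (x - 1) ^ 2 = (√x - 1) ^ 2 * (√x + 1) ^ 2 := by
    rw [← mul_pow]; congr 1; nlinarith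
  have h4 : (√x - 1) ^ 2 ≤ x - 1 - Real.log x := by nlinarith
  have h5 : (√x + 1) ^ 2 ≤ 2 * (x + 1) := by nlinarith [sq_nonneg (√x - 1)]
  rw [h3]
  exact mul_le_mul h4 h5 (sq_nonneg _) ((sq_nonneg _).trans h4)

/-- The posterior at $(A,\delta)$ is a trial posterior at $(A',\delta')$. The surrogate drops
between the two points by exactly the two extra terms: a quadratic one from the update of $A$ and a
logarithmic one from the update of $\delta$. -/
theorem lossG_descent (hS : S.PosSemidef) (htr : 0 < S.trace)
    {A A' : Matrix (Fin m) (Fin q) ℝ} {δ δ' : ℝ} (hδ : 0 < δ)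
    (hA' : A' = S * A * (emGain S A δ)⁻¹)
    (hδ' : δ' = 1 / (m : ℝ) * (S.trace - (A' * (emSigma A δ)⁻¹ * Aᵀ * S).trace)) :
    lossG S A' δ' + 1 / δ * ((A - A') * emMoment S A δ * (A - A')ᵀ).trace
      + m * (δ' / δ - 1 - Real.log (δ' / δ)) ≤ lossG S A δ := by
  have hm : (0 : ℝ) < m := by exact_mod_cast dim_pos_of_trace_pos htr
  have hδ'0 := emStep_ridge_pos hS htr hδ hA' hδ'
  have h1 := lossG_le_surrogate hS A' hδ'0 (emLoading A δ)
    ((emSigma_posDef A hδ).inv.smul hδ)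
  rw [← surrogate_self hS A hδ]
  refine (add_le_add_left (add_le_add_left h1 _) _).trans (le_of_eq ?_)
  have h2 := trace_quadratic_sub hS hδ hA' A
  have h3 := trace_quadratic_sub hS hδ hA' A'
  have h4 : S.trace - (A' * (emSigma A δ)⁻¹ * Aᵀ * S).trace = m * δ' := by
    rw [hδ', ← mul_assoc, mul_one_div_cancel hm.ne', one_mul]
  rw [h4] at h2 h3
  simp only [sub_self, Matrix.zero_mul, Matrix.trace_zero, add_zero] at h3
  simp only [emMoment] at h2 h3 ⊢
  rw [surrogate, surrogate, h2, h3, Real.log_div hδ'0.ne' hδ.ne']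
  field_simp
  ring

theorem trace_emSigma (A : Matrix (Fin m) (Fin q) ℝ) (δ : ℝ) :
    (emSigma A δ).trace = q * δ + ‖A‖ ^ 2 := by
  rw [frobenius_sq_eq_trace', emSigma, Matrix.trace_add, Matrix.trace_smul]
  simp [mul_comm]

theorem lossG_descent_sq (hS : S.PosSemidef) (htr : 0 < S.trace)
    {A A' : Matrix (Fin m) (Fin q) ℝ} {δ δ' K : ℝ} (hδ : 0 < δ)
    (hA' : A' = S * A * (emGain S A δ)⁻¹)
    (hδ' : δ' = 1 / (m : ℝ) * (S.trace - (A' * (emSigma A δ)⁻¹ * Aᵀ * S).trace))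
    (hδK : δ ≤ K) (hδK' : δ' ≤ K) (hAK : ‖A‖ ≤ K) :
    ‖A' - A‖ ^ 2 + (δ' - δ) ^ 2 ≤ (q * K + 5 * K ^ 2) * (lossG S A δ - lossG S A' δ') := by
  have hm : (1 : ℝ) ≤ m := by exact_mod_cast dim_pos_of_trace_pos htr
  have hδ'0 := emStep_ridge_pos hS htr hδ hA' hδ'
  have h := lossG_descent hS htr hδ hA' hδ'
  have hZ := emSigma_posDef A hδ
  set t₁ := ((A - A') * (emSigma A δ)⁻¹ * (A - A')ᵀ).trace with ht₁
  have ht₁0 : 0 ≤ t₁ := (hZ.inv.posSemidef.conj _).trace_nonneg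
  -- Only the part $\delta\Sigma^{-1}$ of the moment is kept; its $\delta$ cancels the factor
  -- $1/\delta$.
  have h1 : t₁ ≤ 1 / δ * ((A - A') * emMoment S A δ * (A - A')ᵀ).trace := by
    rw [emMoment, Matrix.mul_add, Matrix.add_mul, Matrix.trace_add, Matrix.mul_smul,
      Matrix.smul_mul, Matrix.trace_smul, smul_eq_mul, ← ht₁, mul_add, ← mul_assoc (1 / δ),
      one_div_mul_cancel hδ.ne', one_mul]
    have := ((hS.conj (emLoading A δ)).conj (A - A')).trace_nonneg
    have : 0 ≤ 1 / δ * ((A - A') * (emLoading A δ * S * (emLoading A δ)ᵀ) * (A - A')ᵀ).trace :=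
      mul_nonneg (by positivity) this
    linarith
  have h2 : ‖A' - A‖ ^ 2 ≤ t₁ * (q * K + K ^ 2) := by
    rw [norm_sub_rev]
    refine (frobenius_sq_le_trace_mul_inv hZ _).trans (mul_le_mul_of_nonneg_left ?_ ht₁0)
    rw [trace_emSigma]
    gcongr
  set t₂ := δ' / δ - 1 - Real.log (δ' / δ)
  -- The factor $4K^2$ bounds $2\delta(\delta'+\delta)$; with $\operatorname{tr}\Sigma\le qK+K^2$
  -- from `h2` it accounts for the constant $qK+5K^2$.
  have h3 : (δ' - δ) ^ 2 ≤ 4 * K ^ 2 * t₂ := by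
    have h4 := sq_div_le_sub_one_sub_log (div_pos hδ'0 hδ)
    have h5 : (δ' / δ - 1) ^ 2 / (2 * (δ' / δ + 1)) = (δ' - δ) ^ 2 / (2 * δ * (δ' + δ)) := by
      field_simp
    rw [h5, div_le_iff₀ (by positivity)] at h4
    refine h4.trans ?_
    have ht₂ : 0 ≤ t₂ := by linarith [Real.log_le_sub_one_of_pos (div_pos hδ'0 hδ)]
    rw [mul_comm]
    refine mul_le_mul_of_nonneg_right ?_ ht₂
    nlinarith [mul_le_mul hδK hδK hδ.le (hδ.le.trans hδK),
      mul_le_mul hδK hδK' hδ'0.le (hδ.le.trans hδK)]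
  have ht₂0 : 0 ≤ t₂ := by linarith [Real.log_le_sub_one_of_pos (div_pos hδ'0 hδ)]
  have hK : 0 ≤ K := hδ.le.trans hδK
  have h6 : t₁ + t₂ ≤ lossG S A δ - lossG S A' δ' := by nlinarith
  have h7 : 0 ≤ q * K + K ^ 2 := by positivity
  nlinarith [mul_le_mul_of_nonneg_left h6 (by positivity : 0 ≤ q * K + 5 * K ^ 2),
    mul_nonneg h7 ht₂0, mul_nonneg (sq_nonneg K) ht₁0, mul_nonneg (sq_nonneg K) ht₂0]

variable {A : ℕ → Matrix (Fin m) (Fin q) ℝ} {δ : ℕ → ℝ}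

theorem IsEMSequence.ridge_pos (hEM : IsEMSequence S A δ) (hS : S.PosSemidef)
    (htr : 0 < S.trace) (hδ : 0 < δ 0) (t : ℕ) : 0 < δ t := by
  induction t with
  | zero => exact hδ
  | succ t ih => exact emStep_ridge_pos hS htr ih (hEM.step_A t) (hEM.step_δ t)

theorem IsEMSequence.lossG_antitone (hEM : IsEMSequence S A δ) (hS : S.PosSemidef)
    (htr : 0 < S.trace) (hδ : 0 < δ 0) : Antitone fun t => lossG S (A t) (δ t) := by
  refine antitone_nat_of_succ_le fun t => ?_
  have hδt := hEM.ridge_pos hS htr hδ t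
  -- Only the sign of the decrease matters here, so the bound $K$ may depend on $t$.
  have h := lossG_descent_sq hS htr hδt (hEM.step_A t) (hEM.step_δ t)
    (K := δ t + δ (t + 1) + ‖A t‖)
    (by linarith [hEM.ridge_pos hS htr hδ (t + 1), norm_nonneg (A t)])
    (by linarith [norm_nonneg (A t)]) (by linarith [hEM.ridge_pos hS htr hδ (t + 1)])
  have hK : 0 < δ t + δ (t + 1) + ‖A t‖ := by
    have := hEM.ridge_pos hS htr hδ (t + 1); positivity
  have h2 : 0 ≤ ‖A (t + 1) - A t‖ ^ 2 + (δ (t + 1) - δ t) ^ 2 := by positivity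
  have h3 : 0 ≤ lossG S (A t) (δ t) - lossG S (A (t + 1)) (δ (t + 1)) :=
    nonneg_of_mul_nonneg_right (h2.trans h) (by positivity)
  linarith

/-- Every parameter is the initial value of an EM sequence. -/
theorem exists_isEMSequence (S : Matrix (Fin m) (Fin m) ℝ) (A₀ : Matrix (Fin m) (Fin q) ℝ)
    (δ₀ : ℝ) : ∃ A δ, IsEMSequence S A δ ∧ A 0 = A₀ ∧ δ 0 = δ₀ := by
  let step : Matrix (Fin m) (Fin q) ℝ × ℝ → Matrix (Fin m) (Fin q) ℝ × ℝ := fun x =>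
    (S * x.1 * (emGain S x.1 x.2)⁻¹, 1 / (m : ℝ) * (S.trace -
      (S * x.1 * (emGain S x.1 x.2)⁻¹ * (emSigma x.1 x.2)⁻¹ * x.1ᵀ * S).trace))
  refine ⟨fun t => (step^[t] (A₀, δ₀)).1, fun t => (step^[t] (A₀, δ₀)).2, ⟨fun t => ?_, fun t => ?_⟩,
    rfl, rfl⟩
  · simp only [Function.iterate_succ_apply']
    rfl
  · simp only [Function.iterate_succ_apply']
    rfl

end Descent

/-! ### The loss and the EM step relative to an invariant subspace. -/

noncomputable section InvariantSubspace

open scoped Matrix.Norms.Frobenius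

variable {m q : ℕ} {S : Matrix (Fin m) (Fin m) ℝ} {U : Matrix (Fin m) (Fin q) ℝ} {g : Fin q → ℝ}

/-- The value of the loss at a maximum-likelihood solution with leading eigenvalues `g` and
ridge `δ`. -/
def optimalLoss (m : ℕ) {q : ℕ} (g : Fin q → ℝ) (δ : ℝ) : ℝ :=
  ∑ i, Real.log (g i) + q + ((m : ℝ) - q) * (Real.log δ + 1)

theorem transpose_mul_eq_diagonal_mul (hS : S.PosSemidef) (hSU : S * U = U * diagonal g) :
    Uᵀ * S = diagonal g * Uᵀ := by
  have h := congrArg Matrix.transpose hSU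
  simpa [hS.transpose_eq] using h

theorem transpose_mul_mul_eq_diagonal (hUU : Uᵀ * U = 1) (hSU : S * U = U * diagonal g) :
    Uᵀ * S * U = diagonal g := by
  rw [Matrix.mul_assoc, hSU, ← Matrix.mul_assoc, hUU, Matrix.one_mul]

theorem emSigma_add_of_orthogonal (hUU : Uᵀ * U = 1) (W : Matrix (Fin q) (Fin q) ℝ)
    {Z : Matrix (Fin m) (Fin q) ℝ} (hZ : Uᵀ * Z = 0) (δ : ℝ) :
    emSigma (U * W + Z) δ = δ • (1 : Matrix (Fin q) (Fin q) ℝ) + Wᵀ * W + Zᵀ * Z := by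
  have hZ' : Zᵀ * U = 0 := by simpa using congrArg Matrix.transpose hZ
  have e1 : Wᵀ * Uᵀ * (U * W) = Wᵀ * W := by
    rw [Matrix.mul_assoc, ← Matrix.mul_assoc Uᵀ, hUU, Matrix.one_mul]
  have e2 : Wᵀ * Uᵀ * Z = 0 := by rw [Matrix.mul_assoc, hZ, Matrix.mul_zero]
  have e3 : Zᵀ * (U * W) = 0 := by rw [← Matrix.mul_assoc, hZ', Matrix.zero_mul]
  simp only [emSigma, Matrix.transpose_add, Matrix.transpose_mul, Matrix.add_mul, Matrix.mul_add,
    e1, e2, e3]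
  simp [add_assoc]

theorem emSigma_mul (hUU : Uᵀ * U = 1) (W : Matrix (Fin q) (Fin q) ℝ) (δ : ℝ) :
    emSigma (U * W) δ = δ • (1 : Matrix (Fin q) (Fin q) ℝ) + Wᵀ * W := by
  simpa using emSigma_add_of_orthogonal hUU W (Matrix.mul_zero Uᵀ) δ

theorem transpose_mul_mul_add (hS : S.PosSemidef) (hUU : Uᵀ * U = 1)
    (hSU : S * U = U * diagonal g) (W : Matrix (Fin q) (Fin q) ℝ)
    {Z : Matrix (Fin m) (Fin q) ℝ} (hZ : Uᵀ * Z = 0) :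
    (U * W + Z)ᵀ * S * (U * W + Z) = Wᵀ * diagonal g * W + Zᵀ * S * Z := by
  have hZ' : Zᵀ * U = 0 := by simpa using congrArg Matrix.transpose hZ
  have e1 : Wᵀ * Uᵀ * S * (U * W) = Wᵀ * diagonal g * W := by
    rw [← transpose_mul_mul_eq_diagonal hUU hSU]; simp only [Matrix.mul_assoc]
  have e2 : Wᵀ * Uᵀ * S * Z = 0 := by
    rw [Matrix.mul_assoc Wᵀ, transpose_mul_eq_diagonal_mul hS hSU, Matrix.mul_assoc,
      Matrix.mul_assoc, hZ, Matrix.mul_zero, Matrix.mul_zero]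
  have e3 : Zᵀ * S * (U * W) = 0 := by
    rw [← Matrix.mul_assoc, Matrix.mul_assoc Zᵀ, hSU, ← Matrix.mul_assoc, hZ']; simp
  simp only [Matrix.transpose_add, Matrix.transpose_mul, Matrix.add_mul, Matrix.mul_add,
    e1, e2, e3]
  simp

/-- The component orthogonal to the invariant subspace affects the loss to second order only. -/
theorem lossG_add_orthogonal_le (hS : S.PosSemidef)
    (hSU : S * U = U * diagonal g) (W : Matrix (Fin q) (Fin q) ℝ)
    {Z : Matrix (Fin m) (Fin q) ℝ} (hZ : Uᵀ * Z = 0) {δ : ℝ} (hδ : 0 < δ) :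
    lossG S (U * W + Z) δ ≤
      lossG S (U * W) δ + 1 / δ * (Z * emMoment S (U * W) δ * Zᵀ).trace := by
  refine (lossG_le_surrogate hS _ hδ (emLoading (U * W) δ)
    ((emSigma_posDef (U * W) hδ).inv.smul hδ)).trans (le_of_eq ?_)
  rw [← surrogate_self hS (U * W) hδ, surrogate, surrogate]
  set R := emMoment S (U * W) δ with hR
  have hRt : Rᵀ = R := (emMoment_posDef hS _ hδ).posSemidef.transpose_eq
  rw [show emLoading (U * W) δ * S * (emLoading (U * W) δ)ᵀ + δ • (emSigma (U * W) δ)⁻¹ = R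
    from rfl]
  -- After a cyclic permutation each cross term contains $U^TZ=0$, so no first-order term in $Z$
  -- survives.
  have e1 : (Z * emLoading (U * W) δ * S).trace = 0 := by
    have : Z * emLoading (U * W) δ * S =
        (Z * (emSigma (U * W) δ)⁻¹ * Wᵀ * diagonal g) * Uᵀ := by
      simp only [emLoading, Matrix.transpose_mul, Matrix.mul_assoc,
        transpose_mul_eq_diagonal_mul hS hSU]
    rw [this, Matrix.trace_mul_comm]
    simp only [← Matrix.mul_assoc, hZ]
    simp
  have e2 : (Z * R * (U * W)ᵀ).trace = 0 := by
    rw [Matrix.transpose_mul, ← Matrix.mul_assoc, Matrix.trace_mul_comm]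
    simp only [← Matrix.mul_assoc, hZ]
    simp
  have e3 : (U * W * R * Zᵀ).trace = 0 := by
    rw [← e2, ← Matrix.trace_transpose]; simp [Matrix.mul_assoc, hRt]
  simp only [Matrix.add_mul, Matrix.mul_add, Matrix.transpose_add, Matrix.trace_add, e1, e2, e3]
  ring

theorem mul_emSigma_inv_mul_transpose (W : Matrix (Fin q) (Fin q) ℝ) {δ : ℝ} (hδ : 0 < δ) :
    W * (δ • (1 : Matrix (Fin q) (Fin q) ℝ) + Wᵀ * W)⁻¹ * Wᵀ =
      1 - δ • (δ • (1 : Matrix (Fin q) (Fin q) ℝ) + W * Wᵀ)⁻¹ := by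
  have h := inv_covariance W hδ
  rw [add_comm (δ • 1) (W * Wᵀ), h, smul_smul, mul_one_div_cancel hδ.ne', one_smul, emSigma, sub_sub_cancel]

theorem trace_mul_emSigma_inv (hS : S.PosSemidef) (hUU : Uᵀ * U = 1)
    (hSU : S * U = U * diagonal g) (W : Matrix (Fin q) (Fin q) ℝ) {δ : ℝ} (hδ : 0 < δ) :
    (U * W * (emSigma (U * W) δ)⁻¹ * (U * W)ᵀ * S).trace =
      ∑ i, g i - δ * ((δ • (1 : Matrix (Fin q) (Fin q) ℝ) + W * Wᵀ)⁻¹ * diagonal g).trace := by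
  have : U * W * (emSigma (U * W) δ)⁻¹ * (U * W)ᵀ * S = U *
      ((W * (δ • (1 : Matrix (Fin q) (Fin q) ℝ) + Wᵀ * W)⁻¹ * Wᵀ) * diagonal g * Uᵀ) := by
    rw [emSigma_mul hUU]
    simp only [Matrix.transpose_mul, Matrix.mul_assoc, transpose_mul_eq_diagonal_mul hS hSU]
  rw [this, Matrix.trace_mul_comm, Matrix.mul_assoc, hUU, Matrix.mul_one,
    mul_emSigma_inv_mul_transpose W hδ, Matrix.sub_mul, Matrix.trace_sub, Matrix.one_mul,
    Matrix.trace_diagonal, Matrix.smul_mul, Matrix.trace_smul, smul_eq_mul]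

theorem lossG_mul_eq (hS : S.PosSemidef) (hUU : Uᵀ * U = 1) (hSU : S * U = U * diagonal g)
    (W : Matrix (Fin q) (Fin q) ℝ) {δ : ℝ} (hδ : 0 < δ) :
    lossG S (U * W) δ = ((m : ℝ) - q) * Real.log δ
      + Real.log (δ • (1 : Matrix (Fin q) (Fin q) ℝ) + W * Wᵀ).det
      + 1 / δ * (S.trace - ∑ i, g i)
      + ((δ • (1 : Matrix (Fin q) (Fin q) ℝ) + W * Wᵀ)⁻¹ * diagonal g).trace := by
  have h1 : Real.log (emSigma (U * W) δ).det =
      Real.log (δ • (1 : Matrix (Fin q) (Fin q) ℝ) + W * Wᵀ).det := by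
    have := log_det_covariance W hδ
    rw [sub_self, zero_mul, zero_add] at this
    rw [emSigma_mul hUU, add_comm (δ • 1) (W * Wᵀ), this, emSigma]
  have h2 := trace_mul_emSigma_inv hS hUU hSU W hδ
  rw [lossG_eq S _ hδ, h1, h2]
  field_simp
  ring

theorem log_det_diagonal_inv (hg : ∀ i, 0 < g i) :
    Real.log (diagonal fun i => (g i)⁻¹).det = -∑ i, Real.log (g i) := by
  rw [Matrix.det_diagonal, Real.log_prod fun i _ => (inv_pos.2 (hg i)).ne', ← Finset.sum_neg_distrib]
  simp

/-- Linearize both logarithms at the optimum: $\log\det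
Q\le\log\det\Gamma+\operatorname{tr}(\Gamma^{-1}Q)-q$, and likewise for $\log\delta$. The remainder
$\operatorname{tr}(\Gamma^{-1}Q)-2q+\operatorname{tr}(Q^{-1}\Gamma)$ equals
$\operatorname{tr}(D\Gamma DQ)$, so the excess loss is quadratic in the defect of stationarity. -/
theorem lossG_mul_le (hS : S.PosSemidef) (hUU : Uᵀ * U = 1) (hSU : S * U = U * diagonal g)
    (hg : ∀ i, 0 < g i) {δ₀ : ℝ} (hδ₀ : 0 < δ₀) (hqm : q < m)
    (hτ : S.trace - ∑ i, g i = ((m : ℝ) - q) * δ₀)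
    (W : Matrix (Fin q) (Fin q) ℝ) {δ : ℝ} (hδ : 0 < δ)
    {D : Matrix (Fin q) (Fin q) ℝ}
    (hD : D = diagonal (fun i => (g i)⁻¹) - (δ • (1 : Matrix (Fin q) (Fin q) ℝ) + W * Wᵀ)⁻¹) :
    lossG S (U * W) δ ≤ optimalLoss m g δ₀
      + (D * diagonal g * D * (δ • (1 : Matrix (Fin q) (Fin q) ℝ) + W * Wᵀ)).trace
      + ((m : ℝ) - q) * ((δ - δ₀) ^ 2 / (δ * δ₀)) := by
  have hQ := posDef_smul_one_add (posSemidef_mul_transpose_self' W) hδ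
  rw [lossG_mul_eq hS hUU hSU W hδ, hτ]
  set Q := δ • (1 : Matrix (Fin q) (Fin q) ℝ) + W * Wᵀ
  have hQu := (Matrix.isUnit_iff_isUnit_det _).1 hQ.isUnit
  have hG : (diagonal fun i => (g i)⁻¹).PosDef := Matrix.PosDef.diagonal fun i => inv_pos.2 (hg i)
  have h1 := hG.log_det_mul_le hQ
  rw [log_det_diagonal_inv hg, Fintype.card_fin] at h1
  have hGG : (diagonal fun i => (g i)⁻¹) * diagonal g = 1 := by
    rw [Matrix.diagonal_mul_diagonal, ← Matrix.diagonal_one]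
    congr 1; ext i; exact inv_mul_cancel₀ (hg i).ne'
  have hGG' : diagonal g * (diagonal fun i => (g i)⁻¹) = 1 := by
    rw [Matrix.diagonal_mul_diagonal, ← Matrix.diagonal_one]
    congr 1; ext i; exact mul_inv_cancel₀ (hg i).ne'
  have h2 : (D * diagonal g * D * Q).trace =
      ((diagonal fun i => (g i)⁻¹) * Q).trace - 2 * q + (Q⁻¹ * diagonal g).trace := by
    have : D * diagonal g * D * Q =
        (diagonal fun i => (g i)⁻¹) * Q - 1 - 1 + Q⁻¹ * diagonal g := by
      rw [hD]
      have e1 : Q⁻¹ * diagonal g * Q⁻¹ * Q = Q⁻¹ * diagonal g :=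
        Matrix.nonsing_inv_mul_cancel_right _ _ hQu
      have e2 : Q⁻¹ * diagonal g * (diagonal fun i => (g i)⁻¹) * Q = 1 := by
        rw [Matrix.mul_assoc Q⁻¹, hGG', Matrix.mul_one, Matrix.nonsing_inv_mul _ hQu]
      simp only [Matrix.sub_mul, Matrix.mul_sub, hGG, Matrix.one_mul, e1, e2,
        Matrix.nonsing_inv_mul _ hQu]
      abel
    rw [this]
    simp only [Matrix.trace_add, Matrix.trace_sub, Matrix.trace_one, Fintype.card_fin]
    ring
  have hmq : (0 : ℝ) < (m : ℝ) - q := sub_pos.2 (by exact_mod_cast hqm)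
  have h3 : Real.log δ + δ₀ / δ ≤ Real.log δ₀ + 1 + (δ - δ₀) ^ 2 / (δ * δ₀) := by
    have h := Real.log_le_sub_one_of_pos (div_pos hδ hδ₀)
    rw [Real.log_div hδ.ne' hδ₀.ne'] at h
    have : (δ - δ₀) ^ 2 / (δ * δ₀) = δ / δ₀ - 2 + δ₀ / δ := by field_simp; ring
    rw [this]; linarith
  have h4 := mul_le_mul_of_nonneg_left h3 hmq.le
  rw [optimalLoss, h2]
  have h5 : 1 / δ * (((m : ℝ) - q) * δ₀) = ((m : ℝ) - q) * (δ₀ / δ) := by ring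
  rw [h5]
  linarith

theorem lossG_eq_optimalLoss (hS : S.PosSemidef) (hUU : Uᵀ * U = 1)
    (hSU : S * U = U * diagonal g) (hg : ∀ i, 0 < g i) {δ₀ : ℝ} (hδ₀ : 0 < δ₀)
    (hτ : S.trace - ∑ i, g i = ((m : ℝ) - q) * δ₀) {W : Matrix (Fin q) (Fin q) ℝ}
    (hW : W * Wᵀ = diagonal fun i => g i - δ₀) :
    lossG S (U * W) δ₀ = optimalLoss m g δ₀ := by
  have hQ : δ₀ • (1 : Matrix (Fin q) (Fin q) ℝ) + W * Wᵀ = diagonal g := by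
    rw [hW, ← Matrix.diagonal_one, ← Matrix.diagonal_smul, Matrix.diagonal_add]
    congr 1; ext i; simp
  have hu : IsUnit (diagonal g).det := by
    rw [Matrix.det_diagonal]
    exact isUnit_iff_ne_zero.2 (Finset.prod_ne_zero_iff.2 fun i _ => (hg i).ne')
  rw [lossG_mul_eq hS hUU hSU W hδ₀, hQ, hτ, Matrix.nonsing_inv_mul _ hu, Matrix.det_diagonal,
    Real.log_prod fun i _ => (hg i).ne', optimalLoss]
  simp only [Matrix.trace_one, Fintype.card_fin]
  field_simp
  ring

theorem emGain_mul (hS : S.PosSemidef) (hUU : Uᵀ * U = 1) (hSU : S * U = U * diagonal g)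
    (W : Matrix (Fin q) (Fin q) ℝ) (δ : ℝ) :
    emGain S (U * W) δ = δ • (1 : Matrix (Fin q) (Fin q) ℝ)
      + (δ • (1 : Matrix (Fin q) (Fin q) ℝ) + Wᵀ * W)⁻¹ * (Wᵀ * diagonal g * W) := by
  have h := transpose_mul_mul_add hS hUU hSU W (Matrix.mul_zero Uᵀ)
  simp only [add_zero, Matrix.transpose_zero, Matrix.zero_mul] at h
  rw [emGain, emSigma_mul hUU, ← h]
  simp only [Matrix.mul_assoc]

/-- Since the gain acts from the right, the update is a power iteration up to an invertible change
of latent coordinates. -/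
theorem transpose_mul_emStep (hS : S.PosSemidef)
    (hSU : S * U = U * diagonal g) {A A' : Matrix (Fin m) (Fin q) ℝ} {δ : ℝ} (hδ : 0 < δ)
    (hA' : A' = S * A * (emGain S A δ)⁻¹) :
    Uᵀ * A' * emGain S A δ = diagonal g * (Uᵀ * A) := by
  rw [hA', Matrix.mul_assoc, Matrix.nonsing_inv_mul_cancel_right _ _
    (emGain_isUnit_det hS _ hδ), ← Matrix.mul_assoc, transpose_mul_eq_diagonal_mul hS hSU,
    Matrix.mul_assoc]

/-- The left side vanishes exactly when $W$ is fixed by the update restricted to $A=UW$; hence the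
step length will control the defect multiplied by $\Gamma W$. -/
theorem mul_emGain_mul_sub (hS : S.PosSemidef) (hUU : Uᵀ * U = 1) (hSU : S * U = U * diagonal g)
    (hg : ∀ i, 0 < g i) (W : Matrix (Fin q) (Fin q) ℝ) {δ : ℝ} (hδ : 0 < δ) :
    W * emGain S (U * W) δ - diagonal g * W =
      δ • ((diagonal (fun i => (g i)⁻¹) - (δ • (1 : Matrix (Fin q) (Fin q) ℝ) + W * Wᵀ)⁻¹)
        * diagonal g * W) := by
  have hGG : (diagonal fun i => (g i)⁻¹) * diagonal g = 1 := by
    rw [Matrix.diagonal_mul_diagonal, ← Matrix.diagonal_one]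
    congr 1; ext i; exact inv_mul_cancel₀ (hg i).ne'
  have h1 : W * emGain S (U * W) δ = δ • W
      + (W * (δ • (1 : Matrix (Fin q) (Fin q) ℝ) + Wᵀ * W)⁻¹ * Wᵀ) * diagonal g * W := by
    rw [emGain_mul hS hUU hSU]
    simp [Matrix.mul_add, Matrix.mul_assoc]
  rw [h1, mul_emSigma_inv_mul_transpose W hδ]
  simp only [Matrix.sub_mul, hGG, Matrix.one_mul, Matrix.smul_mul, smul_sub]
  abel

theorem trace_compl_projection (hUU : Uᵀ * U = 1) (hSU : S * U = U * diagonal g) :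
    ((1 - U * Uᵀ) * S * (1 - U * Uᵀ)).trace = S.trace - ∑ i, g i := by
  have h1 : (1 - U * Uᵀ) * (1 - U * Uᵀ) = 1 - U * Uᵀ := by
    have : U * Uᵀ * (U * Uᵀ) = U * Uᵀ := by
      rw [Matrix.mul_assoc, ← Matrix.mul_assoc Uᵀ, hUU, Matrix.one_mul]
    simp only [Matrix.sub_mul, Matrix.mul_sub, this, Matrix.one_mul, Matrix.mul_one]
    abel
  rw [Matrix.trace_mul_comm, ← Matrix.mul_assoc, h1, Matrix.sub_mul, Matrix.one_mul,
    Matrix.trace_sub, Matrix.mul_assoc, Matrix.trace_mul_comm,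
    transpose_mul_mul_eq_diagonal hUU hSU, Matrix.trace_diagonal]

/-- A lower bound for the updated ridge when the update of `A` is a graph over the invariant
subspace. -/
theorem trace_sub_le_mul_ridge (hS : S.PosSemidef) (hUU : Uᵀ * U = 1)
    (hSU : S * U = U * diagonal g) (hg : ∀ i, 0 < g i)
    {A A' : Matrix (Fin m) (Fin q) ℝ} {δ : ℝ} (hδ : 0 < δ)
    (hA' : A' = S * A * (emGain S A δ)⁻¹)
    {Y : Matrix (Fin m) (Fin q) ℝ} {W : Matrix (Fin q) (Fin q) ℝ} (hY : Uᵀ * Y = 0) (hYW : A' = (U + Y) * W) :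
    S.trace - ∑ i, g i ≤ (‖(1 - U * Uᵀ : Matrix (Fin m) (Fin m) ℝ)‖ + ‖U‖ * ‖Y‖) ^ 2
      * (S.trace - (A' * (emSigma A δ)⁻¹ * Aᵀ * S).trace) := by
  set P : Matrix (Fin m) (Fin m) ℝ := 1 - U * Uᵀ with hP
  -- The columns of $N$ are orthogonal to those of $U+Y$, so $N^T$ annihilates $A'$ and does not see
  -- the correction in $K=1-A'B$. The trailing spectral mass $\operatorname{tr}(PSP)$ is therefore
  -- bounded by $\|N\|^2$ times the residual, which is at most $m\delta'$.
  set N : Matrix (Fin m) (Fin m) ℝ := P - U * Yᵀ with hN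
  set K : Matrix (Fin m) (Fin m) ℝ := 1 - A' * emLoading A δ with hK
  have hPt : Pᵀ = P := by simp [hP]
  have hPU : P * U = 0 := by
    rw [hP, Matrix.sub_mul, Matrix.one_mul, Matrix.mul_assoc, hUU, Matrix.mul_one, sub_self]
  have hNA : Nᵀ * A' = 0 := by
    rw [hYW, ← Matrix.mul_assoc]
    have : Nᵀ * (U + Y) = 0 := by
      simp only [hN, Matrix.transpose_sub, hPt, Matrix.transpose_mul, Matrix.transpose_transpose,
        Matrix.sub_mul, Matrix.mul_add, hPU, Matrix.mul_assoc, hUU, hY]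
      simp [hP, Matrix.sub_mul, Matrix.mul_assoc, hY]
    rw [this, Matrix.zero_mul]
  have hNK : Nᵀ * K = Nᵀ := by
    rw [hK, Matrix.mul_sub, Matrix.mul_one, ← Matrix.mul_assoc, hNA, Matrix.zero_mul, sub_zero]
  obtain ⟨F, hF⟩ := hS.exists_eq_transpose_mul_self
  have hF2 : ∀ M : Matrix (Fin m) (Fin m) ℝ, ‖M * Fᵀ‖ ^ 2 = (M * S * Mᵀ).trace := fun M => by
    rw [frobenius_sq_eq_trace, hF]; simp [Matrix.mul_assoc]
  have h1 : S.trace - ∑ i, g i ≤ ‖Nᵀ * Fᵀ‖ ^ 2 := by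
    rw [hF2, Matrix.transpose_transpose, ← trace_compl_projection hUU hSU]
    have e1 : P * S * (U * Yᵀ) = 0 := by
      rw [← Matrix.mul_assoc, Matrix.mul_assoc P, hSU, ← Matrix.mul_assoc, hPU]; simp
    have e2 : Y * Uᵀ * S * P = 0 := by
      have := congrArg Matrix.transpose e1
      simpa [Matrix.mul_assoc, hS.transpose_eq, hPt] using this
    have e3 : Y * Uᵀ * S * (U * Yᵀ) = Y * diagonal g * Yᵀ := by
      rw [← transpose_mul_mul_eq_diagonal hUU hSU]; simp only [Matrix.mul_assoc]
    have e4 : Nᵀ * S * N = P * S * P + Y * diagonal g * Yᵀ := by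
      simp only [hN, Matrix.transpose_sub, hPt, Matrix.transpose_mul, Matrix.transpose_transpose,
        Matrix.sub_mul, Matrix.mul_sub, e1, e2, e3]
      abel
    rw [e4, Matrix.trace_add]
    have := ((Matrix.PosSemidef.diagonal (d := g) fun i => (hg i).le).conj Y).trace_nonneg
    linarith
  have h2 : ‖K * Fᵀ‖ ^ 2 ≤ S.trace - (A' * (emSigma A δ)⁻¹ * Aᵀ * S).trace := by
    rw [hF2, trace_emStep_eq hS hδ hA']
    have := ((emSigma_posDef A hδ).inv.posSemidef.conj A').trace_nonneg
    nlinarith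
  have h3 : ‖Nᵀ‖ ≤ ‖P‖ + ‖U‖ * ‖Y‖ := by
    rw [Matrix.frobenius_norm_transpose]
    refine (norm_sub_le _ _).trans (add_le_add_right ?_ _)
    simpa [Matrix.frobenius_norm_transpose] using Matrix.frobenius_norm_mul U Yᵀ
  calc S.trace - ∑ i, g i ≤ ‖Nᵀ * K * Fᵀ‖ ^ 2 := by rw [hNK]; exact h1
    _ ≤ (‖Nᵀ‖ * ‖K * Fᵀ‖) ^ 2 := by
        rw [Matrix.mul_assoc]
        exact pow_le_pow_left₀ (norm_nonneg _) (Matrix.frobenius_norm_mul _ _) 2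
    _ = ‖Nᵀ‖ ^ 2 * ‖K * Fᵀ‖ ^ 2 := mul_pow _ _ _
    _ ≤ _ := mul_le_mul (pow_le_pow_left₀ (norm_nonneg _) h3 2) h2 (sq_nonneg _) (by positivity)

end InvariantSubspace

/-! ### Bounds along an EM sequence aligned with an invariant subspace. -/

noncomputable section AlignedSequences

open scoped Matrix.Norms.Frobenius

variable {m q : ℕ}

/-- An EM sequence whose column spaces are graphs over a fixed invariant subspace `U`, with
eigenvalues `g`, and approach it at a geometric rate. -/
structure AlignedEM (S : Matrix (Fin m) (Fin m) ℝ) (U : Matrix (Fin m) (Fin q) ℝ) (g : Fin q → ℝ)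
    (δ₀ ρ : ℝ) (A : ℕ → Matrix (Fin m) (Fin q) ℝ) (δ : ℕ → ℝ)
    (Y : ℕ → Matrix (Fin m) (Fin q) ℝ) : Prop where
  psd : S.PosSemidef
  lt : q < m
  orth : Uᵀ * U = 1
  eig : S * U = U * diagonal g
  opt_pos : 0 < δ₀
  opt_lt : ∀ i, δ₀ < g i
  trace_eq : S.trace - ∑ i, g i = ((m : ℝ) - q) * δ₀
  em : IsEMSequence S A δ
  ridge_zero : 0 < δ 0
  compl : ∀ t, Uᵀ * Y t = 0
  graph : ∀ t, A t = (U + Y t) * (Uᵀ * A t)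
  unit : ∀ t, IsUnit (Uᵀ * A t).det
  rate_pos : 0 < ρ
  rate_lt : ρ < 1
  decay : Y =O[atTop] fun t => ρ ^ t

namespace AlignedEM

variable {S : Matrix (Fin m) (Fin m) ℝ} {U : Matrix (Fin m) (Fin q) ℝ} {g : Fin q → ℝ}
  {δ₀ ρ : ℝ} {A : ℕ → Matrix (Fin m) (Fin q) ℝ} {δ : ℕ → ℝ} {Y : ℕ → Matrix (Fin m) (Fin q) ℝ}

theorem g_pos (h : AlignedEM S U g δ₀ ρ A δ Y) (i : Fin q) : 0 < g i :=
  h.opt_pos.trans (h.opt_lt i)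

theorem codim_pos (h : AlignedEM S U g δ₀ ρ A δ Y) : (0 : ℝ) < (m : ℝ) - q :=
  sub_pos.2 (by exact_mod_cast h.lt)

theorem dim_pos (h : AlignedEM S U g δ₀ ρ A δ Y) : (0 : ℝ) < m := by
  have := h.lt; exact_mod_cast (by omega : 0 < m)

theorem trace_pos (h : AlignedEM S U g δ₀ ρ A δ Y) : 0 < S.trace := by
  have h1 : 0 ≤ ∑ i, g i := Finset.sum_nonneg fun i _ => (h.g_pos i).le
  have h2 := mul_pos h.codim_pos h.opt_pos
  have h3 := h.trace_eq
  linarith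

theorem ridge_pos (h : AlignedEM S U g δ₀ ρ A δ Y) (t : ℕ) : 0 < δ t :=
  h.em.ridge_pos h.psd h.trace_pos h.ridge_zero t

theorem exists_ridge_le (h : AlignedEM S U g δ₀ ρ A δ Y) : ∃ K, 0 < K ∧ ∀ t, δ t ≤ K := by
  refine ⟨max (δ 0) (1 / (m : ℝ) * S.trace), lt_max_of_lt_left h.ridge_zero, fun t => ?_⟩
  cases t with
  | zero => exact le_max_left _ _
  | succ t =>
    exact (emStep_ridge_le h.psd (h.ridge_pos t) (h.em.step_A t) (h.em.step_δ t)).trans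
      (le_max_right _ _)

theorem decay_zero (h : AlignedEM S U g δ₀ ρ A δ Y) : Tendsto (fun t => ρ ^ t) atTop (𝓝 0) :=
  tendsto_pow_atTop_nhds_zero_of_lt_one h.rate_pos.le h.rate_lt

/-- The trailing eigenvalues have positive total $(m-q)\delta_0$, and by `trace_sub_le_mul_ridge` a
bounded $Y$ cannot absorb it. -/
theorem exists_le_ridge (h : AlignedEM S U g δ₀ ρ A δ Y) : ∃ d, 0 < d ∧ ∀ t, d ≤ δ t := by
  obtain ⟨C, hC⟩ := (Asymptotics.isBigO_one_nat_atTop_iff (f := Y)).1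
    (h.decay.trans (h.decay_zero.isBigO_one ℝ))
  set B := (‖(1 - U * Uᵀ : Matrix (Fin m) (Fin m) ℝ)‖ + ‖U‖ * C) ^ 2
  have hτ : 0 < ((m : ℝ) - q) * δ₀ := mul_pos h.codim_pos h.opt_pos
  have hm := h.dim_pos
  refine ⟨min (δ 0) (((m : ℝ) - q) * δ₀ / (m * (B + 1))), lt_min h.ridge_zero (by positivity),
    fun t => ?_⟩
  cases t with
  | zero => exact min_le_left _ _
  | succ t =>
    refine (min_le_right _ _).trans ?_
    have h1 := trace_sub_le_mul_ridge h.psd h.orth h.eig h.g_pos (h.ridge_pos t) (h.em.step_A t)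
      (h.compl (t + 1)) (h.graph (t + 1))
    have h2 : S.trace - (A (t + 1) * (emSigma (A t) (δ t))⁻¹ * (A t)ᵀ * S).trace
        = m * δ (t + 1) := by
      rw [h.em.step_δ t, ← mul_assoc, mul_one_div_cancel hm.ne', one_mul]
    rw [h2, h.trace_eq] at h1
    have h3 : 0 < m * δ (t + 1) := mul_pos hm (h.ridge_pos _)
    have h4 : (‖(1 - U * Uᵀ : Matrix (Fin m) (Fin m) ℝ)‖ + ‖U‖ * ‖Y (t + 1)‖) ^ 2 ≤ B := by
      exact pow_le_pow_left₀ (by positivity)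
        (add_le_add_right (mul_le_mul_of_nonneg_left (hC (t + 1)) (norm_nonneg _)) _) 2
    rw [div_le_iff₀ (by positivity)]
    nlinarith [mul_le_mul_of_nonneg_right h4 h3.le]

theorem le_det_covariance (A : Matrix (Fin m) (Fin q) ℝ) {δ : ℝ} (hδ : 0 < δ) :
    δ ^ m * (1 + ‖A‖ ^ 2 / δ) ≤ (A * Aᵀ + δ • (1 : Matrix (Fin m) (Fin m) ℝ)).det := by
  have h1 : A * Aᵀ + δ • (1 : Matrix (Fin m) (Fin m) ℝ) = δ • (1 + δ⁻¹ • (A * Aᵀ)) := by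
    simp [smul_smul, mul_inv_cancel₀ hδ.ne', add_comm]
  have h2 := ((posSemidef_mul_transpose_self' A).smul (inv_pos.2 hδ).le).one_add_trace_le_det
  rw [Matrix.trace_smul, ← frobenius_sq_eq_trace, smul_eq_mul, inv_mul_eq_div] at h2
  rw [h1, Matrix.det_smul, Fintype.card_fin]
  gcongr

theorem log_det_covariance_le_lossG {S : Matrix (Fin m) (Fin m) ℝ} (hS : S.PosSemidef)
    (A : Matrix (Fin m) (Fin q) ℝ) {δ : ℝ} (hδ : 0 < δ) :
    Real.log (A * Aᵀ + δ • (1 : Matrix (Fin m) (Fin m) ℝ)).det ≤ lossG S A δ := by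
  have h := posDef_smul_one_add (posSemidef_mul_transpose_self' A) hδ
  rw [add_comm] at h
  have := h.inv.posSemidef.trace_mul_nonneg hS
  rw [lossG]; linarith

theorem lossG_antitone (h : AlignedEM S U g δ₀ ρ A δ Y) :
    Antitone fun t => lossG S (A t) (δ t) :=
  h.em.lossG_antitone h.psd h.trace_pos h.ridge_zero

/-- The decreasing loss bounds the determinant of $AA^T+\delta I$, which dominates
$\delta^{m}(1+\|A\|^2/\delta)$; the ridge is bounded above and away from zero. -/
theorem exists_norm_le (h : AlignedEM S U g δ₀ ρ A δ Y) : ∃ K, ∀ t, ‖A t‖ ≤ K := by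
  obtain ⟨K, hK0, hK⟩ := h.exists_ridge_le
  obtain ⟨d, hd0, hd⟩ := h.exists_le_ridge
  refine ⟨√(K * Real.exp (lossG S (A 0) (δ 0)) / d ^ m), fun t => Real.le_sqrt_of_sq_le ?_⟩
  have hδ := h.ridge_pos t
  have h1 := le_det_covariance (A t) hδ
  have h2 := (log_det_covariance_le_lossG h.psd (A t) hδ).trans (h.lossG_antitone (Nat.zero_le t))
  have h3 : 0 < (A t * (A t)ᵀ + δ t • (1 : Matrix (Fin m) (Fin m) ℝ)).det :=
    lt_of_lt_of_le (by positivity) h1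
  rw [Real.log_le_iff_le_exp h3] at h2
  have h4 : d ^ m * (‖A t‖ ^ 2 / K) ≤ Real.exp (lossG S (A 0) (δ 0)) := by
    refine le_trans ?_ (h1.trans h2)
    have e1 : ‖A t‖ ^ 2 / K ≤ ‖A t‖ ^ 2 / δ t := by
      have := hK t; gcongr
    have e2 : d ^ m ≤ δ t ^ m := by have := hd t; gcongr
    have e3 : 0 ≤ ‖A t‖ ^ 2 / K := by positivity
    exact mul_le_mul e2 (by linarith) e3 (by positivity)
  rw [le_div_iff₀ (by positivity)]
  have h5 : d ^ m * (‖A t‖ ^ 2 / K) = ‖A t‖ ^ 2 * d ^ m / K := by ring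
  rw [h5, div_le_iff₀ hK0] at h4
  linarith

/-- The size of the step from the `t`-th to the next iterate. -/
def stepSize (A : ℕ → Matrix (Fin m) (Fin q) ℝ) (δ : ℕ → ℝ) (t : ℕ) : ℝ :=
  ‖A (t + 1) - A t‖ + |δ (t + 1) - δ t|

theorem stepSize_nonneg (A : ℕ → Matrix (Fin m) (Fin q) ℝ) (δ : ℕ → ℝ) (t : ℕ) :
    0 ≤ stepSize A δ t := by
  unfold stepSize; positivity

theorem exists_stepSize_sq_le (h : AlignedEM S U g δ₀ ρ A δ Y) : ∃ K, 0 < K ∧ ∀ t,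
    stepSize A δ t ^ 2 ≤ K * (lossG S (A t) (δ t) - lossG S (A (t + 1)) (δ (t + 1))) := by
  obtain ⟨K, hK0, hK⟩ := h.exists_ridge_le
  obtain ⟨K', hK'⟩ := h.exists_norm_le
  set L := max K K'
  have hL : 0 < L := lt_max_of_lt_left hK0
  refine ⟨2 * (q * L + 5 * L ^ 2), by positivity, fun t => ?_⟩
  have h1 := lossG_descent_sq h.psd h.trace_pos (h.ridge_pos t) (h.em.step_A t) (h.em.step_δ t)
    ((hK t).trans (le_max_left K K')) ((hK (t + 1)).trans (le_max_left K K'))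
    ((hK' t).trans (le_max_right K K'))
  have h2 : stepSize A δ t ^ 2 ≤ 2 * (‖A (t + 1) - A t‖ ^ 2 + (δ (t + 1) - δ t) ^ 2) := by
    rw [stepSize, ← sq_abs (δ (t + 1) - δ t)]
    nlinarith [sq_nonneg (‖A (t + 1) - A t‖ - |δ (t + 1) - δ t|)]
  nlinarith

theorem exists_tendsto_lossG (h : AlignedEM S U g δ₀ ρ A δ Y) :
    ∃ G, Tendsto (fun t => lossG S (A t) (δ t)) atTop (𝓝 G) := by
  obtain ⟨d, hd0, hd⟩ := h.exists_le_ridge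
  refine ⟨_, tendsto_atTop_ciInf h.lossG_antitone ⟨m * Real.log d, ?_⟩⟩
  rintro _ ⟨t, rfl⟩
  refine le_trans ?_ (log_det_covariance_le_lossG h.psd (A t) (h.ridge_pos t))
  rw [← Real.log_pow]
  refine Real.log_le_log (by positivity) (le_trans ?_ (le_det_covariance (A t) (h.ridge_pos t)))
  have := h.ridge_pos t
  have e2 : d ^ m ≤ δ t ^ m := by have := hd t; gcongr
  have e3 : 0 ≤ ‖A t‖ ^ 2 / δ t := by positivity
  nlinarith [pow_pos hd0 m]

theorem tendsto_stepSize (h : AlignedEM S U g δ₀ ρ A δ Y) :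
    Tendsto (stepSize A δ) atTop (𝓝 0) := by
  obtain ⟨G, hG⟩ := h.exists_tendsto_lossG
  obtain ⟨K, hK0, hK⟩ := h.exists_stepSize_sq_le
  have h1 : Tendsto (fun t => K * (lossG S (A t) (δ t) - lossG S (A (t + 1)) (δ (t + 1)))) atTop
      (𝓝 0) := by
    simpa using (hG.sub (hG.comp (tendsto_add_atTop_nat 1))).const_mul K
  have h2 : Tendsto (fun t => stepSize A δ t ^ 2) atTop (𝓝 0) :=
    squeeze_zero (fun t => sq_nonneg _) hK h1
  have h3 := h2.sqrt
  simpa [Real.sqrt_sq (stepSize_nonneg A δ _)] using h3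

end AlignedEM

end AlignedSequences

/-! ### Stationarity equations up to the error scale. -/

noncomputable section Asymptotics

open scoped Matrix.Norms.Frobenius

open Asymptotics

section MatrixBigO

variable {α ι κ μ : Type*} [Fintype ι] [Fintype κ] [Fintype μ] {l : Filter α}

theorem Asymptotics.IsBigO.matrix_mul {f : α → Matrix ι κ ℝ} {f' : α → Matrix κ μ ℝ} {u v : α → ℝ}
    (hf : f =O[l] u) (hf' : f' =O[l] v) : (fun t => f t * f' t) =O[l] fun t => u t * v t :=
  (isBigO_of_le l fun t => by
    simpa using Matrix.frobenius_norm_mul (f t) (f' t)).trans (hf.norm_left.mul hf'.norm_left)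

theorem Asymptotics.IsBigO.matrix_mul_bounded {f : α → Matrix ι κ ℝ} {f' : α → Matrix κ μ ℝ}
    {u : α → ℝ} (hf : f =O[l] u) (hf' : f' =O[l] fun _ => (1 : ℝ)) :
    (fun t => f t * f' t) =O[l] u := by
  simpa using hf.matrix_mul hf'

theorem Asymptotics.IsBigO.bounded_matrix_mul {f : α → Matrix ι κ ℝ} {f' : α → Matrix κ μ ℝ}
    {u : α → ℝ} (hf : f =O[l] fun _ => (1 : ℝ)) (hf' : f' =O[l] u) :
    (fun t => f t * f' t) =O[l] u := by
  simpa using hf.matrix_mul hf'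

theorem Asymptotics.IsBigO.matrix_transpose {f : α → Matrix ι κ ℝ} {u : α → ℝ}
    (hf : f =O[l] u) : (fun t => (f t)ᵀ) =O[l] u :=
  (isBigO_of_le l fun t => (Matrix.frobenius_norm_transpose (f t)).le).trans hf

theorem Asymptotics.IsBigO.matrix_apply {f : α → Matrix ι κ ℝ} {u : α → ℝ}
    (hf : f =O[l] u) (i : ι) (j : κ) : (fun t => f t i j) =O[l] u :=
  (isBigO_of_le l fun t => abs_entry_le_frobenius (f t) i j).trans hf

theorem Asymptotics.IsBigO.matrix_trace {f : α → Matrix ι ι ℝ} {u : α → ℝ}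
    (hf : f =O[l] u) : (fun t => (f t).trace) =O[l] u :=
  (IsBigO.of_bound (Fintype.card ι) (Eventually.of_forall fun t =>
    abs_trace_le_frobenius (f t))).trans hf

theorem Asymptotics.IsBigO.bounded_smul {f : α → Matrix ι κ ℝ} {c : α → ℝ} {u : α → ℝ}
    (hc : c =O[l] fun _ => (1 : ℝ)) (hf : f =O[l] u) : (fun t => c t • f t) =O[l] u := by
  simpa using hc.smul hf

theorem isBigO_matrix_of_apply {f : α → Matrix ι κ ℝ} {u : α → ℝ}
    (hf : ∀ i j, (fun t => f t i j) =O[l] u) : f =O[l] u := by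
  refine (isBigO_of_le l (g := fun t => ∑ i, ∑ j, |f t i j|) fun t => ?_).trans
    (IsBigO.fun_sum fun i _ => IsBigO.fun_sum fun j _ => (hf i j).abs_left)
  refine (frobenius_le_sum (f t)).trans (le_abs_self _)

end MatrixBigO

/-- Solutions of a contracting linear recursion with bounded inhomogeneity are bounded. -/
theorem isBigO_one_of_contracting {x a b : ℕ → ℝ} {r : ℝ} (hr : r < 1)
    (hx : ∀ t, x (t + 1) = a t * x t + b t) (ha : ∀ᶠ t in atTop, |a t| ≤ r)
    (hb : b =O[atTop] fun _ => (1 : ℝ)) : x =O[atTop] fun _ => (1 : ℝ) := by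
  obtain ⟨C, hC⟩ := (isBigO_one_nat_atTop_iff (f := b)).1 hb
  obtain ⟨T, hT⟩ := eventually_atTop.1 ha
  have hr' : 0 < 1 - r := sub_pos.2 hr
  set B := max |x T| (C / (1 - r))
  have hB : ∀ n, |x (T + n)| ≤ B := fun n => by
    induction n with
    | zero => exact le_max_left _ _
    | succ n ih =>
      have h1 : C ≤ B * (1 - r) := (div_le_iff₀ hr').1 (le_max_right _ _)
      have h2 := hT (T + n) (by omega)
      have h3 : |x (T + n + 1)| ≤ |a (T + n)| * |x (T + n)| + |b (T + n)| := by
        rw [hx, ← abs_mul]; exact abs_add_le _ _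
      have h4 : |b (T + n)| ≤ C := hC _
      have h5 : |a (T + n)| * |x (T + n)| ≤ r * B :=
        mul_le_mul h2 ih (abs_nonneg _) ((abs_nonneg _).trans h2)
      rw [← add_assoc]; linarith
  refine IsBigO.of_bound B (eventually_atTop.2 ⟨T, fun t ht => ?_⟩)
  obtain ⟨n, rfl⟩ := Nat.exists_eq_add_of_le ht
  simpa using hB n

namespace AlignedEM

variable {m q : ℕ} {S : Matrix (Fin m) (Fin m) ℝ} {U : Matrix (Fin m) (Fin q) ℝ} {g : Fin q → ℝ}
  {δ₀ ρ : ℝ} {A : ℕ → Matrix (Fin m) (Fin q) ℝ} {δ : ℕ → ℝ} {Y : ℕ → Matrix (Fin m) (Fin q) ℝ}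

/-- Step size plus distance scale to the invariant subspace. -/
def errorScale (A : ℕ → Matrix (Fin m) (Fin q) ℝ) (δ : ℕ → ℝ) (ρ : ℝ) (t : ℕ) : ℝ :=
  stepSize A δ t + ρ ^ t

theorem tendsto_errorScale (h : AlignedEM S U g δ₀ ρ A δ Y) :
    Tendsto (errorScale A δ ρ) atTop (𝓝 0) := by
  have := h.tendsto_stepSize.add h.decay_zero
  rwa [add_zero] at this

theorem isBigO_pow_errorScale (h : AlignedEM S U g δ₀ ρ A δ Y) :
    (fun t => ρ ^ t) =O[atTop] errorScale A δ ρ :=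
  isBigO_of_le _ fun t => by
    have h1 := stepSize_nonneg A δ t
    have h2 := pow_pos h.rate_pos t
    rw [Real.norm_of_nonneg h2.le, Real.norm_of_nonneg (by unfold errorScale; linarith)]
    unfold errorScale; linarith

theorem isBigO_A_sub (h : AlignedEM S U g δ₀ ρ A δ Y) :
    (fun t => A (t + 1) - A t) =O[atTop] errorScale A δ ρ :=
  isBigO_of_le _ fun t => by
    have h2 := pow_pos h.rate_pos t
    refine le_trans ?_ (le_abs_self _)
    unfold errorScale stepSize
    linarith [abs_nonneg (δ (t + 1) - δ t)]

theorem isBigO_ridge_sub (h : AlignedEM S U g δ₀ ρ A δ Y) :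
    (fun t => δ (t + 1) - δ t) =O[atTop] errorScale A δ ρ :=
  isBigO_of_le _ fun t => by
    have h2 := pow_pos h.rate_pos t
    refine le_trans ?_ (le_abs_self _)
    unfold errorScale stepSize
    rw [Real.norm_eq_abs]
    linarith [norm_nonneg (A (t + 1) - A t)]

theorem isBigO_A (h : AlignedEM S U g δ₀ ρ A δ Y) : A =O[atTop] fun _ => (1 : ℝ) :=
  isBigO_one_nat_atTop_iff.2 h.exists_norm_le

theorem isBigO_ridge (h : AlignedEM S U g δ₀ ρ A δ Y) : δ =O[atTop] fun _ => (1 : ℝ) := by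
  obtain ⟨K, -, hK⟩ := h.exists_ridge_le
  exact isBigO_one_nat_atTop_iff.2 ⟨K, fun t => by
    rw [Real.norm_of_nonneg (h.ridge_pos t).le]; exact hK t⟩

theorem isBigO_ridge_inv (h : AlignedEM S U g δ₀ ρ A δ Y) :
    (fun t => (δ t)⁻¹) =O[atTop] fun _ => (1 : ℝ) := by
  obtain ⟨d, hd0, hd⟩ := h.exists_le_ridge
  exact isBigO_one_nat_atTop_iff.2 ⟨d⁻¹, fun t => by
    rw [Real.norm_of_nonneg (inv_pos.2 (h.ridge_pos t)).le]
    exact inv_anti₀ hd0 (hd t)⟩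

/-- A bounded matrix-valued constant. -/
theorem isBigO_const_one {ι κ : Type*} [Fintype ι] [Fintype κ] (M : Matrix ι κ ℝ) :
    (fun _ : ℕ => M) =O[atTop] fun _ => (1 : ℝ) :=
  isBigO_const_const M one_ne_zero _

theorem isBigO_W (h : AlignedEM S U g δ₀ ρ A δ Y) :
    (fun t => Uᵀ * A t) =O[atTop] fun _ => (1 : ℝ) :=
  (isBigO_const_one Uᵀ).bounded_matrix_mul h.isBigO_A

theorem isBigO_W_sub (h : AlignedEM S U g δ₀ ρ A δ Y) :
    (fun t => Uᵀ * A (t + 1) - Uᵀ * A t) =O[atTop] errorScale A δ ρ := by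
  simpa [Matrix.mul_sub] using (isBigO_const_one Uᵀ).bounded_matrix_mul h.isBigO_A_sub

theorem isBigO_inv_smul_add (h : AlignedEM S U g δ₀ ρ A δ Y) {ι : Type*} [Fintype ι]
    [DecidableEq ι] {N : ℕ → Matrix ι ι ℝ} (hN : ∀ t, (N t).PosSemidef) :
    (fun t => (δ t • (1 : Matrix ι ι ℝ) + N t)⁻¹) =O[atTop] fun _ => (1 : ℝ) := by
  refine IsBigO.trans (IsBigO.of_bound (Fintype.card ι) (Eventually.of_forall fun t => ?_))
    h.isBigO_ridge_inv
  have hδ := h.ridge_pos t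
  refine (frobenius_inv_smul_one_add_le (hN t) hδ).trans (le_of_eq ?_)
  rw [Real.norm_of_nonneg (inv_pos.2 hδ).le, div_eq_mul_inv]

theorem isBigO_emSigma_inv (h : AlignedEM S U g δ₀ ρ A δ Y) :
    (fun t => (emSigma (A t) (δ t))⁻¹) =O[atTop] fun _ => (1 : ℝ) :=
  h.isBigO_inv_smul_add fun t => posSemidef_transpose_mul_self' (A t)

theorem isBigO_emSigma_inv_W (h : AlignedEM S U g δ₀ ρ A δ Y) :
    (fun t => (emSigma (U * (Uᵀ * A t)) (δ t))⁻¹) =O[atTop] fun _ => (1 : ℝ) :=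
  h.isBigO_inv_smul_add fun t => posSemidef_transpose_mul_self' (U * (Uᵀ * A t))

theorem isBigO_YW (h : AlignedEM S U g δ₀ ρ A δ Y) :
    (fun t => Y t * (Uᵀ * A t)) =O[atTop] fun t => ρ ^ t :=
  h.decay.matrix_mul_bounded h.isBigO_W

theorem eq_add (h : AlignedEM S U g δ₀ ρ A δ Y) (t : ℕ) :
    U * (Uᵀ * A t) + Y t * (Uᵀ * A t) = A t := by
  rw [← Matrix.add_mul, ← h.graph t]

theorem compl_mul (h : AlignedEM S U g δ₀ ρ A δ Y) (t : ℕ) : Uᵀ * (Y t * (Uᵀ * A t)) = 0 := by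
  rw [← Matrix.mul_assoc, h.compl, Matrix.zero_mul]

/-- Resolvent identity: the two matrices $\Sigma$ differ by $Z^TZ$ with $Z=YW$. One of the two
decaying factors is enough, the other is used as bounded. -/
theorem isBigO_emSigma_inv_sub (h : AlignedEM S U g δ₀ ρ A δ Y) :
    (fun t => (emSigma (A t) (δ t))⁻¹ - (emSigma (U * (Uᵀ * A t)) (δ t))⁻¹)
      =O[atTop] fun t => ρ ^ t := by
  have h1 : ∀ t, (emSigma (A t) (δ t))⁻¹ - (emSigma (U * (Uᵀ * A t)) (δ t))⁻¹ =
      -((emSigma (A t) (δ t))⁻¹ * ((Y t * (Uᵀ * A t))ᵀ * (Y t * (Uᵀ * A t)))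
        * (emSigma (U * (Uᵀ * A t)) (δ t))⁻¹) := fun t => by
    have e1 := emSigma_isUnit_det (A t) (h.ridge_pos t)
    have e2 := emSigma_isUnit_det (U * (Uᵀ * A t)) (h.ridge_pos t)
    have e3 : (Y t * (Uᵀ * A t))ᵀ * (Y t * (Uᵀ * A t)) =
        emSigma (A t) (δ t) - emSigma (U * (Uᵀ * A t)) (δ t) := by
      have := emSigma_add_of_orthogonal h.orth (Uᵀ * A t) (h.compl_mul t) (δ t)
      rw [h.eq_add] at this
      rw [this, emSigma_mul h.orth, add_sub_cancel_left]
    rw [e3, Matrix.mul_sub, Matrix.sub_mul, Matrix.nonsing_inv_mul _ e1, Matrix.one_mul,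
      Matrix.mul_nonsing_inv_cancel_right _ _ e2]
    abel
  simp only [h1]
  have hZ := h.isBigO_YW
  have hZ1 := hZ.trans (h.decay_zero.isBigO_one ℝ)
  exact ((h.isBigO_emSigma_inv.bounded_matrix_mul
    (hZ1.matrix_transpose.bounded_matrix_mul hZ)).matrix_mul_bounded h.isBigO_emSigma_inv_W).neg_left

theorem isBigO_emGain_sub (h : AlignedEM S U g δ₀ ρ A δ Y) :
    (fun t => emGain S (A t) (δ t) - emGain S (U * (Uᵀ * A t)) (δ t))
      =O[atTop] fun t => ρ ^ t := by
  have h1 : ∀ t, emGain S (A t) (δ t) - emGain S (U * (Uᵀ * A t)) (δ t) =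
      ((emSigma (A t) (δ t))⁻¹ - (emSigma (U * (Uᵀ * A t)) (δ t))⁻¹) * ((A t)ᵀ * S * A t)
        + (emSigma (U * (Uᵀ * A t)) (δ t))⁻¹ *
          ((Y t * (Uᵀ * A t))ᵀ * S * (Y t * (Uᵀ * A t))) := fun t => by
    have e1 := transpose_mul_mul_add h.psd h.orth h.eig (Uᵀ * A t) (h.compl_mul t)
    have e2 := transpose_mul_mul_add h.psd h.orth h.eig (Uᵀ * A t) (Matrix.mul_zero Uᵀ)
    rw [h.eq_add] at e1
    simp only [add_zero, Matrix.transpose_zero, Matrix.zero_mul] at e2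
    rw [← e2] at e1
    have e3 : (Y t * (Uᵀ * A t))ᵀ * S * (Y t * (Uᵀ * A t)) =
      (A t)ᵀ * S * A t - (U * (Uᵀ * A t))ᵀ * S * (U * (Uᵀ * A t)) := by
      rw [e1, add_sub_cancel_left]
    rw [e3, emGain, emGain, Matrix.sub_mul, Matrix.mul_sub]
    simp only [Matrix.mul_assoc]
    abel
  simp only [h1]
  have hZ := h.isBigO_YW
  have hZ1 := hZ.trans (h.decay_zero.isBigO_one ℝ)
  refine (h.isBigO_emSigma_inv_sub.matrix_mul_bounded ?_).add
    (h.isBigO_emSigma_inv_W.bounded_matrix_mul ?_)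
  · exact (h.isBigO_A.matrix_transpose.matrix_mul_bounded
      (isBigO_const_one S)).matrix_mul_bounded h.isBigO_A
  · exact (hZ1.matrix_transpose.matrix_mul_bounded (isBigO_const_one S)).bounded_matrix_mul hZ

theorem isBigO_emGain_W (h : AlignedEM S U g δ₀ ρ A δ Y) :
    (fun t => emGain S (U * (Uᵀ * A t)) (δ t)) =O[atTop] fun _ => (1 : ℝ) := by
  have hA : (fun t => U * (Uᵀ * A t)) =O[atTop] fun _ => (1 : ℝ) :=
    (isBigO_const_one U).bounded_matrix_mul h.isBigO_W
  exact (h.isBigO_ridge.bounded_smul (isBigO_const_one 1)).add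
    (((h.isBigO_emSigma_inv_W.matrix_mul_bounded hA.matrix_transpose).matrix_mul_bounded
      (isBigO_const_one S)).matrix_mul_bounded hA)

theorem W_succ_mul_emGain (h : AlignedEM S U g δ₀ ρ A δ Y) (t : ℕ) :
    Uᵀ * A (t + 1) * emGain S (A t) (δ t) = diagonal g * (Uᵀ * A t) :=
  transpose_mul_emStep h.psd h.eig (h.ridge_pos t) (h.em.step_A t)

/-- The defect `Γ⁻¹ - (δ + W Wᵀ)⁻¹` of the stationarity equation, `W = Uᵀ A`. -/
def defect (U : Matrix (Fin m) (Fin q) ℝ) (g : Fin q → ℝ) (A : ℕ → Matrix (Fin m) (Fin q) ℝ)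
    (δ : ℕ → ℝ) (t : ℕ) : Matrix (Fin q) (Fin q) ℝ :=
  diagonal (fun i => (g i)⁻¹) -
    (δ t • (1 : Matrix (Fin q) (Fin q) ℝ) + (Uᵀ * A t) * (Uᵀ * A t)ᵀ)⁻¹

/-- By `mul_emGain_mul_sub` the product is $\delta^{-1}(WK_U-\Gamma W)$, where $K_U$ is the gain at
$UW$ and $\Gamma W=W'K$. What remains is a step $W'-W$ and the gain error $K-K_U=O(\rho^t)$. -/
theorem isBigO_defect_mul (h : AlignedEM S U g δ₀ ρ A δ Y) :
    (fun t => defect U g A δ t * diagonal g * (Uᵀ * A t)) =O[atTop] errorScale A δ ρ := by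
  have h1 : ∀ t, defect U g A δ t * diagonal g * (Uᵀ * A t) = (δ t)⁻¹ •
      (-((Uᵀ * A (t + 1) - Uᵀ * A t) * emGain S (U * (Uᵀ * A t)) (δ t))
        - Uᵀ * A (t + 1) * (emGain S (A t) (δ t) - emGain S (U * (Uᵀ * A t)) (δ t))) :=
      fun t => by
    have e1 := mul_emGain_mul_sub h.psd h.orth h.eig h.g_pos (Uᵀ * A t) (h.ridge_pos t)
    rw [← W_succ_mul_emGain h t] at e1
    have e2 : -((Uᵀ * A (t + 1) - Uᵀ * A t) * emGain S (U * (Uᵀ * A t)) (δ t))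
        - Uᵀ * A (t + 1) * (emGain S (A t) (δ t) - emGain S (U * (Uᵀ * A t)) (δ t)) =
        Uᵀ * A t * emGain S (U * (Uᵀ * A t)) (δ t)
          - Uᵀ * A (t + 1) * emGain S (A t) (δ t) := by
      rw [Matrix.sub_mul, Matrix.mul_sub]; abel
    rw [e2, e1, smul_smul, inv_mul_cancel₀ (h.ridge_pos t).ne', one_smul, defect]
  simp only [h1]
  have hW' := h.isBigO_W.comp_tendsto (tendsto_add_atTop_nat 1)
  exact h.isBigO_ridge_inv.bounded_smul ((h.isBigO_W_sub.matrix_mul_bounded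
    h.isBigO_emGain_W).neg_left.sub (IsBigO.bounded_matrix_mul hW'
      (h.isBigO_emGain_sub.trans h.isBigO_pow_errorScale)))

/-- For $A=A'=UW$ the ridge update would be exactly
$m\delta'=(m-q)\delta_0+\delta\operatorname{tr}(Q^{-1}\Gamma)$; moving $A'$ to $A$ costs the step
length, and moving $A$ to $UW$ costs $\rho^t$. -/
theorem isBigO_ridge_equation (h : AlignedEM S U g δ₀ ρ A δ Y) :
    (fun t => m * δ (t + 1) - (((m : ℝ) - q) * δ₀ + δ t *
      ((δ t • (1 : Matrix (Fin q) (Fin q) ℝ) + (Uᵀ * A t) * (Uᵀ * A t)ᵀ)⁻¹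
        * diagonal g).trace)) =O[atTop] errorScale A δ ρ := by
  have h1 : ∀ t, m * δ (t + 1) - (((m : ℝ) - q) * δ₀ + δ t *
      ((δ t • (1 : Matrix (Fin q) (Fin q) ℝ) + (Uᵀ * A t) * (Uᵀ * A t)ᵀ)⁻¹
        * diagonal g).trace) =
      (-((A (t + 1) - A t) * ((emSigma (A t) (δ t))⁻¹ * (A t)ᵀ * S))
        - (Y t * (Uᵀ * A t)) * ((emSigma (A t) (δ t))⁻¹ * (A t)ᵀ * S)
        - U * (Uᵀ * A t) * (((emSigma (A t) (δ t))⁻¹ - (emSigma (U * (Uᵀ * A t)) (δ t))⁻¹)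
          * ((A t)ᵀ * S))
        - U * (Uᵀ * A t) * ((emSigma (U * (Uᵀ * A t)) (δ t))⁻¹
          * ((Y t * (Uᵀ * A t))ᵀ * S))).trace := fun t => by
    have e1 := trace_mul_emSigma_inv h.psd h.orth h.eig (Uᵀ * A t) (h.ridge_pos t)
    have e2 : S.trace - (A (t + 1) * (emSigma (A t) (δ t))⁻¹ * (A t)ᵀ * S).trace
        = m * δ (t + 1) := by
      rw [h.em.step_δ t, ← mul_assoc, mul_one_div_cancel h.dim_pos.ne', one_mul]
    have e3 : (-((A (t + 1) - A t) * ((emSigma (A t) (δ t))⁻¹ * (A t)ᵀ * S))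
        - (Y t * (Uᵀ * A t)) * ((emSigma (A t) (δ t))⁻¹ * (A t)ᵀ * S)
        - U * (Uᵀ * A t) * (((emSigma (A t) (δ t))⁻¹ - (emSigma (U * (Uᵀ * A t)) (δ t))⁻¹)
          * ((A t)ᵀ * S))
        - U * (Uᵀ * A t) * ((emSigma (U * (Uᵀ * A t)) (δ t))⁻¹
          * ((Y t * (Uᵀ * A t))ᵀ * S))) =
        U * (Uᵀ * A t) * (emSigma (U * (Uᵀ * A t)) (δ t))⁻¹ * (U * (Uᵀ * A t))ᵀ * S
          - A (t + 1) * (emSigma (A t) (δ t))⁻¹ * (A t)ᵀ * S := by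
      have f1 : Y t * (Uᵀ * A t) = A t - U * (Uᵀ * A t) :=
        eq_sub_of_add_eq' (h.eq_add t)
      rw [f1]
      simp only [Matrix.transpose_sub, Matrix.sub_mul, Matrix.mul_sub, Matrix.mul_assoc]
      abel
    rw [e3, Matrix.trace_sub, e1, ← e2, ← h.trace_eq]
    ring
  simp only [h1]
  have hB : (fun t => (emSigma (A t) (δ t))⁻¹ * (A t)ᵀ * S) =O[atTop] fun _ => (1 : ℝ) :=
    (h.isBigO_emSigma_inv.matrix_mul_bounded h.isBigO_A.matrix_transpose).matrix_mul_bounded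
      (isBigO_const_one S)
  have hUW : (fun t => U * (Uᵀ * A t)) =O[atTop] fun _ => (1 : ℝ) :=
    (isBigO_const_one U).bounded_matrix_mul h.isBigO_W
  have hZ := h.isBigO_YW.trans h.isBigO_pow_errorScale
  have hAS : (fun t => (A t)ᵀ * S) =O[atTop] fun _ => (1 : ℝ) :=
    h.isBigO_A.matrix_transpose.matrix_mul_bounded (isBigO_const_one S)
  refine IsBigO.matrix_trace (((IsBigO.sub ?_ ?_).sub ?_).sub ?_)
  · exact (h.isBigO_A_sub.matrix_mul_bounded hB).neg_left
  · exact hZ.matrix_mul_bounded hB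
  · exact hUW.bounded_matrix_mul ((h.isBigO_emSigma_inv_sub.trans
      h.isBigO_pow_errorScale).matrix_mul_bounded hAS)
  · exact hUW.bounded_matrix_mul (h.isBigO_emSigma_inv_W.bounded_matrix_mul
      (hZ.matrix_transpose.matrix_mul_bounded (isBigO_const_one S)))

end AlignedEM

end Asymptotics

/-! ### Gradient-type inequality and convergence. -/

noncomputable section Convergence

open scoped Matrix.Norms.Frobenius

open Asymptotics

/-- A nonnegative sequence satisfying a contracting recursion with geometric inhomogeneity decays
geometrically. -/
theorem exists_geometric_bound {x : ℕ → ℝ} {a b ρ : ℝ} (ha0 : 0 ≤ a) (ha : a < 1) (hb : 0 ≤ b)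
    (hρ0 : 0 < ρ) (hρ : ρ < 1) (hx : ∀ᶠ t in atTop, x (t + 1) ≤ a * x t + b * ρ ^ t) :
    ∃ r, 0 < r ∧ r < 1 ∧ ∃ C, 0 ≤ C ∧ ∀ᶠ t in atTop, x t ≤ C * r ^ t := by
  obtain ⟨T, hT⟩ := eventually_atTop.1 hx
  obtain ⟨r, hr1, hr2⟩ := exists_between (max_lt ha hρ)
  have har : a < r := (le_max_left _ _).trans_lt hr1
  have hρr : ρ < r := (le_max_right _ _).trans_lt hr1
  have hr0 : 0 < r := hρ0.trans hρr
  have hra : 0 < r - a := sub_pos.2 har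
  set C := max (|x T| / r ^ T) (b / (r - a))
  have hC0 : 0 ≤ C := le_max_of_le_right (by positivity)
  refine ⟨r, hr0, hr2, C, hC0, eventually_atTop.2 ⟨T, fun t ht => ?_⟩⟩
  induction t, ht using Nat.le_induction with
  | base =>
    have := (div_le_iff₀ (pow_pos hr0 T)).1 (le_max_left (|x T| / r ^ T) (b / (r - a)))
    exact (le_abs_self _).trans this
  | succ t ht ih =>
    have h1 : b ≤ C * (r - a) := (div_le_iff₀ hra).1 (le_max_right _ _)
    have h2 : ρ ^ t ≤ r ^ t := pow_le_pow_left₀ hρ0.le hρr.le t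
    calc x (t + 1) ≤ a * x t + b * ρ ^ t := hT t ht
      _ ≤ a * (C * r ^ t) + C * (r - a) * r ^ t :=
        add_le_add (mul_le_mul_of_nonneg_left ih ha0)
          (mul_le_mul h1 h2 (pow_pos hρ0 t).le (mul_nonneg hC0 hra.le))
      _ = C * r ^ (t + 1) := by ring

/-- Eliminating $s_t$ between the descent estimate and the gap estimate makes the gap contract up to
a geometric term. The gap thus decays geometrically, and so does $s_t$, being bounded by a multiple
of its square root. -/
theorem summable_of_descent {x s : ℕ → ℝ} {x₀ K ρ : ℝ} (hρ0 : 0 < ρ) (hρ : ρ < 1)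
    (hanti : Antitone x) (hs0 : ∀ t, 0 ≤ s t) (hK : 0 < K)
    (hdesc : ∀ t, s t ^ 2 ≤ K * (x t - x (t + 1)))
    (hlim : ∀ t, x₀ ≤ x t)
    (hgap : ∃ C, 0 < C ∧ ∀ᶠ t in atTop, x t - x₀ ≤ C * (s t + ρ ^ t) ^ 2) : Summable s := by
  obtain ⟨C, hC, hgap⟩ := hgap
  -- The $2CK$ comes from $(s+\rho^t)^2\le2s^2+2\rho^{2t}$; the added $1$ ensures $M>1$, hence
  -- $0<1-1/M<1$.
  set M := 2 * C * K + 1 with hM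
  have hM1 : 1 < M := by have := mul_pos (mul_pos two_pos hC) hK; linarith
  have hM0 : 0 < M := one_pos.trans hM1
  have hrec : ∀ᶠ t in atTop, x (t + 1) - x₀ ≤ (1 - 1 / M) * (x t - x₀) + (2 * C / M) * (ρ ^ 2) ^ t := by
    filter_upwards [hgap] with t ht
    have h1 : (s t + ρ ^ t) ^ 2 ≤ 2 * s t ^ 2 + 2 * (ρ ^ 2) ^ t := by
      rw [pow_right_comm]; nlinarith [sq_nonneg (s t - ρ ^ t)]
    have h2 := hdesc t
    have h3 : x (t + 1) ≤ x t := hanti (Nat.le_succ t)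
    have h4 : x t - x₀ ≤ M * (x t - x (t + 1)) + 2 * C * (ρ ^ 2) ^ t := by
      have := mul_le_mul_of_nonneg_left h1 hC.le
      have := mul_le_mul_of_nonneg_left h2 hC.le
      rw [hM]; nlinarith
    have h5 : (x t - x₀) / M ≤ (x t - x (t + 1)) + 2 * C / M * (ρ ^ 2) ^ t := by
      rw [div_le_iff₀ hM0]
      have : (x t - x (t + 1) + 2 * C / M * (ρ ^ 2) ^ t) * M =
        M * (x t - x (t + 1)) + 2 * C * (ρ ^ 2) ^ t := by field_simp
      rw [this]; exact h4
    have h6 : (1 - 1 / M) * (x t - x₀) = (x t - x₀) - (x t - x₀) / M := by ring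
    rw [h6]; linarith
  obtain ⟨r, hr0, hr1, B, hB0, hB⟩ := exists_geometric_bound (x := fun t => x t - x₀)
    (a := 1 - 1 / M) (b := 2 * C / M) (ρ := ρ ^ 2)
    (by rw [sub_nonneg, div_le_one hM0]; exact hM1.le)
    (by have := one_div_pos.2 hM0; linarith) (by positivity) (by positivity)
    (pow_lt_one₀ hρ0.le hρ two_ne_zero) hrec
  have hbound : ∀ᶠ t in atTop, s t ≤ √(K * B) * √r ^ t := by
    filter_upwards [hB] with t ht
    have h1 : s t ^ 2 ≤ K * (B * r ^ t) :=
      (hdesc t).trans (mul_le_mul_of_nonneg_left (by linarith [hlim (t + 1)]) hK.le)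
    refine (Real.le_sqrt_of_sq_le h1).trans (le_of_eq ?_)
    rw [← mul_assoc, Real.sqrt_mul (by positivity), show √(r ^ t) = √r ^ t from ?_]
    rw [Real.sqrt_eq_iff_mul_self_eq (by positivity) (by positivity), ← mul_pow,
      Real.mul_self_sqrt hr0.le]
  have hsum : Summable fun t => √(K * B) * √r ^ t :=
    (summable_geometric_of_lt_one (Real.sqrt_nonneg _)
      (by rw [Real.sqrt_lt' one_pos]; simpa using hr1)).mul_left _
  refine summable_of_isBigO_nat hsum (IsBigO.of_bound 1 ?_)
  filter_upwards [hbound] with t ht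
  rw [Real.norm_of_nonneg (hs0 t), Real.norm_of_nonneg (by positivity), one_mul]
  exact ht

namespace AlignedEM

variable {m q : ℕ} {S : Matrix (Fin m) (Fin m) ℝ} {U : Matrix (Fin m) (Fin q) ℝ} {g : Fin q → ℝ}
  {δ₀ ρ : ℝ} {A : ℕ → Matrix (Fin m) (Fin q) ℝ} {δ : ℕ → ℝ} {Y : ℕ → Matrix (Fin m) (Fin q) ℝ}

theorem mul_W_inv (h : AlignedEM S U g δ₀ ρ A δ Y) (t : ℕ) :
    A t * (Uᵀ * A t)⁻¹ = U + Y t := by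
  conv_lhs => rw [h.graph t]
  rw [← Matrix.mul_assoc Uᵀ, Matrix.mul_add, h.orth, h.compl, add_zero, Matrix.one_mul,
    Matrix.mul_nonsing_inv_cancel_right _ _ (h.unit t)]

/-- Inverting the power iteration gives a linear recursion: since $AW^{-1}=U+Y$, the second part of
the gain contributes only a bounded inhomogeneity, and column $i$ is multiplied by $\delta_t/g_i$.
-/
theorem W_inv_succ (h : AlignedEM S U g δ₀ ρ A δ Y) (t : ℕ) :
    (Uᵀ * A (t + 1))⁻¹ = δ t • ((Uᵀ * A t)⁻¹ * diagonal fun i => (g i)⁻¹)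
      + (emSigma (A t) (δ t))⁻¹ * (A t)ᵀ * S * (U + Y t) * diagonal fun i => (g i)⁻¹ := by
  refine Matrix.inv_eq_right_inv ?_
  have hGG : diagonal g * (diagonal fun i => (g i)⁻¹) = 1 := by
    rw [Matrix.diagonal_mul_diagonal, ← Matrix.diagonal_one]
    congr 1; ext i; exact mul_inv_cancel₀ (h.g_pos i).ne'
  have h1 : δ t • ((Uᵀ * A t)⁻¹ * diagonal fun i => (g i)⁻¹)
      + (emSigma (A t) (δ t))⁻¹ * (A t)ᵀ * S * (U + Y t) * (diagonal fun i => (g i)⁻¹) =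
      emGain S (A t) (δ t) * ((Uᵀ * A t)⁻¹ * diagonal fun i => (g i)⁻¹) := by
    rw [emGain, Matrix.add_mul, ← h.mul_W_inv]
    simp only [Matrix.smul_mul, Matrix.one_mul, Matrix.mul_assoc]
  rw [h1, ← Matrix.mul_assoc, h.W_succ_mul_emGain, ← Matrix.mul_assoc, Matrix.mul_assoc (diagonal g),
    Matrix.mul_nonsing_inv _ (h.unit t), Matrix.mul_one, hGG]

theorem isBigO_W_inv_apply (h : AlignedEM S U g δ₀ ρ A δ Y) {i : Fin q} {c : ℝ} (hc : c < g i)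
    (hδ : ∀ᶠ t in atTop, δ t < c) (j : Fin q) :
    (fun t => (Uᵀ * A t)⁻¹ j i) =O[atTop] fun _ => (1 : ℝ) := by
  have hgi := h.g_pos i
  refine isBigO_one_of_contracting (r := c / g i) ((div_lt_one hgi).2 hc)
    (a := fun t => δ t / g i)
    (b := fun t => ((emSigma (A t) (δ t))⁻¹ * (A t)ᵀ * S * (U + Y t)
      * diagonal fun i => (g i)⁻¹) j i) (fun t => ?_) ?_ ?_
  · rw [h.W_inv_succ, Matrix.add_apply, Matrix.smul_apply, Matrix.mul_diagonal, smul_eq_mul]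
    ring
  · filter_upwards [hδ] with t ht
    have := h.ridge_pos t
    rw [abs_of_pos (by positivity)]
    gcongr
  · refine IsBigO.matrix_apply ?_ j i
    refine IsBigO.matrix_mul_bounded ?_ (isBigO_const_one _)
    refine IsBigO.matrix_mul_bounded ?_ ((isBigO_const_one U).add
      (h.decay.trans (h.decay_zero.isBigO_one ℝ)))
    exact (h.isBigO_emSigma_inv.matrix_mul_bounded
      h.isBigO_A.matrix_transpose).matrix_mul_bounded (isBigO_const_one S)

/-- Cancel $W$ in $D\Gamma W$ by multiplying with column $i$ of $W^{-1}$, which is bounded once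
$\delta_t$ stays below some $c<g_i$. -/
theorem isBigO_defect_diag (h : AlignedEM S U g δ₀ ρ A δ Y) {i : Fin q} {c : ℝ} (hc : c < g i)
    (hδ : ∀ᶠ t in atTop, δ t < c) (k : Fin q) :
    (fun t => defect U g A δ t k i) =O[atTop] errorScale A δ ρ := by
  have h1 : ∀ t, defect U g A δ t k i = (g i)⁻¹ *
      ∑ j, (defect U g A δ t * diagonal g * (Uᵀ * A t)) k j * (Uᵀ * A t)⁻¹ j i := fun t => by
    rw [← Matrix.mul_apply, Matrix.mul_nonsing_inv_cancel_right _ _ (h.unit t),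
      Matrix.mul_diagonal]
    field_simp [(h.g_pos i).ne']
  simp only [h1]
  refine IsBigO.const_mul_left (IsBigO.fun_sum fun j _ => ?_) _
  simpa using (h.isBigO_defect_mul.matrix_apply k j).mul (h.isBigO_W_inv_apply hc hδ j)

/-- Two regimes. If $g_i\le L$, the trivial bound $\delta(Q^{-1})_{ii}\le1$ suffices. If $g_i>L$,
column $i$ of the defect tends to zero and the quantity is $\delta_t+o(1)$. No prior comparison of
$\delta_t$ with the eigenvalues is needed. -/
theorem eventually_mul_diag_le (h : AlignedEM S U g δ₀ ρ A δ Y) {L : ℝ}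
    (hL : ∀ c, L < c → ∀ᶠ t in atTop, δ t < c) {ε : ℝ} (hε : 0 < ε) (i : Fin q) :
    ∀ᶠ t in atTop, δ t * ((δ t • (1 : Matrix (Fin q) (Fin q) ℝ)
      + (Uᵀ * A t) * (Uᵀ * A t)ᵀ)⁻¹ i i * g i) ≤ L + ε := by
  have hgi := h.g_pos i
  rcases le_or_gt (g i) L with hi | hi
  · refine Eventually.of_forall fun t => ?_
    have hδ := h.ridge_pos t
    have h1 := inv_smul_one_add_diag_le (posSemidef_mul_transpose_self' (Uᵀ * A t)) hδ i
    rw [le_div_iff₀ hδ] at h1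
    nlinarith
  · obtain ⟨c, hLc, hc⟩ := exists_between hi
    have h1 : (fun t => δ t * (defect U g A δ t i i * g i)) =O[atTop] errorScale A δ ρ := by
      simpa using h.isBigO_ridge.mul ((h.isBigO_defect_diag hc (hL c hLc) i).mul
        (isBigO_refl (fun _ => g i) atTop) |>.trans (by
          simpa [mul_comm] using (isBigO_refl (errorScale A δ ρ) atTop).const_mul_left (g i)))
    have h2 := h1.trans_tendsto h.tendsto_errorScale
    filter_upwards [hL (L + ε / 2) (by linarith), h2.eventually_const_lt (by linarith : -(ε / 2) < 0)]
      with t h3 h4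
    have h5 : δ t * ((δ t • (1 : Matrix (Fin q) (Fin q) ℝ)
        + (Uᵀ * A t) * (Uᵀ * A t)ᵀ)⁻¹ i i * g i) = δ t - δ t * (defect U g A δ t i i * g i) := by
      rw [defect, Matrix.sub_apply, Matrix.diagonal_apply_eq]
      field_simp
      ring
    linarith

/-- Inserting the bound for each diagonal entry into the ridge equation gives
$mL\le(m-q)\delta_0+qL$ for the limit superior $L$. This makes the boundedness of $W^{-1}$ available
for every column. -/
theorem limsup_ridge_le (h : AlignedEM S U g δ₀ ρ A δ Y) : limsup δ atTop ≤ δ₀ := by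
  obtain ⟨K, -, hK⟩ := h.exists_ridge_le
  have hbdd : IsBoundedUnder (· ≤ ·) atTop δ := isBoundedUnder_of ⟨K, hK⟩
  have hcob : IsCoboundedUnder (· ≤ ·) atTop δ :=
    (isBoundedUnder_of (r := (· ≥ ·)) ⟨0, fun t => (h.ridge_pos t).le⟩).isCoboundedUnder_le
  set L := limsup δ atTop
  have hL : ∀ c, L < c → ∀ᶠ t in atTop, δ t < c := fun c hc => eventually_lt_of_limsup_lt hc hbdd
  have hm := h.dim_pos
  have key : ∀ ε > 0, m * L ≤ ((m : ℝ) - q) * δ₀ + q * (L + ε) + ε := fun ε hε => by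
    have h1 := h.isBigO_ridge_equation.trans_tendsto h.tendsto_errorScale
    have h2 : ∀ᶠ t in atTop, m * δ (t + 1) ≤ ((m : ℝ) - q) * δ₀ + q * (L + ε) + ε := by
      filter_upwards [h1.eventually_lt_const hε,
        eventually_all.2 (h.eventually_mul_diag_le hL hε)] with t h3 h4
      have h5 : δ t * ((δ t • (1 : Matrix (Fin q) (Fin q) ℝ) + (Uᵀ * A t) * (Uᵀ * A t)ᵀ)⁻¹
          * diagonal g).trace ≤ q * (L + ε) := by
        simp only [Matrix.trace, Matrix.diag, Matrix.mul_diagonal]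
        rw [Finset.mul_sum]
        refine (Finset.sum_le_card_nsmul _ _ (L + ε) fun i _ => h4 i).trans (le_of_eq ?_)
        rw [nsmul_eq_mul, Finset.card_univ, Fintype.card_fin]
      linarith
    have h3 : ∀ᶠ t in atTop, δ t ≤ (((m : ℝ) - q) * δ₀ + q * (L + ε) + ε) / m := by
      obtain ⟨T, hT⟩ := eventually_atTop.1 h2
      refine eventually_atTop.2 ⟨T + 1, fun t ht => ?_⟩
      obtain ⟨n, rfl⟩ := Nat.exists_eq_add_of_le ht
      rw [le_div_iff₀ hm, mul_comm]
      have := hT (T + n) (by omega)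
      rwa [show T + 1 + n = T + n + 1 by omega]
    have h4 := limsup_le_of_le hcob h3
    rw [le_div_iff₀ hm] at h4
    linarith
  have h1 : m * L ≤ ((m : ℝ) - q) * δ₀ + q * L := by
    refine le_of_forall_pos_le_add fun ε hε => ?_
    have hq : (0 : ℝ) < q + 1 := by positivity
    have := key (ε / (q + 1)) (by positivity)
    have e : q * (ε / (q + 1)) + ε / (q + 1) = ε := by field_simp
    linarith
  have h2 := h.codim_pos
  nlinarith

theorem isBigO_defect (h : AlignedEM S U g δ₀ ρ A δ Y) :
    defect U g A δ =O[atTop] errorScale A δ ρ := by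
  obtain ⟨K, -, hK⟩ := h.exists_ridge_le
  have hbdd : IsBoundedUnder (· ≤ ·) atTop δ := isBoundedUnder_of ⟨K, hK⟩
  refine isBigO_matrix_of_apply fun k i => ?_
  obtain ⟨c, hc1, hc2⟩ := exists_between (h.opt_lt i)
  exact h.isBigO_defect_diag hc2
    (eventually_lt_of_limsup_lt (h.limsup_ridge_le.trans_lt hc1) hbdd) k

/-- Substitute $\operatorname{tr}(Q^{-1}\Gamma)=q-\operatorname{tr}(D\Gamma)$ in the ridge equation
and solve for $(m-q)(\delta-\delta_0)$. -/
theorem isBigO_ridge_sub_opt (h : AlignedEM S U g δ₀ ρ A δ Y) :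
    (fun t => δ t - δ₀) =O[atTop] errorScale A δ ρ := by
  have h1 : ∀ t, δ t - δ₀ = ((m : ℝ) - q)⁻¹ * ((m * δ (t + 1) - (((m : ℝ) - q) * δ₀ + δ t *
      ((δ t • (1 : Matrix (Fin q) (Fin q) ℝ) + (Uᵀ * A t) * (Uᵀ * A t)ᵀ)⁻¹
        * diagonal g).trace)) - m * (δ (t + 1) - δ t)
        - δ t * (defect U g A δ t * diagonal g).trace) := fun t => by
    have hGG : (diagonal fun i => (g i)⁻¹) * diagonal g = 1 := by
      rw [Matrix.diagonal_mul_diagonal, ← Matrix.diagonal_one]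
      congr 1; ext i; exact inv_mul_cancel₀ (h.g_pos i).ne'
    have hc := h.codim_pos.ne'
    rw [defect, Matrix.sub_mul, Matrix.trace_sub, hGG, Matrix.trace_one, Fintype.card_fin]
    field_simp
    ring
  simp only [h1]
  refine IsBigO.const_mul_left ((h.isBigO_ridge_equation.sub
    (h.isBigO_ridge_sub.const_mul_left _)).sub ?_) _
  simpa using h.isBigO_ridge.mul
    (h.isBigO_defect.matrix_mul_bounded (isBigO_const_one (diagonal g))).matrix_trace

/-- Three contributions, each quadratic in a quantity of the error scale: the component $YW$ off the
subspace, the defect, and $\delta-\delta_0$. -/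
theorem lossG_sub_le (h : AlignedEM S U g δ₀ ρ A δ Y) :
    ∃ C, 0 < C ∧ ∀ᶠ t in atTop, lossG S (A t) (δ t) - optimalLoss m g δ₀
      ≤ C * errorScale A δ ρ t ^ 2 := by
  set E : ℕ → ℝ := fun t =>
    (δ t)⁻¹ * (Y t * (Uᵀ * A t) * emMoment S (U * (Uᵀ * A t)) (δ t) * (Y t * (Uᵀ * A t))ᵀ).trace
    + (defect U g A δ t * diagonal g * defect U g A δ t
        * (δ t • (1 : Matrix (Fin q) (Fin q) ℝ) + (Uᵀ * A t) * (Uᵀ * A t)ᵀ)).trace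
    + ((m : ℝ) - q) * δ₀⁻¹ * ((δ t)⁻¹ * ((δ t - δ₀) * (δ t - δ₀))) with hE
  have hZ := h.isBigO_YW.trans h.isBigO_pow_errorScale
  have hUW : (fun t => U * (Uᵀ * A t)) =O[atTop] fun _ => (1 : ℝ) :=
    (isBigO_const_one U).bounded_matrix_mul h.isBigO_W
  have hR : (fun t => emMoment S (U * (Uᵀ * A t)) (δ t)) =O[atTop] fun _ => (1 : ℝ) := by
    have hB : (fun t => emLoading (U * (Uᵀ * A t)) (δ t)) =O[atTop] fun _ => (1 : ℝ) :=
      h.isBigO_emSigma_inv_W.matrix_mul_bounded hUW.matrix_transpose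
    exact ((hB.matrix_mul_bounded (isBigO_const_one S)).matrix_mul_bounded
      hB.matrix_transpose).add (h.isBigO_ridge.bounded_smul h.isBigO_emSigma_inv_W)
  have hQ : (fun t => δ t • (1 : Matrix (Fin q) (Fin q) ℝ) + (Uᵀ * A t) * (Uᵀ * A t)ᵀ)
      =O[atTop] fun _ => (1 : ℝ) :=
    (h.isBigO_ridge.bounded_smul (isBigO_const_one 1)).add
      (h.isBigO_W.matrix_mul_bounded h.isBigO_W.matrix_transpose)
  have hEO : E =O[atTop] fun t => errorScale A δ ρ t * errorScale A δ ρ t := by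
    refine (IsBigO.add ?_ ?_).add (IsBigO.const_mul_left ?_ _)
    · simpa using h.isBigO_ridge_inv.mul
        ((hZ.matrix_mul_bounded hR).matrix_mul hZ.matrix_transpose).matrix_trace
    · exact (((h.isBigO_defect.matrix_mul_bounded (isBigO_const_one _)).matrix_mul
        h.isBigO_defect).matrix_mul_bounded hQ).matrix_trace
    · simpa using h.isBigO_ridge_inv.mul (h.isBigO_ridge_sub_opt.mul h.isBigO_ridge_sub_opt)
  obtain ⟨C, hC0, hC⟩ := hEO.exists_pos
  refine ⟨C, hC0, ?_⟩
  filter_upwards [hC.bound] with t ht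
  have hδ := h.ridge_pos t
  have h1 := lossG_add_orthogonal_le h.psd h.eig (Uᵀ * A t) (h.compl_mul t) hδ
  have h2 := lossG_mul_le h.psd h.orth h.eig h.g_pos h.opt_pos h.lt h.trace_eq (Uᵀ * A t) hδ
    (D := defect U g A δ t) rfl
  rw [h.eq_add] at h1
  have h3 : (δ t - δ₀) ^ 2 / (δ t * δ₀) = δ₀⁻¹ * ((δ t)⁻¹ * ((δ t - δ₀) * (δ t - δ₀))) := by
    field_simp
  have h4 : E t ≤ C * errorScale A δ ρ t ^ 2 := by
    refine (le_abs_self _).trans (ht.trans (le_of_eq ?_))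
    rw [norm_mul, Real.norm_eq_abs, abs_mul_abs_self, pow_two]
  rw [h3, ← mul_assoc] at h2
  rw [one_div] at h1
  simp only [hE] at h4
  linarith

theorem tendsto_ridge (h : AlignedEM S U g δ₀ ρ A δ Y) : Tendsto δ atTop (𝓝 δ₀) :=
  tendsto_sub_nhds_zero_iff.1 (h.isBigO_ridge_sub_opt.trans_tendsto h.tendsto_errorScale)

/-- Accumulation points of the iterates of `A` are optimal. -/
theorem eq_of_tendsto_comp (h : AlignedEM S U g δ₀ ρ A δ Y) {φ : ℕ → ℕ}
    (hφ : Tendsto φ atTop atTop) {A' : Matrix (Fin m) (Fin q) ℝ}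
    (hA : Tendsto (A ∘ φ) atTop (𝓝 A')) :
    A' = U * (Uᵀ * A') ∧ (Uᵀ * A') * (Uᵀ * A')ᵀ = diagonal fun i => g i - δ₀ := by
  have hW : Tendsto (fun t => Uᵀ * A (φ t)) atTop (𝓝 (Uᵀ * A')) :=
    ((continuous_const.matrix_mul continuous_id).tendsto A').comp hA
  constructor
  · have h1 : Tendsto (fun t => U * (Uᵀ * A (φ t)) + Y (φ t) * (Uᵀ * A (φ t))) atTop
        (𝓝 (U * (Uᵀ * A') + 0)) :=
      (((continuous_const.matrix_mul continuous_id).tendsto (Uᵀ * A')).comp hW).add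
        ((h.isBigO_YW.trans_tendsto h.decay_zero).comp hφ)
    simp only [h.eq_add, add_zero] at h1
    exact tendsto_nhds_unique hA h1
  · have hQ : Tendsto (fun t => δ (φ t) • (1 : Matrix (Fin q) (Fin q) ℝ)
        + (Uᵀ * A (φ t)) * (Uᵀ * A (φ t))ᵀ) atTop
        (𝓝 (δ₀ • (1 : Matrix (Fin q) (Fin q) ℝ) + (Uᵀ * A') * (Uᵀ * A')ᵀ)) :=
      ((h.tendsto_ridge.comp hφ).smul_const 1).add
        (((continuous_id.matrix_mul continuous_id.matrix_transpose).tendsto (Uᵀ * A')).comp hW)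
    have hX : Tendsto (fun t => diagonal (fun i => (g i)⁻¹) - defect U g A δ (φ t)) atTop
        (𝓝 (diagonal (fun i => (g i)⁻¹) - 0)) :=
      ((h.isBigO_defect.trans_tendsto h.tendsto_errorScale).comp hφ).const_sub _
    have h1 := hX.mul hQ
    have h2 : ∀ t, (diagonal (fun i => (g i)⁻¹) - defect U g A δ (φ t)) *
        (δ (φ t) • (1 : Matrix (Fin q) (Fin q) ℝ) + (Uᵀ * A (φ t)) * (Uᵀ * A (φ t))ᵀ) = 1 :=
      fun t => by
        rw [defect, sub_sub_cancel]
        exact Matrix.nonsing_inv_mul _ ((Matrix.isUnit_iff_isUnit_det _).1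
          (posDef_smul_one_add (posSemidef_mul_transpose_self' _) (h.ridge_pos _)).isUnit)
    simp only [h2, sub_zero] at h1
    have h3 := tendsto_nhds_unique h1 tendsto_const_nhds
    have hGG : diagonal g * (diagonal fun i => (g i)⁻¹) = 1 := by
      rw [Matrix.diagonal_mul_diagonal, ← Matrix.diagonal_one]
      congr 1; ext i; exact mul_inv_cancel₀ (h.g_pos i).ne'
    have h4 : δ₀ • (1 : Matrix (Fin q) (Fin q) ℝ) + (Uᵀ * A') * (Uᵀ * A')ᵀ = diagonal g := by
      have := congrArg (fun M => diagonal g * M) h3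
      simpa only [← Matrix.mul_assoc, hGG, Matrix.one_mul, Matrix.mul_one] using this
    rw [eq_sub_of_add_eq' h4, ← Matrix.diagonal_one, ← Matrix.diagonal_smul, Matrix.diagonal_sub]
    congr 1; ext i; simp

theorem _root_.continuousAt_lossG (S : Matrix (Fin m) (Fin m) ℝ) (A : Matrix (Fin m) (Fin q) ℝ)
    {δ : ℝ} (hδ : 0 < δ) :
    ContinuousAt (fun x : Matrix (Fin m) (Fin q) ℝ × ℝ => lossG S x.1 x.2) (A, δ) := by
  have hC : Continuous fun x : Matrix (Fin m) (Fin q) ℝ × ℝ =>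
      x.1 * x.1ᵀ + x.2 • (1 : Matrix (Fin m) (Fin m) ℝ) := by fun_prop
  have hP := posDef_smul_one_add (posSemidef_mul_transpose_self' A) hδ
  rw [add_comm] at hP
  have hdet := hP.det_pos.ne'
  have hinv : ContinuousAt (fun x : Matrix (Fin m) (Fin q) ℝ × ℝ =>
      (x.1 * x.1ᵀ + x.2 • (1 : Matrix (Fin m) (Fin m) ℝ))⁻¹) (A, δ) := by
    refine ContinuousAt.comp (g := Inv.inv) ?_ hC.continuousAt
    refine continuousAt_matrix_inv _ ?_
    rw [Ring.inverse_eq_inv']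
    exact continuousAt_inv₀ hdet
  refine ContinuousAt.add (hC.matrix_det.continuousAt.log hdet) ?_
  exact (continuous_id.matrix_trace).continuousAt.comp (hinv.mul continuousAt_const)

/-- The loss converges by monotonicity, so its limit can be read off along one convergent
subsequence, whose limit is optimal. -/
theorem tendsto_lossG (h : AlignedEM S U g δ₀ ρ A δ Y) :
    Tendsto (fun t => lossG S (A t) (δ t)) atTop (𝓝 (optimalLoss m g δ₀)) := by
  obtain ⟨K, hK⟩ := h.exists_norm_le
  have : ProperSpace (Matrix (Fin m) (Fin q) ℝ) := FiniteDimensional.proper ℝ _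
  obtain ⟨A', -, φ, hφ, hA'⟩ := tendsto_subseq_of_bounded
    (Metric.isBounded_closedBall (x := (0 : Matrix (Fin m) (Fin q) ℝ)) (r := K)) (x := A)
    (fun t => by simpa using hK t)
  obtain ⟨h1, h2⟩ := h.eq_of_tendsto_comp hφ.tendsto_atTop hA'
  obtain ⟨G, hG⟩ := h.exists_tendsto_lossG
  have hp : Tendsto (fun t => (A (φ t), δ (φ t))) atTop (𝓝 (A', δ₀)) :=
    hA'.prodMk_nhds (h.tendsto_ridge.comp hφ.tendsto_atTop)
  have h3 := Tendsto.comp (continuousAt_lossG S A' h.opt_pos) hp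
  have h4 : lossG S A' δ₀ = G := tendsto_nhds_unique h3 (hG.comp hφ.tendsto_atTop)
  rw [h1, lossG_eq_optimalLoss h.psd h.orth h.eig h.g_pos h.opt_pos h.trace_eq h2] at h4
  rwa [h4]

theorem optimalLoss_le (h : AlignedEM S U g δ₀ ρ A δ Y) (t : ℕ) :
    optimalLoss m g δ₀ ≤ lossG S (A t) (δ t) :=
  h.lossG_antitone.le_of_tendsto h.tendsto_lossG t

theorem summable_stepSize (h : AlignedEM S U g δ₀ ρ A δ Y) : Summable (stepSize A δ) := by
  obtain ⟨K, hK0, hK⟩ := h.exists_stepSize_sq_le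
  exact summable_of_descent h.rate_pos h.rate_lt h.lossG_antitone (stepSize_nonneg A δ) hK0 hK
    h.optimalLoss_le h.lossG_sub_le

theorem exists_tendsto (h : AlignedEM S U g δ₀ ρ A δ Y) :
    ∃ A' : Matrix (Fin m) (Fin q) ℝ, Tendsto A atTop (𝓝 A') ∧ A' = U * (Uᵀ * A') ∧
      (Uᵀ * A') * (Uᵀ * A')ᵀ = diagonal fun i => g i - δ₀ := by
  have : CompleteSpace (Matrix (Fin m) (Fin q) ℝ) := FiniteDimensional.complete ℝ _
  have hc : CauchySeq A := cauchySeq_of_summable_dist <|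
    h.summable_stepSize.of_nonneg_of_le (fun _ => dist_nonneg) fun t => by
      rw [dist_comm, dist_eq_norm, stepSize]
      linarith [abs_nonneg (δ (t + 1) - δ t)]
  obtain ⟨A', hA'⟩ := cauchySeq_tendsto_of_complete hc
  exact ⟨A', hA', h.eq_of_tendsto_comp tendsto_id hA'⟩

end AlignedEM

end Convergence

/-! ### Ordered eigenvalues and principal matrices. -/

noncomputable section Spectral

open scoped Matrix.Norms.Frobenius

open Asymptotics

variable {m q : ℕ}

/-- A positive semidefinite matrix with ordered eigenvalues `γ` is diagonalized as `diagonal γ`. -/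
theorem IsOrderedEigenvalues.exists_eigenbasis {S : Matrix (Fin m) (Fin m) ℝ} {γ : Fin m → ℝ}
    (hγ : IsOrderedEigenvalues S γ) (hS : S.PosSemidef) :
    ∃ V : Matrix (Fin m) (Fin m) ℝ, Vᵀ * V = 1 ∧ V * Vᵀ = 1 ∧ S * V = V * diagonal γ := by
  have hD : (diagonal γ).IsHermitian := Matrix.isHermitian_diagonal γ
  -- Equal characteristic polynomials give equal sorted eigenvalues, so the eigenvector matrices $E$
  -- of $S$ and $F$ of `diagonal γ` combine to $EF^T$, whose columns follow the order of $\gamma$.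
  have hev : hS.isHermitian.eigenvalues = hD.eigenvalues := by
    rw [Matrix.IsHermitian.eigenvalues_eq_eigenvalues_iff, hγ.2, Matrix.charpoly_diagonal]
  have key : ∀ {T : Matrix (Fin m) (Fin m) ℝ} (hT : T.IsHermitian),
      ∃ E : Matrix (Fin m) (Fin m) ℝ, Eᵀ * E = 1 ∧ E * Eᵀ = 1 ∧
        T = E * diagonal hT.eigenvalues * Eᵀ := fun {T} hT => by
    refine ⟨hT.eigenvectorUnitary, ?_, ?_, ?_⟩
    · simpa [Matrix.star_eq_conjTranspose] using
        Unitary.coe_star_mul_self hT.eigenvectorUnitary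
    · simpa [Matrix.star_eq_conjTranspose] using
        Unitary.coe_mul_star_self hT.eigenvectorUnitary
    · have h := hT.spectral_theorem
      rw [Unitary.conjStarAlgAut_apply] at h
      simpa [Matrix.star_eq_conjTranspose, Function.comp_def] using h
  obtain ⟨E, hE1, hE2, hE⟩ := key hS.isHermitian
  obtain ⟨F, hF1, hF2, hF⟩ := key hD
  refine ⟨E * Fᵀ, ?_, ?_, ?_⟩
  · rw [Matrix.transpose_mul, Matrix.transpose_transpose, Matrix.mul_assoc, ← Matrix.mul_assoc Eᵀ,
      hE1, Matrix.one_mul, hF2]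
  · rw [Matrix.transpose_mul, Matrix.transpose_transpose, Matrix.mul_assoc, ← Matrix.mul_assoc Fᵀ,
      hF1, Matrix.one_mul, hE2]
  · have h1 : S * E = E * diagonal hD.eigenvalues := by
      conv_lhs => rw [hE]
      rw [Matrix.mul_assoc, hE1, Matrix.mul_one, hev]
    have h2 : Fᵀ * diagonal γ = diagonal hD.eigenvalues * Fᵀ := by
      conv_lhs => rw [hF]
      rw [← Matrix.mul_assoc, ← Matrix.mul_assoc, hF1, Matrix.one_mul]
    rw [← Matrix.mul_assoc, h1, Matrix.mul_assoc, Matrix.mul_assoc, h2]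

theorem trace_eq_sum_of_eigenbasis {S V : Matrix (Fin m) (Fin m) ℝ} {γ : Fin m → ℝ}
    (hV : Vᵀ * V = 1) (hV' : V * Vᵀ = 1) (hSV : S * V = V * diagonal γ) :
    S.trace = ∑ k, γ k := by
  have h : S = V * (diagonal γ * Vᵀ) := by
    rw [← Matrix.mul_assoc, ← hSV, Matrix.mul_assoc, hV', Matrix.mul_one]
  rw [h, Matrix.trace_mul_comm, Matrix.mul_assoc, hV, Matrix.mul_one, Matrix.trace_diagonal]

theorem sum_castLE_add_sum_filter (hqm : q < m) (f : Fin m → ℝ) :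
    ∑ i : Fin q, f (Fin.castLE hqm.le i)
      + ∑ j ∈ Finset.univ.filter (fun j : Fin m => q ≤ (j : ℕ)), f j = ∑ j, f j := by
  have h1 : ∑ i : Fin q, f (Fin.castLE hqm.le i) =
      ∑ j ∈ Finset.univ.filter (fun j : Fin m => ¬ q ≤ (j : ℕ)), f j := by
    refine Finset.sum_bij (fun i _ => Fin.castLE hqm.le i) (fun i _ => by simp)
      (fun i _ j _ h => Fin.castLE_injective _ h) (fun j hj => ?_) fun _ _ => rfl
    refine ⟨⟨j, by simpa using hj⟩, Finset.mem_univ _, rfl⟩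
  rw [h1, add_comm, Finset.sum_filter_add_sum_filter_not]

theorem card_filter_le (hqm : q < m) :
    ((Finset.univ.filter (fun j : Fin m => q ≤ (j : ℕ))).card : ℝ) = (m : ℝ) - q := by
  have h := sum_castLE_add_sum_filter hqm (fun _ => (1 : ℝ))
  simp only [Finset.sum_const, Finset.card_univ, Fintype.card_fin, nsmul_eq_mul, mul_one] at h
  linarith

theorem sub_mul_mlRidge (hqm : q < m) (γ : Fin m → ℝ) :
    ((m : ℝ) - q) * mlRidge q γ = ∑ j ∈ Finset.univ.filter (fun j : Fin m => q ≤ (j : ℕ)), γ j := by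
  have : (0 : ℝ) < (m : ℝ) - q := sub_pos.2 (by exact_mod_cast hqm)
  rw [mlRidge, ← mul_assoc, mul_one_div_cancel this.ne', one_mul]

/-- The spectral hypothesis of the convergence theorem: a positive semidefinite matrix with ordered
eigenvalues of which the `q`-th strictly exceeds some later positive one. -/
structure SpectralSetting (S : Matrix (Fin m) (Fin m) ℝ) (γ : Fin m → ℝ) (q : ℕ) : Prop where
  psd : S.PosSemidef
  eigenvalues : IsOrderedEigenvalues S γ
  lt : q < m
  gap : ∃ i j : Fin m, (i : ℕ) + 1 = q ∧ q ≤ (j : ℕ) ∧ 0 < γ j ∧ γ j < γ i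

namespace SpectralSetting

variable {S : Matrix (Fin m) (Fin m) ℝ} {γ : Fin m → ℝ}

theorem codim_pos (h : SpectralSetting S γ q) : (0 : ℝ) < (m : ℝ) - q :=
  sub_pos.2 (by exact_mod_cast h.lt)

theorem eigenvalue_nonneg (h : SpectralSetting S γ q) (k : Fin m) : 0 ≤ γ k := by
  obtain ⟨V, hV, -, hSV⟩ := h.eigenvalues.exists_eigenbasis h.psd
  have h1 : Vᵀ * S * V = diagonal γ := by
    rw [Matrix.mul_assoc, hSV, ← Matrix.mul_assoc, hV, Matrix.one_mul]
  have h2 := (h.psd.conj' V).diag_nonneg (i := k)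
  rwa [h1, Matrix.diagonal_apply_eq] at h2

theorem trace_sub (h : SpectralSetting S γ q) :
    S.trace - ∑ i : Fin q, γ (Fin.castLE h.lt.le i) = ((m : ℝ) - q) * mlRidge q γ := by
  obtain ⟨V, hV, hV', hSV⟩ := h.eigenvalues.exists_eigenbasis h.psd
  rw [trace_eq_sum_of_eigenbasis hV hV' hSV, sub_mul_mlRidge h.lt,
    ← sum_castLE_add_sum_filter h.lt γ]
  ring

theorem mlRidge_pos (h : SpectralSetting S γ q) : 0 < mlRidge q γ := by
  obtain ⟨i, j, hi, hj, hj0, hij⟩ := h.gap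
  have h1 : 0 < ((m : ℝ) - q) * mlRidge q γ := by
    rw [sub_mul_mlRidge h.lt]
    exact Finset.sum_pos' (fun k _ => h.eigenvalue_nonneg k) ⟨j, by simpa using hj, hj0⟩
  exact pos_of_mul_pos_right h1 h.codim_pos.le

/-- The mean of the trailing eigenvalues lies strictly below the last leading one, at zero-based
index $q-1$, because one trailing eigenvalue does and none exceeds it. -/
theorem mlRidge_lt (h : SpectralSetting S γ q) (i : Fin q) :
    mlRidge q γ < γ (Fin.castLE h.lt.le i) := by
  obtain ⟨k, j, hk, hj, hj0, hkj⟩ := h.gap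
  have hki : γ k ≤ γ (Fin.castLE h.lt.le i) := h.eigenvalues.1 (by
    rw [Fin.le_def]; simp only [Fin.val_castLE]; omega)
  refine lt_of_lt_of_le ?_ hki
  have h1 : ((m : ℝ) - q) * mlRidge q γ < ((m : ℝ) - q) * γ k := by
    rw [sub_mul_mlRidge h.lt, ← card_filter_le h.lt, ← nsmul_eq_mul, ← Finset.sum_const]
    refine Finset.sum_lt_sum (fun l hl => h.eigenvalues.1 ?_) ⟨j, by simpa using hj, hkj⟩
    have : q ≤ (l : ℕ) := by simpa using hl
    rw [Fin.le_def]; omega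
  exact lt_of_mul_lt_mul_left h1 h.codim_pos.le

theorem leading_pos (h : SpectralSetting S γ q) (i : Fin q) : 0 < γ (Fin.castLE h.lt.le i) :=
  h.mlRidge_pos.trans (h.mlRidge_lt i)

theorem exists_isPrincipal (h : SpectralSetting S γ q) :
    ∃ U : Matrix (Fin m) (Fin q) ℝ, IsPrincipal S γ h.lt U := by
  obtain ⟨V, hV, -, hSV⟩ := h.eigenvalues.exists_eigenbasis h.psd
  refine ⟨V.submatrix id (Fin.castLE h.lt.le), ?_, ?_⟩
  · ext i j
    have := congrFun (congrFun hV (Fin.castLE h.lt.le i)) (Fin.castLE h.lt.le j)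
    simp only [Matrix.mul_apply, Matrix.transpose_apply, Matrix.submatrix_apply, id,
      Matrix.one_apply] at this ⊢
    rw [this]
    simp [Fin.ext_iff]
  · ext k j
    have := congrFun (congrFun hSV k) (Fin.castLE h.lt.le j)
    rw [Matrix.mul_diagonal] at this ⊢
    simpa [Matrix.mul_apply] using this

end SpectralSetting

theorem isCompact_isPrincipal (S : Matrix (Fin m) (Fin m) ℝ) (γ : Fin m → ℝ) (hqm : q < m) :
    IsCompact {U : Matrix (Fin m) (Fin q) ℝ | IsPrincipal S γ hqm U} := by
  have : ProperSpace (Matrix (Fin m) (Fin q) ℝ) := FiniteDimensional.proper ℝ _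
  refine Metric.isCompact_of_isClosed_isBounded ?_ ?_
  · refine IsClosed.inter (isClosed_eq ?_ ?_) (isClosed_eq ?_ ?_) <;> fun_prop
  · refine (Metric.isBounded_closedBall (x := (0 : Matrix (Fin m) (Fin q) ℝ)) (r := √q)).subset ?_
    intro U hU
    rw [mem_closedBall_zero_iff]
    refine Real.le_sqrt_of_sq_le ?_
    rw [frobenius_sq_eq_trace', hU.1]
    simp

/-- Tilting one column of a principal matrix towards an orthogonal eigenvector for the same
eigenvalue. -/
theorem IsPrincipal.tilt {S : Matrix (Fin m) (Fin m) ℝ} {γ : Fin m → ℝ} {hqm : q < m}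
    {U : Matrix (Fin m) (Fin q) ℝ} (hU : IsPrincipal S γ hqm U) {w : Fin m → ℝ} {i : Fin q}
    (hw : S *ᵥ w = γ (Fin.castLE hqm.le i) • w) (hUw : Uᵀ *ᵥ w = 0) :
    IsPrincipal S γ hqm ((U + vecMulVec w (Pi.single i 1))
      * diagonal (Function.update 1 i (√(1 + w ⬝ᵥ w))⁻¹)) := by
  have hn : 0 ≤ w ⬝ᵥ w := Finset.sum_nonneg fun k _ => mul_self_nonneg (w k)
  set c := (√(1 + w ⬝ᵥ w))⁻¹
  constructor
  · have h1 : (U + vecMulVec w (Pi.single i 1))ᵀ * (U + vecMulVec w (Pi.single i 1)) =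
        diagonal (Function.update 1 i (1 + w ⬝ᵥ w)) := by
      have e1 : Uᵀ * vecMulVec w (Pi.single i 1) = 0 := by
        rw [Matrix.mul_vecMulVec, hUw, Matrix.zero_vecMulVec]
      have e2 : vecMulVec (Pi.single i 1) w * U = 0 := by
        have := congrArg Matrix.transpose e1
        simpa [Matrix.transpose_vecMulVec] using this
      rw [Matrix.transpose_add, Matrix.transpose_vecMulVec, Matrix.add_mul, Matrix.mul_add,
        Matrix.mul_add, hU.1, e1, e2, Matrix.vecMulVec_mul_vecMulVec]
      ext k l
      by_cases hk : k = i <;> by_cases hl : l = i <;>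
        simp [Matrix.vecMulVec_apply, Matrix.diagonal_apply, Matrix.one_apply, hk, hl]
      rw [if_neg (Ne.symm hl), if_neg (Ne.symm hl)]
    rw [Matrix.transpose_mul, Matrix.diagonal_transpose, Matrix.mul_assoc,
      ← Matrix.mul_assoc (_)ᵀ, h1, Matrix.diagonal_mul_diagonal, Matrix.diagonal_mul_diagonal,
      ← Matrix.diagonal_one]
    congr 1
    ext k
    by_cases hk : k = i
    · subst hk
      simp only [Function.update_self]
      have : √(1 + w ⬝ᵥ w) * √(1 + w ⬝ᵥ w) = 1 + w ⬝ᵥ w := Real.mul_self_sqrt (by linarith)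
      rw [← this]
      simp only [c]
      field_simp
    · simp [Function.update_of_ne hk]
  · have h1 : S * (U + vecMulVec w (Pi.single i 1)) = (U + vecMulVec w (Pi.single i 1))
        * diagonal (fun i => γ (Fin.castLE hqm.le i)) := by
      rw [Matrix.mul_add, Matrix.add_mul, hU.2, Matrix.mul_vecMulVec, hw]
      congr 1
      ext k l
      rw [Matrix.mul_diagonal]
      by_cases hl : l = i <;> simp [Matrix.vecMulVec_apply, hl, mul_comm]
    rw [← Matrix.mul_assoc, h1, Matrix.mul_assoc, Matrix.mul_assoc, Matrix.diagonal_mul_diagonal,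
      Matrix.diagonal_mul_diagonal]
    congr 2
    ext k; exact mul_comm _ _

end Spectral

/-! ### Choice of the principal subspace selected by the initial matrix. -/

noncomputable section SpectralDecay

open scoped Matrix.Norms.Frobenius

open Asymptotics

variable {m q : ℕ} {S : Matrix (Fin m) (Fin m) ℝ} {γ : Fin m → ℝ}

/-- As $w$ is orthogonal to $U$, tilting changes $U^TA_0$ by a rank-one factor, to which the matrix
determinant lemma applies. -/
theorem det_tilt {U A₀ Y₀ : Matrix (Fin m) (Fin q) ℝ} (hA₀ : A₀ = (U + Y₀) * (Uᵀ * A₀))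
    {w : Fin m → ℝ} (hUw : Uᵀ *ᵥ w = 0) (i : Fin q) (c : ℝ) :
    (((U + vecMulVec w (Pi.single i 1)) * diagonal (Function.update 1 i c))ᵀ * A₀).det =
      c * (1 + (w ᵥ* Y₀) i) * (Uᵀ * A₀).det := by
  have h1 : (U + vecMulVec w (Pi.single i 1))ᵀ * A₀ =
      (1 + vecMulVec (Pi.single i 1) (w ᵥ* Y₀)) * (Uᵀ * A₀) := by
    have e1 : w ᵥ* U = 0 := by rwa [← Matrix.mulVec_transpose]
    have e2 : w ᵥ* A₀ = (w ᵥ* Y₀) ᵥ* (Uᵀ * A₀) := by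
      conv_lhs => rw [hA₀]
      rw [← Matrix.vecMul_vecMul, Matrix.vecMul_add, e1, zero_add]
    rw [Matrix.transpose_add, Matrix.transpose_vecMulVec, Matrix.add_mul, Matrix.add_mul,
      Matrix.one_mul, Matrix.vecMulVec_mul, Matrix.vecMulVec_mul, e2]
  rw [Matrix.transpose_mul, Matrix.diagonal_transpose, Matrix.mul_assoc, h1, Matrix.det_mul,
    Matrix.det_mul, Matrix.det_diagonal, Matrix.vecMulVec_eq Unit,
    Matrix.det_one_add_replicateCol_mul_replicateRow, Finset.prod_update_of_mem (Finset.mem_univ i)]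
  simp [mul_assoc]

/-- The nondegenerate principal matrix maximizing `|det (Uᵀ A₀)|` makes the residual of `A₀`
orthogonal to the competing eigenvectors. -/
theorem residual_orthogonal {hqm : q < m} {U A₀ Y₀ : Matrix (Fin m) (Fin q) ℝ}
    (hU : IsPrincipal S γ hqm U) (hdet : (Uᵀ * A₀).det ≠ 0)
    (hmax : ∀ U', IsPrincipal S γ hqm U' → (U'ᵀ * A₀).det ^ 2 ≤ (Uᵀ * A₀).det ^ 2)
    (hA₀ : A₀ = (U + Y₀) * (Uᵀ * A₀)) {w : Fin m → ℝ} {i : Fin q}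
    (hw : S *ᵥ w = γ (Fin.castLE hqm.le i) • w) (hUw : Uᵀ *ᵥ w = 0) : (w ᵥ* Y₀) i = 0 := by
  set a := (w ᵥ* Y₀) i with ha
  set n := w ⬝ᵥ w with hn
  have hn0 : 0 ≤ n := Finset.sum_nonneg fun k _ => mul_self_nonneg (w k)
  -- Maximality against the tilt by $sw$, with its normalization $1/(1+s^2n)$ of the squared
  -- determinant. The term $2sa$ is of first order in $s$, so $a=0$; the choice $s=a/(n+1)$ below
  -- makes this explicit.
  have key : ∀ s : ℝ, (1 + s * a) ^ 2 ≤ 1 + s ^ 2 * n := fun s => by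
    have hw' : S *ᵥ (s • w) = γ (Fin.castLE hqm.le i) • (s • w) := by
      rw [Matrix.mulVec_smul, hw, smul_comm]
    have hUw' : Uᵀ *ᵥ (s • w) = 0 := by rw [Matrix.mulVec_smul, hUw, smul_zero]
    have h1 := hmax _ (hU.tilt hw' hUw')
    have e1 : (s • w) ⬝ᵥ (s • w) = s ^ 2 * n := by
      rw [smul_dotProduct, dotProduct_smul, smul_eq_mul, smul_eq_mul, ← mul_assoc, pow_two]
    have e2 : ((s • w) ᵥ* Y₀) i = s * a := by rw [Matrix.smul_vecMul]; rfl
    have hpos : 0 < 1 + s ^ 2 * n := by positivity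
    rw [det_tilt hA₀ hUw', e1, e2, mul_pow, mul_pow, inv_pow, Real.sq_sqrt hpos.le] at h1
    have h2 := le_of_mul_le_mul_right (h1.trans_eq (one_mul _).symm) (by positivity)
    rwa [inv_mul_le_iff₀ hpos, mul_one] at h2
  have h1 := key (a / (n + 1))
  have h2 : (1 + a / (n + 1) * a) ^ 2 - (1 + (a / (n + 1)) ^ 2 * n) =
      (a ^ 2 * (n + 2) + a ^ 4) / (n + 1) ^ 2 := by
    field_simp
    ring
  have h3 : a ^ 2 * (n + 2) + a ^ 4 ≤ 0 := by
    have : (a ^ 2 * (n + 2) + a ^ 4) / (n + 1) ^ 2 ≤ 0 := by linarith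
    by_contra hc
    exact absurd this (not_le.2 (div_pos (not_le.1 hc) (by positivity)))
  have h4 : a ^ 2 ≤ 0 := by nlinarith [sq_nonneg a, sq_nonneg (a ^ 2), mul_nonneg (sq_nonneg a) hn0]
  exact pow_eq_zero_iff two_ne_zero |>.1 (le_antisymm h4 (sq_nonneg a))

/-- Eigenvectors for eigenvalues above some leading one lie in every principal subspace. -/
theorem IsPrincipal.mulVec_eq {hqm : q < m} {U : Matrix (Fin m) (Fin q) ℝ}
    (hγ : Antitone γ) (hS : S.PosSemidef)
    (hU : IsPrincipal S γ hqm U) {V : Matrix (Fin m) (Fin m) ℝ} (hV : Vᵀ * V = 1)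
    (hV' : V * Vᵀ = 1) (hSV : S * V = V * diagonal γ) {k : Fin m} {i : Fin q}
    (hk : γ (Fin.castLE hqm.le i) < γ k) : (1 - U * Uᵀ) *ᵥ V.col k = 0 := by
  set g : Fin q → ℝ := fun j => γ (Fin.castLE hqm.le j) with hg
  set c := g i with hc
  set B := Vᵀ * U with hB
  have hBB : Bᵀ * B = 1 := by
    rw [hB, Matrix.transpose_mul, Matrix.transpose_transpose, Matrix.mul_assoc,
      ← Matrix.mul_assoc V, hV', Matrix.one_mul, hU.1]
  have hVS : Vᵀ * S = diagonal γ * Vᵀ := by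
    simpa [hS.transpose_eq] using congrArg Matrix.transpose hSV
  have hBe : diagonal γ * B = B * diagonal g := by
    rw [hB, ← Matrix.mul_assoc, ← hVS, Matrix.mul_assoc, hU.2, Matrix.mul_assoc]
  have hB0 : ∀ k j, B k j ≠ 0 → γ k = g j := fun k j h => by
    have := congrFun (congrFun hBe k) j
    rw [Matrix.diagonal_mul, Matrix.mul_diagonal, mul_comm] at this
    exact mul_left_cancel₀ h this
  set w : Fin m → Fin m → ℝ := fun k => (1 - U * Uᵀ) *ᵥ V.col k with hw
  have hwn : ∀ k, w k ⬝ᵥ w k = 1 - ∑ j, B k j ^ 2 := fun k => by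
    have hP : (1 - U * Uᵀ)ᵀ * (1 - U * Uᵀ) = 1 - U * Uᵀ := by
      have : U * Uᵀ * (U * Uᵀ) = U * Uᵀ := by
        rw [Matrix.mul_assoc, ← Matrix.mul_assoc Uᵀ, hU.1, Matrix.one_mul]
      simp only [Matrix.transpose_sub, Matrix.transpose_mul, Matrix.transpose_transpose,
        Matrix.transpose_one, Matrix.sub_mul, Matrix.mul_sub, this, Matrix.one_mul, Matrix.mul_one]
      abel
    have e1 : w k ⬝ᵥ w k = (Vᵀ * ((1 - U * Uᵀ)ᵀ * (1 - U * Uᵀ)) * V : Matrix (Fin m) (Fin m) ℝ) k k := by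
      have : Vᵀ * ((1 - U * Uᵀ)ᵀ * (1 - U * Uᵀ)) * V =
          ((1 - U * Uᵀ) * V)ᵀ * ((1 - U * Uᵀ) * V) := by
        simp only [Matrix.transpose_mul, Matrix.mul_assoc]
      rw [this]
      rfl
    have e2 : Vᵀ * (1 - U * Uᵀ) * V = 1 - B * Bᵀ := by
      rw [Matrix.mul_sub, Matrix.sub_mul, Matrix.mul_one, hV, hB]
      simp [Matrix.mul_assoc]
    rw [e1, hP, e2, Matrix.sub_apply, Matrix.one_apply_eq, Matrix.mul_apply]
    simp [pow_two]
  have hle : ∀ k, ∑ j, B k j ^ 2 ≤ 1 := fun k => by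
    have : 0 ≤ w k ⬝ᵥ w k := Finset.sum_nonneg fun l _ => mul_self_nonneg _
    rw [hwn] at this; linarith
  -- Count the eigenvalues above $c$. A nonzero $B_{kj}$ forces $\gamma_k=g_j$, so the left side
  -- sums the unit column norms of $B$ with $g_j>c$, and every $k$ with $\gamma_k>c$ is a leading
  -- index. As rows of $B$ have norm at most one, equality of the sums forces each such row to have
  -- norm one.
  have hsum : ∑ k, (if c < γ k then ∑ j, B k j ^ 2 else 0) = ∑ k, (if c < γ k then (1 : ℝ) else 0) := by
    have e1 : ∑ k, (if c < γ k then ∑ j, B k j ^ 2 else 0) = ∑ j, if c < g j then (1 : ℝ) else 0 := by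
      have f1 : ∀ k, (if c < γ k then ∑ j, B k j ^ 2 else 0) =
          ∑ j, if c < g j then B k j ^ 2 else 0 := fun k => by
        have f2 : ∀ j, (if c < g j then B k j ^ 2 else 0) = if c < γ k then B k j ^ 2 else 0 :=
          fun j => by
            by_cases h0 : B k j = 0
            · simp [h0]
            · rw [hB0 k j h0]
        simp only [f2]
        split_ifs <;> simp
      simp only [f1]
      rw [Finset.sum_comm]
      refine Finset.sum_congr rfl fun j _ => ?_
      by_cases h : c < g j
      · simp only [h, if_true]
        have := congrFun (congrFun hBB j) j
        rw [Matrix.mul_apply, Matrix.one_apply_eq] at this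
        simpa [pow_two] using this
      · simp [h]
    rw [e1, ← sum_castLE_add_sum_filter hqm fun k => if c < γ k then (1 : ℝ) else 0, left_eq_add]
    refine Finset.sum_eq_zero fun l hl => if_neg (not_lt.2 (hγ ?_))
    have : q ≤ (l : ℕ) := by simpa using hl
    rw [Fin.le_def]; simp only [Fin.val_castLE]; omega
  have h1 := (Finset.sum_eq_sum_iff_of_le (fun k _ => by
    split_ifs with h
    · exact hle k
    · exact le_rfl)).1 hsum k (Finset.mem_univ k)
  rw [if_pos hk, if_pos hk] at h1
  have h2 := hwn k
  rw [h1, sub_self] at h2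
  exact dotProduct_self_eq_zero.1 h2

/-- In an eigenbasis, the residual for the maximizing principal matrix has no entries which fail
to decay. -/
theorem SpectralSetting.residual_apply_eq_zero (h : SpectralSetting S γ q)
    {U A₀ Y₀ : Matrix (Fin m) (Fin q) ℝ} (hU : IsPrincipal S γ h.lt U) (hdet : (Uᵀ * A₀).det ≠ 0)
    (hmax : ∀ U', IsPrincipal S γ h.lt U' → (U'ᵀ * A₀).det ^ 2 ≤ (Uᵀ * A₀).det ^ 2)
    (hA₀ : A₀ = (U + Y₀) * (Uᵀ * A₀)) (hY₀ : Uᵀ * Y₀ = 0) {V : Matrix (Fin m) (Fin m) ℝ}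
    (hV : Vᵀ * V = 1) (hV' : V * Vᵀ = 1) (hSV : S * V = V * diagonal γ) {k : Fin m} {i : Fin q}
    (hk : γ (Fin.castLE h.lt.le i) ≤ γ k) : (Vᵀ * Y₀) k i = 0 := by
  set w : Fin m → ℝ := (1 - U * Uᵀ) *ᵥ V.col k with hw
  have hwY : (Vᵀ * Y₀) k i = (w ᵥ* Y₀) i := by
    have e1 : w ᵥ* Y₀ = V.col k ᵥ* Y₀ := by
      have hPt : (1 - U * Uᵀ)ᵀ = 1 - U * Uᵀ := by simp
      rw [hw, ← Matrix.vecMul_transpose, hPt, Matrix.vecMul_vecMul, Matrix.sub_mul, Matrix.one_mul,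
        Matrix.mul_assoc, hY₀, Matrix.mul_zero, sub_zero]
    rw [e1]
    rfl
  rw [hwY]
  rcases hk.lt_or_eq with hlt | heq
  · rw [hw, hU.mulVec_eq h.eigenvalues.1 h.psd hV hV' hSV hlt, Matrix.zero_vecMul]
    rfl
  · have hSv : S *ᵥ V.col k = γ k • V.col k := by
      ext l
      have := congrFun (congrFun hSV l) k
      rw [Matrix.mul_diagonal, mul_comm] at this
      exact this
    refine residual_orthogonal hU hdet hmax hA₀ ?_ ?_
    · have e1 : S * (1 - U * Uᵀ) = (1 - U * Uᵀ) * S := by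
        rw [Matrix.mul_sub, Matrix.sub_mul, Matrix.mul_one, Matrix.one_mul, ← Matrix.mul_assoc,
          hU.2, Matrix.mul_assoc U, Matrix.mul_assoc U, transpose_mul_eq_diagonal_mul h.psd hU.2]
      rw [heq, hw, Matrix.mulVec_mulVec, e1, ← Matrix.mulVec_mulVec, hSv, Matrix.mulVec_smul]
    · rw [hw, Matrix.mulVec_mulVec, Matrix.mul_sub, Matrix.mul_one, ← Matrix.mul_assoc, hU.1,
        Matrix.one_mul, sub_self, Matrix.zero_mulVec]

end SpectralDecay

/-! ### Convergence, global minimality and the centering constraint. -/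

noncomputable section MaximumLikelihood

open scoped Matrix.Norms.Frobenius

open Asymptotics

variable {m q : ℕ} {S : Matrix (Fin m) (Fin m) ℝ} {γ : Fin m → ℝ}

namespace SpectralSetting

theorem trace_pos (h : SpectralSetting S γ q) : 0 < S.trace := by
  have h1 : 0 ≤ ∑ i : Fin q, γ (Fin.castLE h.lt.le i) :=
    Finset.sum_nonneg fun i _ => (h.leading_pos i).le
  have h2 := mul_pos h.codim_pos h.mlRidge_pos
  have h3 := h.trace_sub
  linarith

theorem isUnit_diagonal_leading (h : SpectralSetting S γ q) :
    IsUnit (diagonal fun i : Fin q => γ (Fin.castLE h.lt.le i)).det := by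
  rw [Matrix.det_diagonal]
  exact isUnit_iff_ne_zero.2 (Finset.prod_ne_zero_iff.2 fun i _ => (h.leading_pos i).ne')

variable {A : ℕ → Matrix (Fin m) (Fin q) ℝ} {δ : ℕ → ℝ}

theorem isUnit_det_succ_iff (h : SpectralSetting S γ q) (hEM : IsEMSequence S A δ) (hδ : 0 < δ 0)
    {U : Matrix (Fin m) (Fin q) ℝ} (hU : IsPrincipal S γ h.lt U) (t : ℕ) :
    IsUnit (Uᵀ * A (t + 1)).det ↔ IsUnit (Uᵀ * A t).det := by
  have hδt := hEM.ridge_pos h.psd h.trace_pos hδ t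
  have h1 := congrArg Matrix.det (transpose_mul_emStep h.psd hU.2 hδt (hEM.step_A t))
  rw [Matrix.det_mul, Matrix.det_mul] at h1
  have h2 := emGain_isUnit_det h.psd (A t) hδt
  rw [← h2.mul_right_iff, h1, h.isUnit_diagonal_leading.mul_left_iff]

theorem isUnit_det_iff (h : SpectralSetting S γ q) (hEM : IsEMSequence S A δ) (hδ : 0 < δ 0)
    {U : Matrix (Fin m) (Fin q) ℝ} (hU : IsPrincipal S γ h.lt U) (t : ℕ) :
    IsUnit (Uᵀ * A t).det ↔ IsUnit (Uᵀ * A 0).det := by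
  induction t with
  | zero => exact Iff.rfl
  | succ t ih => rw [h.isUnit_det_succ_iff hEM hδ hU, ih]

/-- A nondegenerate principal matrix can be chosen to maximize `|det (Uᵀ A₀)|`. -/
theorem exists_maximal (h : SpectralSetting S γ q) {A₀ : Matrix (Fin m) (Fin q) ℝ}
    (hA₀ : ∃ U : Matrix (Fin m) (Fin q) ℝ, IsPrincipal S γ h.lt U ∧ IsUnit (Uᵀ * A₀)) :
    ∃ U : Matrix (Fin m) (Fin q) ℝ, IsPrincipal S γ h.lt U ∧ IsUnit (Uᵀ * A₀).det ∧
      ∀ U', IsPrincipal S γ h.lt U' → (U'ᵀ * A₀).det ^ 2 ≤ (Uᵀ * A₀).det ^ 2 := by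
  obtain ⟨U₁, hU₁, hu⟩ := hA₀
  have hc : Continuous fun U : Matrix (Fin m) (Fin q) ℝ => (Uᵀ * A₀).det ^ 2 := by fun_prop
  obtain ⟨U, hU, hmax⟩ := (isCompact_isPrincipal S γ h.lt).exists_isMaxOn ⟨U₁, hU₁⟩ hc.continuousOn
  refine ⟨U, hU, ?_, fun U' hU' => hmax hU'⟩
  have h1 : (U₁ᵀ * A₀).det ^ 2 ≤ (Uᵀ * A₀).det ^ 2 := hmax hU₁
  have h2 := ((Matrix.isUnit_iff_isUnit_det _).1 hu).ne_zero
  refine isUnit_iff_ne_zero.2 fun h0 => ?_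
  rw [h0] at h1
  have : 0 < (U₁ᵀ * A₀).det ^ 2 := by positivity
  linarith

theorem exists_rate (h : SpectralSetting S γ q) : ∃ ρ : ℝ, 0 < ρ ∧ ρ < 1 ∧
    ∀ (k : Fin m) (i : Fin q), γ k < γ (Fin.castLE h.lt.le i) →
      γ k / γ (Fin.castLE h.lt.le i) ≤ ρ := by
  have h1 : ∀ᶠ ρ : ℝ in 𝓝[<] 1, ∀ (k : Fin m) (i : Fin q), γ k < γ (Fin.castLE h.lt.le i) →
      γ k / γ (Fin.castLE h.lt.le i) ≤ ρ := by
    refine eventually_all.2 fun k => eventually_all.2 fun i => ?_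
    by_cases hki : γ k < γ (Fin.castLE h.lt.le i)
    · have h2 : γ k / γ (Fin.castLE h.lt.le i) < 1 := (div_lt_one (h.leading_pos i)).2 hki
      filter_upwards [Ioo_mem_nhdsLT h2] with ρ hρ _ using hρ.1.le
    · exact Eventually.of_forall fun ρ hρ => absurd hρ hki
  obtain ⟨ρ, hρ, hρ01⟩ := (h1.and (Ioo_mem_nhdsLT (zero_lt_one (α := ℝ)))).exists
  exact ⟨ρ, hρ01.1, hρ01.2, hρ⟩

/-- EM sequences with nondegenerate initial matrix approach a principal subspace at a geometric
rate. -/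
theorem exists_alignedEM (h : SpectralSetting S γ q) (hEM : IsEMSequence S A δ) (hδ : 0 < δ 0)
    (hA₀ : ∃ U : Matrix (Fin m) (Fin q) ℝ, IsPrincipal S γ h.lt U ∧ IsUnit (Uᵀ * A 0)) :
    ∃ (U : Matrix (Fin m) (Fin q) ℝ) (ρ : ℝ) (Y : ℕ → Matrix (Fin m) (Fin q) ℝ),
      IsPrincipal S γ h.lt U ∧
      AlignedEM S U (fun i => γ (Fin.castLE h.lt.le i)) (mlRidge q γ) ρ A δ Y := by
  obtain ⟨U, hU, hdet, hmax⟩ := h.exists_maximal hA₀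
  obtain ⟨ρ, hρ0, hρ1, hρ⟩ := h.exists_rate
  obtain ⟨V, hV, hV', hSV⟩ := h.eigenvalues.exists_eigenbasis h.psd
  have hunit : ∀ t, IsUnit (Uᵀ * A t).det := fun t => (h.isUnit_det_iff hEM hδ hU t).2 hdet
  set Y : ℕ → Matrix (Fin m) (Fin q) ℝ := fun t => A t * (Uᵀ * A t)⁻¹ - U with hY
  have hgraph : ∀ t, A t = (U + Y t) * (Uᵀ * A t) := fun t => by
    rw [hY, add_sub_cancel, Matrix.nonsing_inv_mul_cancel_right _ _ (hunit t)]
  have hcompl : ∀ t, Uᵀ * Y t = 0 := fun t => by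
    rw [hY, Matrix.mul_sub, hU.1, ← Matrix.mul_assoc, Matrix.mul_nonsing_inv _ (hunit t), sub_self]
  have hGG : (diagonal fun i : Fin q => γ (Fin.castLE h.lt.le i)) *
      (diagonal fun i : Fin q => (γ (Fin.castLE h.lt.le i))⁻¹) = 1 := by
    rw [Matrix.diagonal_mul_diagonal, ← Matrix.diagonal_one]
    congr 1; ext i; exact mul_inv_cancel₀ (h.leading_pos i).ne'
  -- In $A_{t+1}(U^TA_{t+1})^{-1}$ the gain cancels, so the graph coordinate evolves linearly,
  -- independently of $\delta_t$.
  have hstep : ∀ t, Y (t + 1) =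
      S * Y t * diagonal fun i : Fin q => (γ (Fin.castLE h.lt.le i))⁻¹ := fun t => by
    have hδt := hEM.ridge_pos h.psd h.trace_pos hδ t
    have e1 := transpose_mul_emStep h.psd hU.2 hδt (hEM.step_A t)
    have hK := emGain_isUnit_det h.psd (A t) hδt
    have e2 : (Uᵀ * A (t + 1))⁻¹ = emGain S (A t) (δ t) * ((Uᵀ * A t)⁻¹ *
        diagonal fun i : Fin q => (γ (Fin.castLE h.lt.le i))⁻¹) := by
      refine Matrix.inv_eq_right_inv ?_
      rw [← Matrix.mul_assoc, e1, ← Matrix.mul_assoc,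
        Matrix.mul_nonsing_inv_cancel_right _ _ (hunit t), hGG]
    have e3 : A (t + 1) * emGain S (A t) (δ t) = S * A t := by
      rw [hEM.step_A t, Matrix.nonsing_inv_mul_cancel_right _ _ hK]
    have e4 : U = S * U * diagonal fun i : Fin q => (γ (Fin.castLE h.lt.le i))⁻¹ := by
      rw [hU.2, Matrix.mul_assoc, hGG, Matrix.mul_one]
    simp only [hY]
    rw [e2, ← Matrix.mul_assoc, e3, Matrix.mul_sub, Matrix.sub_mul, ← e4]
    simp only [Matrix.mul_assoc]
  have hVS : Vᵀ * S = diagonal γ * Vᵀ := by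
    simpa [h.psd.transpose_eq] using congrArg Matrix.transpose hSV
  have hentry : ∀ t k i, (Vᵀ * Y t) k i =
      (γ k / γ (Fin.castLE h.lt.le i)) ^ t * (Vᵀ * Y 0) k i := fun t => by
    induction t with
    | zero => intro k i; simp
    | succ t ih =>
      intro k i
      have e : Vᵀ * Y (t + 1) = diagonal γ * (Vᵀ * Y t) *
          diagonal fun i : Fin q => (γ (Fin.castLE h.lt.le i))⁻¹ := by
        rw [hstep, ← Matrix.mul_assoc, ← Matrix.mul_assoc, hVS, Matrix.mul_assoc (diagonal γ)]
      rw [e, Matrix.mul_diagonal, Matrix.diagonal_mul, ih]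
      ring
  have hVY : (fun t => Vᵀ * Y t) =O[atTop] fun t => ρ ^ t := by
    refine isBigO_matrix_of_apply fun k i => ?_
    rw [funext fun t => hentry t k i]
    -- An entry whose ratio is at least one does not decay; it vanishes initially by the maximal
    -- choice of $U$.
    rcases lt_or_ge (γ k) (γ (Fin.castLE h.lt.le i)) with hlt | hge
    · refine IsBigO.of_bound |(Vᵀ * Y 0) k i| (Eventually.of_forall fun t => ?_)
      have e0 : 0 ≤ γ k / γ (Fin.castLE h.lt.le i) :=
        div_nonneg (h.eigenvalue_nonneg k) (h.leading_pos i).le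
      rw [norm_mul, norm_pow, norm_pow, Real.norm_of_nonneg e0, Real.norm_of_nonneg hρ0.le,
        Real.norm_eq_abs, mul_comm]
      exact mul_le_mul_of_nonneg_left (pow_le_pow_left₀ e0 (hρ k i hlt) t) (abs_nonneg _)
    · rw [h.residual_apply_eq_zero hU hdet.ne_zero hmax (hgraph 0) (hcompl 0) hV hV' hSV hge]
      simpa using isBigO_zero _ _
  have hdecay : Y =O[atTop] fun t => ρ ^ t := by
    have := (AlignedEM.isBigO_const_one V).bounded_matrix_mul hVY
    simpa only [← Matrix.mul_assoc, hV', Matrix.one_mul] using this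
  exact ⟨U, ρ, Y, hU, ⟨h.psd, h.lt, hU.1, hU.2, h.mlRidge_pos, h.mlRidge_lt, h.trace_sub, hEM, hδ,
    hcompl, hgraph, hunit, hρ0, hρ1, hdecay⟩⟩

theorem lossG_eq_of_isMLSolution (h : SpectralSetting S γ q) {A' : Matrix (Fin m) (Fin q) ℝ}
    {δ' : ℝ} (hA' : IsMLSolution S γ h.lt A' δ') :
    lossG S A' δ' =
      optimalLoss m (fun i : Fin q => γ (Fin.castLE h.lt.le i)) (mlRidge q γ) := by
  obtain ⟨rfl, U, V, hU, hV, rfl⟩ := hA'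
  rw [Matrix.mul_assoc]
  refine lossG_eq_optimalLoss h.psd hU.1 hU.2 h.leading_pos h.mlRidge_pos h.trace_sub ?_
  rw [Matrix.transpose_mul, Matrix.diagonal_transpose, Matrix.mul_assoc, ← Matrix.mul_assoc V,
    (Matrix.mem_orthogonalGroup_iff _ _).1 hV, Matrix.one_mul, Matrix.diagonal_mul_diagonal]
  congr 1
  ext i
  exact Real.mul_self_sqrt (sub_pos.2 (h.mlRidge_lt i)).le

/-- The determinant is the characteristic polynomial of $-M$ at $s$, which has finitely many roots.
-/
theorem eventually_det_add_smul_ne_zero (M : Matrix (Fin q) (Fin q) ℝ) :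
    ∀ᶠ s : ℝ in 𝓝[≠] 0, (M + s • (1 : Matrix (Fin q) (Fin q) ℝ)).det ≠ 0 := by
  have h1 : ∀ s : ℝ, (M + s • (1 : Matrix (Fin q) (Fin q) ℝ)).det = (-M).charpoly.eval s :=
    fun s => by
      rw [Matrix.eval_charpoly, sub_neg_eq_add, add_comm, Matrix.smul_one_eq_diagonal]
      rfl
  have hfin : {s : ℝ | (-M).charpoly.IsRoot s}.Finite :=
    Polynomial.finite_setOfPred_isRoot (Matrix.charpoly_monic _).ne_zero
  have h2 : ({s : ℝ | (-M).charpoly.IsRoot s} \ {0})ᶜ ∈ 𝓝 (0 : ℝ) :=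
    (hfin.subset Set.sdiff_subset).isClosed.isOpen_compl.mem_nhds (by simp)
  filter_upwards [nhdsWithin_le_nhds h2, self_mem_nhdsWithin] with s hs hs0 h0
  exact hs ⟨(h1 s).symm.trans h0, hs0⟩

/-- Perturbing $B$ to $B+sU$ makes $U^TB+sI$ invertible for small $s\ne0$. EM started there
decreases the loss to the optimal value, and $s\to0$ gives the bound, even without the constraint
$B^Tb=0$. -/
theorem optimalLoss_le_lossG (h : SpectralSetting S γ q) (B : Matrix (Fin m) (Fin q) ℝ)
    {ε : ℝ} (hε : 0 < ε) :
    optimalLoss m (fun i : Fin q => γ (Fin.castLE h.lt.le i)) (mlRidge q γ) ≤ lossG S B ε := by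
  obtain ⟨U, hU⟩ := h.exists_isPrincipal
  have h1 : ∀ᶠ s : ℝ in 𝓝[≠] 0,
      optimalLoss m (fun i : Fin q => γ (Fin.castLE h.lt.le i)) (mlRidge q γ)
        ≤ lossG S (B + s • U) ε := by
    filter_upwards [eventually_det_add_smul_ne_zero (Uᵀ * B)] with s hs
    obtain ⟨A, δ, hEM, hA0, hδ0⟩ := exists_isEMSequence S (B + s • U) ε
    have hu : IsUnit (Uᵀ * A 0) := by
      rw [hA0, Matrix.mul_add, Matrix.mul_smul, hU.1, Matrix.isUnit_iff_isUnit_det]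
      exact isUnit_iff_ne_zero.2 hs
    obtain ⟨U', ρ, Y, -, hal⟩ := h.exists_alignedEM hEM (hδ0 ▸ hε) ⟨U, hU, hu⟩
    have := hal.optimalLoss_le 0
    rwa [hA0, hδ0] at this
  have hp : Tendsto (fun s : ℝ => (B + s • U, ε)) (𝓝[≠] 0) (𝓝 (B, ε)) := by
    have hc : Continuous fun s : ℝ => (B + s • U, ε) := by fun_prop
    have := hc.tendsto 0
    rw [zero_smul, add_zero] at this
    exact this.mono_left nhdsWithin_le_nhds
  have h2 := Tendsto.comp (continuousAt_lossG S B hε) hp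
  exact ge_of_tendsto h2 h1

theorem exists_tendsto_isMLSolution (h : SpectralSetting S γ q) (hEM : IsEMSequence S A δ)
    (hδ : 0 < δ 0)
    (hA₀ : ∃ U : Matrix (Fin m) (Fin q) ℝ, IsPrincipal S γ h.lt U ∧ IsUnit (Uᵀ * A 0)) :
    ∃ (A' : Matrix (Fin m) (Fin q) ℝ) (δ' : ℝ), IsMLSolution S γ h.lt A' δ' ∧
      Tendsto A atTop (𝓝 A') ∧ Tendsto δ atTop (𝓝 δ') := by
  obtain ⟨U, ρ, Y, hU, hal⟩ := h.exists_alignedEM hEM hδ hA₀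
  obtain ⟨A', hA', h1, h2⟩ := hal.exists_tendsto
  -- The orthogonal factor is $V=(\Gamma_q-\hat\delta I)^{-1/2}U^TA'$.
  refine ⟨A', _, ⟨rfl, U, diagonal (fun i => (√(γ (Fin.castLE h.lt.le i) - mlRidge q γ))⁻¹)
    * (Uᵀ * A'), hU, ?_, ?_⟩, hA', hal.tendsto_ridge⟩
  · rw [Matrix.mem_orthogonalGroup_iff, Matrix.transpose_mul, Matrix.diagonal_transpose,
      Matrix.mul_assoc, ← Matrix.mul_assoc (Uᵀ * A'), h2, Matrix.diagonal_mul_diagonal,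
      Matrix.diagonal_mul_diagonal, ← Matrix.diagonal_one]
    congr 1
    ext i
    have h3 : 0 < γ (Fin.castLE h.lt.le i) - mlRidge q γ := sub_pos.2 (h.mlRidge_lt i)
    have h4 : 0 < √(γ (Fin.castLE h.lt.le i) - mlRidge q γ) := Real.sqrt_pos.2 h3
    have h5 := Real.mul_self_sqrt h3.le
    field_simp
    nlinarith
  · rw [← Matrix.mul_assoc, Matrix.mul_assoc U, Matrix.diagonal_mul_diagonal]
    have : (diagonal fun i : Fin q => √(γ (Fin.castLE h.lt.le i) - mlRidge q γ) *
        (√(γ (Fin.castLE h.lt.le i) - mlRidge q γ))⁻¹) = 1 := by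
      rw [← Matrix.diagonal_one]
      congr 1
      ext i
      exact mul_inv_cancel₀ (Real.sqrt_pos.2 (sub_pos.2 (h.mlRidge_lt i))).ne'
    rw [this, Matrix.mul_one]
    exact h1

/-- For the $U$ of the limit, $\det(U^TA')\ne0$ because $\hat\delta<\gamma_i$ for all $i\le q$. By
continuity $U^TA_t$ is invertible for some $t$, hence at $t=0$. -/
theorem nondegenerate_of_tendsto (h : SpectralSetting S γ q) (hEM : IsEMSequence S A δ)
    (hδ : 0 < δ 0) {A' : Matrix (Fin m) (Fin q) ℝ} {δ' : ℝ} (hA' : IsMLSolution S γ h.lt A' δ')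
    (hA : Tendsto A atTop (𝓝 A')) :
    ∃ U : Matrix (Fin m) (Fin q) ℝ, IsPrincipal S γ h.lt U ∧ IsUnit (Uᵀ * A 0) := by
  obtain ⟨rfl, U, V, hU, hV, rfl⟩ := hA'
  refine ⟨U, hU, ?_⟩
  rw [Matrix.isUnit_iff_isUnit_det]
  have hc : Continuous fun M : Matrix (Fin m) (Fin q) ℝ => (Uᵀ * M).det := by fun_prop
  have h1 := (hc.tendsto _).comp hA
  rw [Matrix.mul_assoc U, ← Matrix.mul_assoc Uᵀ, hU.1, Matrix.one_mul, Matrix.det_mul,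
    Matrix.det_diagonal] at h1
  have hV1 : V.det ≠ 0 := by
    have := congrArg Matrix.det ((Matrix.mem_orthogonalGroup_iff _ _).1 hV)
    rw [Matrix.det_mul, Matrix.det_one] at this
    exact left_ne_zero_of_mul_eq_one this
  have h2 := h1.eventually_ne (mul_ne_zero (Finset.prod_ne_zero_iff.2 fun i _ =>
    (Real.sqrt_pos.2 (sub_pos.2 (h.mlRidge_lt i))).ne') hV1)
  obtain ⟨t, ht⟩ := h2.exists
  exact (h.isUnit_det_iff hEM hδ hU t).1 (isUnit_iff_ne_zero.2 ht)

end SpectralSetting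

theorem centering_transpose_mulVec {b : Fin m → ℝ} (hb : ∀ i, 0 ≤ b i) :
    (centering b)ᵀ *ᵥ b = 0 := by
  rw [centering]
  split_ifs with h
  · simp [h]
  · have hs : ∑ i, b i ≠ 0 := fun h0 => h (funext fun i =>
      (Finset.sum_eq_zero_iff_of_nonneg fun i _ => hb i).1 h0 i (Finset.mem_univ i))
    have h1 : vecMulVec b (fun _ => (1 : ℝ)) *ᵥ b = (∑ i, b i) • b := by
      rw [Matrix.vecMulVec_mulVec]
      ext i
      simp [dotProduct, mul_comm]
    rw [Matrix.transpose_sub, Matrix.transpose_one, Matrix.transpose_smul,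
      Matrix.transpose_vecMulVec, Matrix.sub_mulVec, Matrix.one_mulVec, Matrix.smul_mulVec, h1,
      smul_smul, inv_mul_cancel₀ hs, one_smul, sub_self]

theorem centered_mulVec {b : Fin m → ℝ} (hb : ∀ i, 0 ≤ b i) (M : Matrix (Fin m) (Fin m) ℝ) :
    centered b M *ᵥ b = 0 := by
  rw [centered, ← Matrix.mulVec_mulVec, centering_transpose_mulVec hb, Matrix.mulVec_zero]

/-- Zero trace would force $S=0$ and then $MH_b^T=0$. So $M=0$, or $M$ is a multiple of $Mb\mathbf
1^T$; either way its rank is at most one. -/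
theorem trace_centered_pos (b : Fin m → ℝ) {M : Matrix (Fin m) (Fin m) ℝ} (hM : M.PosSemidef)
    (hp : 1 < M.rank) : 0 < (centered b M).trace := by
  have hS : (centered b M).PosSemidef := hM.conj _
  refine lt_of_le_of_ne hS.trace_nonneg fun h0 => ?_
  have hS0 : centered b M = 0 := hS.trace_eq_zero_iff.1 h0.symm
  obtain ⟨F, hF⟩ := hM.exists_eq_transpose_mul_self
  have h1 : F * (centering b)ᵀ = 0 := by
    have h2 : ‖F * (centering b)ᵀ‖ ^ 2 = 0 := by
      have : (F * (centering b)ᵀ)ᵀ * (F * (centering b)ᵀ) = centered b M := by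
        rw [centered, hF]; simp [Matrix.mul_assoc]
      rw [frobenius_sq_eq_trace', this, hS0, Matrix.trace_zero]
    exact norm_eq_zero.1 (pow_eq_zero_iff two_ne_zero |>.1 h2)
  have h2 : M * (centering b)ᵀ = 0 := by rw [hF, Matrix.mul_assoc, h1, Matrix.mul_zero]
  rw [centering] at h2
  split_ifs at h2 with h
  · rw [Matrix.transpose_one, Matrix.mul_one] at h2
    rw [h2, Matrix.rank_zero] at hp
    omega
  · rw [Matrix.transpose_sub, Matrix.transpose_one, Matrix.mul_sub, Matrix.mul_one, sub_eq_zero,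
      Matrix.transpose_smul, Matrix.transpose_vecMulVec, Matrix.mul_smul, ← Matrix.smul_mul] at h2
    have h3 : ((∑ i, b i)⁻¹ • M * vecMulVec b fun _ : Fin m => (1 : ℝ)).rank ≤ 1 :=
      (Matrix.rank_mul_le_right _ _).trans (Matrix.rank_vecMulVec_le b fun _ : Fin m => (1 : ℝ))
    rw [← h2] at h3
    omega

end MaximumLikelihood

theorem theorem2 {m q : ℕ} (b : Fin m → ℝ) (hb : ∀ i, 0 ≤ b i)
    (M : Matrix (Fin m) (Fin m) ℝ) (hM : M.PosSemidef) (hp : 1 < M.rank)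
    (hqm : q < m) (hqp : q < M.rank)
    (A : ℕ → Matrix (Fin m) (Fin q) ℝ) (δ : ℕ → ℝ)
    (hEM : IsEMSequence (centered b M) A δ)
    (hδ : 0 < δ 0) (hA : (A 0)ᵀ *ᵥ b = 0) :
    -- the constraint and the positivity persist, and the inverses in the updates exist
    (∀ t, (A t)ᵀ *ᵥ b = 0 ∧ 0 < δ t ∧
      IsUnit (emSigma (A t) (δ t)) ∧ IsUnit (emGain (centered b M) (A t) (δ t))) ∧
    -- for ordered eigenvalues `γ` of `S` with `γ_q > γ_j > 0` for some `j > q`: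
    (∀ γ : Fin m → ℝ, IsOrderedEigenvalues (centered b M) γ →
      (∃ i j : Fin m, (i : ℕ) + 1 = q ∧ q ≤ (j : ℕ) ∧ 0 < γ j ∧ γ j < γ i) →
      -- the closed-form solutions are the maximum-likelihood estimates,
      (∀ (A' : Matrix (Fin m) (Fin q) ℝ) (δ' : ℝ),
        IsMLSolution (centered b M) γ hqm A' δ' →
          (A', δ') ∈ feasible q b ∧
          IsMinOn (fun x => lossG (centered b M) x.1 x.2) (feasible q b) (A', δ')) ∧
      -- and the iterates converge to such a solution exactly from non-degenerate initial matrices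
      ((∃ U : Matrix (Fin m) (Fin q) ℝ,
          IsPrincipal (centered b M) γ hqm U ∧ IsUnit (Uᵀ * A 0)) ↔
        ∃ (A' : Matrix (Fin m) (Fin q) ℝ) (δ' : ℝ),
          IsMLSolution (centered b M) γ hqm A' δ' ∧
          Tendsto A atTop (𝓝 A') ∧ Tendsto δ atTop (𝓝 δ'))) := by
  have hS : (centered b M).PosSemidef := hM.conj _
  have htr := trace_centered_pos b hM hp
  have hSb := centered_mulVec hb M
  have hδt := hEM.ridge_pos hS htr hδ
  refine ⟨fun t => ⟨?_, hδt t, (emSigma_posDef (A t) (hδt t)).isUnit,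
    emGain_isUnit hS (A t) (hδt t)⟩, fun γ hγ hgap => ?_⟩
  · cases t with
    | zero => exact hA
    | succ t =>
      rw [hEM.step_A t, Matrix.transpose_mul, Matrix.transpose_mul, hS.transpose_eq,
        ← Matrix.mulVec_mulVec, ← Matrix.mulVec_mulVec, hSb, Matrix.mulVec_zero, Matrix.mulVec_zero]
  · have h : SpectralSetting (centered b M) γ q := ⟨hS, hγ, hqm, hgap⟩
    refine ⟨fun A' δ' hA' => ⟨⟨?_, ?_⟩, ?_⟩, fun hA₀ => h.exists_tendsto_isMLSolution hEM hδ hA₀,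
      fun ⟨A', δ', hA', hlim, _⟩ => h.nondegenerate_of_tendsto hEM hδ hA' hlim⟩
    · obtain ⟨-, U, V, hU, -, rfl⟩ := hA'
      -- From $\Gamma_qU^Tb=U^TSb=0$ and the positivity of the leading eigenvalues, $U^Tb=0$.
      have h1 := congrArg (fun N => N *ᵥ b) (transpose_mul_eq_diagonal_mul hS hU.2)
      simp only [← Matrix.mulVec_mulVec, hSb, Matrix.mulVec_zero] at h1
      have h2 : Uᵀ *ᵥ b = 0 := by
        ext i
        have h3 := congrFun h1 i
        rw [Matrix.mulVec_diagonal] at h3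
        exact (mul_eq_zero.1 h3.symm).resolve_left (h.leading_pos i).ne'
      simp only [Matrix.transpose_mul, ← Matrix.mulVec_mulVec, h2, Matrix.mulVec_zero]
    · rw [hA'.1]
      exact h.mlRidge_pos
    · rintro ⟨B, ε⟩ hB
      change lossG (centered b M) A' δ' ≤ lossG (centered b M) B ε
      rw [h.lossG_eq_of_isMLSolution hA']
      exact h.optimalLoss_le_lossG B hB.2
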